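/- **Zero-momenta Ward identity.** Let $d\ge 4$, $\eta=(d-1)/4$, and for $\vec p\in\mathbb Z^d$ write $\vec p^{\,2\eta}=\sum_i|p_i|^{2\eta}$. Consider the tensor field theory with fields $T_{\vec p},\bar T_{\vec p}$, propagator $C(\vec p)=\Theta(\Lambda^{2\eta}-\vec p^{\,2\eta})/(\vec p^{\,2\eta}+m^{2\eta})$ and interaction $\lambda\sum_{i=1}^d\sum\mathcal V^{(i)}_{\vec p_1\vec p_2\vec p_3\vec p_4}T_{\vec p_1}\bar T_{\vec p_2}T_{\vec p_3}\bar T_{\vec p_4}$, where $\mathcal V^{(i)}_{\vec p_1\vec p_2\vec p_3\vec p_4}=\delta_{p_{1i}p_{4i}}\delta_{p_{2i}p_{3i}}\prod_{j\ne i}\delta_{p_{1j}p_{2j}}\delta_{p_{3j}p_{4j}}$. All functions below are formal power series in $\lambda$: a sum over graphs means $\sum_n\frac{(-\lambda)^n}{n!}\sum(\text{amputated amplitudes of the Wick contractions with } n \text{ vertices})$. A vacuum graph is melonic if its intermediate field representation (one edge for each vertex, one node for each cycle of propagators) is a tree. The melonic self energy $\Sigma(\vec p)$ is the sum over the 1PI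 two-point graphs obtained from melonic vacuum graphs by cutting one line, $\tau$ is its part in which the external lines are attached to a vertex of a fixed colour $i$ (at $i$-th external momentum component $p$, the others being $0$), and $\Gamma^{(2)}(\vec p)=\vec p^{\,2\eta}+m^{2\eta}-\Sigma(\vec p)$. The four-point function $\gamma^{(4)}$ is minus the sum, at zero external momenta, over the 1PI four-point graphs obtained from melonic vacuum graphs by cutting two lines which lie on a common face of colour $i$. Put $$\mathcal L=\sum_{\vec q}\delta_{q_i0}\,[\Gamma^{(2)}(\vec q)]^{-2},$$ the sum being over $\vec q^{\,2\eta}\le\Lambda^{2\eta}$, and, for $a>0$, with $\delta_w(x)=e^{-x^2/w^2}/(w\sqrt\pi)$, $\theta_w(x)=\int_{-\infty}^x\delta_w$ and $w=a\Lambda^{2\eta}$, $$B_a=\sum_{\vec q}\delta_{q_i0}\,(\vec q^{\,2\eta}+m^{2\eta})\,\big[\vec q^{\,2\eta}+m^{2\eta}-\theta_w(\Lambda^{2\eta}-\vec q^{\,2\eta})\,\Sigma(\vec q)\big]^{-2}\,\delta_w(\Lambda^{2\eta}-\vec q^{\,2\eta}).$$ Then $\Sigma(\vec p)=\sum_{j=1}^d\tau(p_j)$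 for all $\Lambda>0$. Moreover, for every fixed $\bar m>0$, in the continuum limit $\Lambda\to\infty$ with $m=\bar m\Lambda$, the following limits exist at every order in $\lambda$: those of $\gamma^{(4)}$ and $\mathcal L$ (the limit of $\mathcal L$ is invertible, i.e. has nonzero order-$0$ term); the limit $\bar\tau(x)$ of $\Lambda^{-2\eta}\tau(\lfloor\Lambda x\rfloor)$ for every $x\in\mathbb R$; the derivative $\tau'(0)=\partial\bar\tau/\partial|x|^{2\eta}$ at $x=0$; for each $a>0$, the limit of $B_a$ as $\Lambda\to\infty$ (the sum $B_a$ converges absolutely order by order); and the limit of the latter as $a\to0^+$, which is denoted $\mathcal L\,\partial\tau$ and is the meaning given to $\sum_{\vec q}\delta_{q_i0}(\vec q^{\,2\eta}+m^{2\eta})[\Gamma^{(2)}(\vec q)]^{-2}\delta(\Lambda^{2\eta}-\vec q^{\,2\eta})$. These limits satisfy, to all orders in $\lambda$, $$\tfrac12\,\gamma^{(4)}\,\mathcal L\,(1+\partial\tau)=\tau'(0).$$ -/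

import Mathlib

open Filter Topology

noncomputable section

namespace TGFT

/-! ### The model: rank `d` tensors over `U(1)`, quartic melonic interactions -/

/-- The exponent `η = (d - 1) / 4`, for which the rank `d` model is just renormalizable. -/
def eta (d : ℕ) : ℝ := ((d : ℝ) - 1) / 4

/-- `p^{2η} = ∑ᵢ |pᵢ|^{2η}`. -/
def momentumPow (d : ℕ) (p : Fin d → ℤ) : ℝ := ∑ i, |(p i : ℝ)| ^ (2 * eta d)

/-- The kinetic kernel `p^{2η} + m^{2η}`. -/
def kinetic (d : ℕ) (m : ℝ) (p : Fin d → ℤ) : ℝ := momentumPow d p + m ^ (2 * eta d)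

/-- The momentum `p` is below the sharp cutoff: `p^{2η} ≤ Λ^{2η}`. -/
def BelowCutoff (d : ℕ) (Λ : ℝ) (p : Fin d → ℤ) : Prop := momentumPow d p ≤ Λ ^ (2 * eta d)

open Classical in
/-- The bare propagator `Θ(Λ^{2η} - p^{2η}) / (p^{2η} + m^{2η})`. -/
def propagator (d : ℕ) (Λ m : ℝ) (p : Fin d → ℤ) : ℝ :=
  if BelowCutoff d Λ p then (kinetic d m p)⁻¹ else 0

/-- The vertex tensor of colour `i`, contracted with `T_{p₁} T̄_{p₂} T_{p₃} T̄_{p₄}`: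
`δ_{p₁ᵢ p₄ᵢ} δ_{p₂ᵢ p₃ᵢ} ∏_{j ≠ i} δ_{p₁ⱼ p₂ⱼ} δ_{p₃ⱼ p₄ⱼ}`. -/
def vertexTensor {d : ℕ} (i : Fin d) (p₁ p₂ p₃ p₄ : Fin d → ℤ) : ℝ :=
  (if p₁ i = p₄ i then 1 else 0) * (if p₂ i = p₃ i then 1 else 0) *
    ∏ j ∈ Finset.univ.erase i,
      (if p₁ j = p₂ j then (1 : ℝ) else 0) * (if p₃ j = p₄ j then 1 else 0)

/-! ### Feynman graphs as Wick contractions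

A graph with `2N` external lines and `n` vertices is a colouring `c : Fin n → Fin d` of the
vertices together with a Wick contraction, that is a bijection from the fields `T` to the fields
`T̄`. Both kinds of fields are indexed by `Leg N n`: `inl e` is the external `T` (resp. `T̄`)
number `e`, `inr (v, false)` is the field `T_{p₁}` (resp. `T̄_{p₂}`) of the vertex `v`, and
`inr (v, true)` is its field `T_{p₃}` (resp. `T̄_{p₄}`). -/

/-- Labels of the fields `T`, and of the fields `T̄`. -/
abbrev Leg (N n : ℕ) := Fin N ⊕ (Fin n × Bool)

/-- A Wick contraction: the field `T` labelled `x` is contracted with the `T̄` labelled `σ x`. -/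
abbrev Wick (N n : ℕ) := Equiv.Perm (Leg N n)

section Graphs

variable {d N n : ℕ}

/-- The factor of the line that starts at the field `T` labelled `x`: the bare propagator for an
internal line, `1` for an external line (external lines are amputated). -/
def lineFactor (Λ m : ℝ) (σ : Wick N n) (k : Leg N n → Fin d → ℤ) (x : Leg N n) : ℝ :=
  if x.isRight ∧ (σ x).isRight then propagator d Λ m (k x) else 1

open Classical in
/-- The amputated amplitude of a graph, by the Feynman rules: a sum over the momenta `k x` of the
lines (the line `x` starts at the field `T` labelled `x`), with the vertex tensor at each vertex and
the propagator on each internal line. The external `T` number `e` has momentum `q e`, the external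
`T̄` number `e` has momentum `p e`. The cutoff leaves finitely many nonzero terms. -/
def amplitude (Λ m : ℝ) (c : Fin n → Fin d) (σ : Wick N n) (q p : Fin N → Fin d → ℤ) : ℝ :=
  ∑ᶠ k : Leg N n → Fin d → ℤ,
    if ∀ e, k (.inl e) = q e ∧ k (σ.symm (.inl e)) = p e then
      (∏ v, vertexTensor (c v) (k (.inr (v, false))) (k (σ.symm (.inr (v, false))))
        (k (.inr (v, true))) (k (σ.symm (.inr (v, true))))) * ∏ x, lineFactor Λ m σ k x
    else 0

/-- The graph on the vertices given by the internal lines, except for the lines that start at the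
fields `T` in `cut`. -/
def vertexGraph (σ : Wick N n) (cut : Set (Fin n × Bool)) : SimpleGraph (Fin n) :=
  SimpleGraph.fromRel fun v w =>
    ∃ b b', (v, b) ∉ cut ∧ σ (.inr (v, b)) = .inr (w, b')

/-- One-particle irreducible: connected (every external line ends at a vertex, and there is at least
one vertex), and still connected after the deletion of any one line. -/
def IsOnePI (σ : Wick N n) : Prop :=
  (∀ e e', σ (.inl e) ≠ .inl e') ∧ (vertexGraph σ ∅).Connected ∧
    ∀ h, (vertexGraph σ {h}).Connected

/-- The vacuum graph obtained by gluing the external `T̄` number `e` to the external `T` number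
`π e`. The label `inl (π e)` remains as a mark on the glued line. -/
def close (π : Equiv.Perm (Fin N)) (σ : Wick N n) : Equiv.Perm (Leg N n) :=
  σ.trans (Equiv.sumCongr π (Equiv.refl _))

/-- The loop-vertices of the intermediate field representation of a vacuum graph: the cycles
(fixed points included) made of lines and of corners `T̄_{p₂} T_{p₁}` or `T̄_{p₄} T_{p₃}`. -/
abbrev LoopVertex (ρ : Equiv.Perm (Leg N n)) := Quotient (Equiv.Perm.SameCycle.setoid ρ)

/-- The intermediate field representation: each vertex of the Feynman graph becomes an edge, between
the loop-vertices that contain its two corners. -/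
def intermediateGraph (ρ : Equiv.Perm (Leg N n)) : SimpleGraph (LoopVertex ρ) :=
  SimpleGraph.fromRel fun a b =>
    ∃ v : Fin n, a = Quotient.mk _ (.inr (v, false)) ∧ b = Quotient.mk _ (.inr (v, true))

/-- The intermediate field representation, with its `n` edges counted with multiplicity, is a
tree: it is connected and has `n + 1` loop-vertices. -/
def IsTree (ρ : Equiv.Perm (Leg N n)) : Prop :=
  (intermediateGraph ρ).Connected ∧ Nat.card (LoopVertex ρ) = n + 1

/-- The strands of colour `j` at the vertices: from the field `T̄` labelled `y` to a field `T`. At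
a vertex of colour `j` they join the two corners, elsewhere they stay at the corner. -/
def strand (c : Fin n → Fin d) (j : Fin d) : Leg N n → Leg N n
  | .inl e => .inl e
  | .inr (v, b) => .inr (v, if c v = j then !b else b)

/-- The marks `e` and `e'` lie on the same face of colour `j` of the vacuum graph `ρ`: following
alternately the lines and the strands of colour `j` leads from `e` to `e'`. -/
def OnSameFace (c : Fin n → Fin d) (j : Fin d) (ρ : Equiv.Perm (Leg N n)) (e e' : Fin N) : Prop :=
  ∃ t : ℕ, (fun x => strand c j (ρ x))^[t] (.inl e) = .inl e'

/-- A melonic graph whose heart external faces have colour `i`: it is obtained by cutting lines of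
a vacuum graph which is a tree in the intermediate field representation, where all the lines that
are cut lie on one face of colour `i`. -/
def IsMelonic (c : Fin n → Fin d) (i : Fin d) (σ : Wick N n) : Prop :=
  ∃ π : Equiv.Perm (Fin N), IsTree (close π σ) ∧ ∀ e e', OnSameFace c i (close π σ) e e'

end Graphs

/-! ### Melonic functions, as formal power series in the coupling `λ` (the variable `X`) -/

open Classical in
/-- Sum of the amputated 1PI melonic graphs with `2N` external lines and with heart faces of colour
`i`, that is `∑ₙ (-λ)ⁿ / n! ∑ (amplitudes of the Wick contractions with n vertices)`. For `N = 1` the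
face condition holds for every `i`; `i` has then to be the colour of the vertex of the external `T`. -/
def melonicSum (d N : ℕ) (i : Fin d) (Λ m : ℝ) (q p : Fin N → Fin d → ℤ) : PowerSeries ℝ :=
  PowerSeries.mk fun n => (-1) ^ n / (n.factorial : ℝ) *
    ∑ c : Fin n → Fin d, ∑ σ : Wick N n,
      if IsOnePI σ ∧ IsMelonic c i σ ∧
          ∀ e v b, σ (.inl e) = .inr (v, b) → c v = i then
        amplitude Λ m c σ q p
      else 0

open Classical in
/-- The melonic self energy `Σ(p)`: the sum of all the amputated 1PI melonic graphs with two external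
lines (a tree with one cut line). -/
def selfEnergy (d : ℕ) (Λ m : ℝ) (p : Fin d → ℤ) : PowerSeries ℝ :=
  PowerSeries.mk fun n => (-1) ^ n / (n.factorial : ℝ) *
    ∑ c : Fin n → Fin d, ∑ σ : Wick 1 n,
      if IsOnePI σ ∧ IsTree σ then amplitude Λ m c σ (fun _ => p) (fun _ => p) else 0

/-- The one-colour part `τ` of the melonic self energy: the graphs whose boundary vertex has
colour `i`, at the external momentum with `i`-th component `p` and other components `0`. -/
def tau (d : ℕ) (i : Fin d) (Λ m : ℝ) (p : ℤ) : PowerSeries ℝ :=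
  melonicSum d 1 i Λ m (fun _ => Pi.single i p) (fun _ => Pi.single i p)

/-- The melonic two-point function `Γ⁽²⁾(p) = p^{2η} + m^{2η} - Σ(p)`. -/
def gammaTwo (d : ℕ) (Λ m : ℝ) (p : Fin d → ℤ) : PowerSeries ℝ :=
  PowerSeries.C (kinetic d m p) - selfEnergy d Λ m p

/-- The zero-momentum 1PI melonic four-point function `γ⁽⁴⁾` (of colour `i`). In terms of `Γ⁽⁴⁾` the
connected four-point function is `-Γ⁽⁴⁾ G G G G`, whence the sign. -/
def gammaFour (d : ℕ) (i : Fin d) (Λ m : ℝ) : PowerSeries ℝ :=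
  -melonicSum d 2 i Λ m 0 0

open Classical in
/-- The loop `𝓛 = ∑_q δ_{qᵢ 0} Γ⁽²⁾(q)⁻²`, over the momenta below the cutoff. -/
def loop (d : ℕ) (i : Fin d) (Λ m : ℝ) : PowerSeries ℝ :=
  ∑ᶠ q : Fin d → ℤ, if q i = 0 ∧ BelowCutoff d Λ q then ((gammaTwo d Λ m q)⁻¹) ^ 2 else 0

/-! ### The boundary term of the sharp cutoff -/

/-- The Gaussian approximation of width `a` of the Dirac function. -/
def deltaReg (a x : ℝ) : ℝ := Real.exp (-(x ^ 2 / a ^ 2)) / (a * √Real.pi)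

/-- The corresponding approximation `∫_{-∞}^x δ_a` of the Heaviside function. -/
def thetaReg (a x : ℝ) : ℝ := ∫ y in Set.Iic x, deltaReg a y

/-- The term of momentum `q` of `𝓛 ∂τ = ∑_q δ_{qᵢ 0} (q^{2η} + m^{2η}) Γ⁽²⁾(q)⁻² δ(Λ^{2η} - q^{2η})`,
with `δ` regularized at the width `a Λ^{2η}`. The function `Γ⁽²⁾` jumps at the cutoff, and is
regularized accordingly: it is `q^{2η} + m^{2η} - θ(Λ^{2η} - q^{2η}) Σ(q)` with `θ' = δ`. -/
def boundaryTerm (d : ℕ) (i : Fin d) (Λ m a : ℝ) (q : Fin d → ℤ) : PowerSeries ℝ :=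
  let w := a * Λ ^ (2 * eta d)
  let x := Λ ^ (2 * eta d) - momentumPow d q
  if q i = 0 then
    PowerSeries.C (kinetic d m q * deltaReg w x) *
      ((PowerSeries.C (kinetic d m q) -
        PowerSeries.C (thetaReg w x) * selfEnergy d Λ m q)⁻¹) ^ 2
  else 0

/-- Convergence of formal power series, order by order in the coupling. -/
def TendstoCoeff {α : Type*} (f : α → PowerSeries ℝ) (F : Filter α) (l : PowerSeries ℝ) : Prop :=
  ∀ n, Tendsto (fun x => PowerSeries.coeff n (f x)) F (𝓝 (PowerSeries.coeff n l))

end TGFT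

end

/-! Combinatorics. In the intermediate field representation a vertex is an edge, and an external
mark roots the tree and fixes an order at every loop-vertex. A Wick contraction whose representation
is a tree is therefore the same as a rooted plane tree with labelled and oriented edges
(`exists_follows`, `Follows.eq`, `Complete.exists_perm`). The factor `1/n!` removes the labels
(`sum_eq_factorial_mul_sum`). Momentum conservation leaves one momentum per loop-vertex, and two
adjacent loop-vertices share the component of the colour of their edge (`Complete.amplitude_eq`). A
graph is 1PI when the root carries a single edge and any other mark is alone in its loop-vertex.

Write `C` for the bare and `G` for the full melonic propagator. Detaching the first edge at the root
gives `G = C (1 + Σ G)` with `Σ(p) = ∑ⱼ τ(pⱼ)` and `τ(s) = -2λ ∑_{qᵢ = s} G(q)`, where the 2 counts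
the orientations of the edge. The same decomposition along the path of edges of colour `i` between
two marks is a linear equation for the chain of loops on the heart face. It gives `γ⁽⁴⁾ (1 + 2λ𝓛) =
4λ`, exactly and at finite cutoff (`gammaFour_mul`).

Continuum. Since `4η = d - 1`, lattice sums in units of the cutoff are integrals over `ℝ^(d-1)` of
functions of integer parts. Order `n + 1` of `τ` is an integral over orders at most `n`, so uniform
bounds, limits and continuity follow by induction on the order and dominated convergence
(`continuous_and_tendsto_tauLim`). In the limit, `τ(x) = -2λ ∫ G_x(u) du` over `|x|^{2η} + g(u) ≤
1`, where `g(u) = ∑ |uⱼ|^{2η}`.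

Derivative. Put `s = |x|^{2η}`. When `x` leaves 0 the domain loses the shell `1 - s < g ≤ 1`, while
the integrand changes by `G_x G_0 (τ(x) - τ(0) - s)`, the resolvent identity. Division by `s` gives
`τ' = -2λ (𝓛 (τ' - 1) - b)`, where `b` is the integral of `G_0` over the boundary `g = 1`
(`tendsto_derivative`). Hence `τ' (1 + 2λ𝓛) = 2λ (𝓛 + b)`, and with the formula for `γ⁽⁴⁾` this is
the Ward identity, provided that `b = 𝓛 ∂τ`.

Boundary term. With `c = p^{2η} + m^{2η}`, the function `c (c - θΣ)⁻²` is the `θ`-derivative of `θ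
(c - θΣ)⁻¹`. Integrated against `δ = θ'` across the boundary it yields `(c - Σ)⁻¹ = G_0`. Order by
order, a factor `j + 1` cancels `∫ θ^j δ = 1/(j + 1)` (`exists_boundary_dressed`). The shell and the
smeared layer are compared in the polar coordinates of the `ℓ^{2η}` norm (`exists_boundary`). -/

namespace TGFT

open Finset.HasAntidiagonal (antidiagonal mem_antidiagonal)

/-! ### Plane trees and their parsing -/

/-- Plane trees with labels in `A` at the edges, each with an orientation, and marks in `M`.
In `node a b t s`, the tree `t` hangs from the edge `a` and `s` is the rest of the tree. -/
inductive PlaneTree (A M : Type) : Type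
  | leaf : PlaneTree A M
  | node (a : A) (b : Bool) (t s : PlaneTree A M) : PlaneTree A M
  | mark (e : M) (t : PlaneTree A M) : PlaneTree A M

namespace PlaneTree

variable {A B M : Type}

/-- The labels, in depth first order. -/
def labels : PlaneTree A M → List A
  | leaf => []
  | node a _ t s => a :: (t.labels ++ s.labels)
  | mark _ t => t.labels

/-- The marks, in depth first order. -/
def marks : PlaneTree A M → List M
  | leaf => []
  | node _ _ t s => t.marks ++ s.marks
  | mark e t => e :: t.marks

/-- Relabelling. -/
def map (f : A → B) : PlaneTree A M → PlaneTree B M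
  | leaf => leaf
  | node a b t s => node (f a) b (t.map f) (s.map f)
  | mark e t => mark e (t.map f)

theorem labels_map (f : A → B) (t : PlaneTree A M) : (t.map f).labels = t.labels.map f := by
  induction t with
  | leaf => rfl
  | node a b t s ht hs => simp [map, labels, ht, hs]
  | mark e t ht => simp [map, labels, ht]

theorem marks_map (f : A → B) (t : PlaneTree A M) : (t.map f).marks = t.marks := by
  induction t with
  | leaf => rfl
  | node a b t s ht hs => simp [map, marks, ht, hs]
  | mark e t ht => simp [map, marks, ht]

variable {N n : ℕ}

/-- The corners and marks of a tree. -/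
def inner : PlaneTree (Fin n) (Fin N) → List (Leg N n)
  | leaf => []
  | node v b t s => .inr (v, b) :: .inr (v, !b) :: (t.inner ++ s.inner)
  | mark e t => .inl e :: t.inner

/-- The lines of the graph of a tree, from the field `T` labelled `x` to the field `T̄`
labelled `y`. -/
def steps : PlaneTree (Fin n) (Fin N) → Leg N n → Leg N n → List (Leg N n × Leg N n)
  | leaf, x, y => [(x, y)]
  | node v b t s, x, y =>
    (x, .inr (v, b)) :: (t.steps (.inr (v, !b)) (.inr (v, !b)) ++ s.steps (.inr (v, b)) y)
  | mark e t, x, y => (x, .inl e) :: t.steps (.inl e) y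

/-- A node adds its near corner to the current cycle and its far corner as the base of a new closed
cycle, so every label of the tree is left once. Together with `steps_snd_perm` this makes the steps
of a complete tree, with `x = y`, the graph of a permutation. -/
theorem steps_fst_perm (t : PlaneTree (Fin n) (Fin N)) (x y : Leg N n) :
    ((t.steps x y).map Prod.fst).Perm (x :: t.inner) := by
  induction t generalizing x y with
  | leaf => simp [steps, inner]
  | node v b t s ht hs =>
    simp only [steps, inner, List.map_cons, List.map_append]
    exact List.Perm.cons _ (((ht _ _).append (hs _ _)).trans List.perm_middle)
  | mark e t ht =>
    simp only [steps, inner, List.map_cons]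
    exact (ht _ _).cons _

theorem steps_snd_perm (t : PlaneTree (Fin n) (Fin N)) (x y : Leg N n) :
    ((t.steps x y).map Prod.snd).Perm (y :: t.inner) := by
  induction t generalizing x y with
  | leaf => simp [steps, inner]
  | node v b t s ht hs =>
    simp only [steps, inner, List.map_cons, List.map_append]
    exact (List.Perm.cons _ (((ht _ _).append (hs _ _)).trans List.perm_middle)).trans
      (List.Perm.swap _ _ _)
  | mark e t ht =>
    simp only [steps, inner, List.map_cons]
    exact ((ht _ _).cons _).trans (List.Perm.swap _ _ _)

theorem inr_mem_inner (t : PlaneTree (Fin n) (Fin N)) (v : Fin n) (b : Bool) :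
    (.inr (v, b) : Leg N n) ∈ t.inner ↔ v ∈ t.labels := by
  induction t with
  | leaf => simp [inner, labels]
  | node w b' t s ht hs =>
    simp only [inner, labels, List.mem_cons, List.mem_append, ht, hs, Sum.inr.injEq, Prod.mk.injEq]
    cases b <;> cases b' <;> simp
  | mark e t ht => simp [inner, labels, ht]

theorem inl_mem_inner (t : PlaneTree (Fin n) (Fin N)) (e : Fin N) :
    (.inl e : Leg N n) ∈ t.inner ↔ e ∈ t.marks := by
  induction t with
  | leaf => simp [inner, marks]
  | node w b' t s ht hs => simp [inner, marks, ht, hs]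
  | mark e t ht => simp [inner, marks, ht]

theorem nodup_inner_left {v : Fin n} {b : Bool} {t s : PlaneTree (Fin n) (Fin N)}
    (h : (node v b t s).inner.Nodup) : (.inr (v, !b) :: t.inner : List (Leg N n)).Nodup :=
  h.sublist (List.Sublist.cons _ (List.Sublist.cons_cons _ (List.sublist_append_left _ _)))

theorem nodup_inner_right {v : Fin n} {b : Bool} {t s : PlaneTree (Fin n) (Fin N)}
    (h : (node v b t s).inner.Nodup) : (.inr (v, b) :: s.inner : List (Leg N n)).Nodup :=
  h.sublist (List.Sublist.cons_cons _ (List.Sublist.cons _ (List.sublist_append_right _ _)))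

theorem nodup_inner_cons_right {v : Fin n} {b : Bool} {t s : PlaneTree (Fin n) (Fin N)}
    {y : Leg N n} (h : (y :: (node v b t s).inner).Nodup) : (y :: s.inner).Nodup :=
  h.sublist (List.Sublist.cons_cons _
    (List.Sublist.cons _ (List.Sublist.cons _ (List.sublist_append_right _ _))))

/-- The Wick contraction `ρ` follows the tree `t`, from `x` to `y`. -/
def Follows (ρ : Equiv.Perm (Leg N n)) (t : PlaneTree (Fin n) (Fin N)) (x y : Leg N n) : Prop :=
  ∀ s ∈ t.steps x y, ρ s.1 = s.2

section Follows

variable {ρ : Equiv.Perm (Leg N n)} {x y : Leg N n}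

@[simp] theorem follows_leaf : Follows ρ leaf x y ↔ ρ x = y := by simp [Follows, steps]

@[simp] theorem follows_node {v : Fin n} {b : Bool} {t s : PlaneTree (Fin n) (Fin N)} :
    Follows ρ (node v b t s) x y ↔ ρ x = .inr (v, b) ∧
      Follows ρ t (.inr (v, !b)) (.inr (v, !b)) ∧ Follows ρ s (.inr (v, b)) y := by
  simp only [Follows, steps, List.mem_cons, List.mem_append]
  constructor
  · intro h
    exact ⟨h _ (.inl rfl), fun s hs => h s (.inr (.inl hs)), fun s hs => h s (.inr (.inr hs))⟩
  · rintro ⟨h1, h2, h3⟩ s (rfl | hs | hs)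
    exacts [h1, h2 s hs, h3 s hs]

@[simp] theorem follows_mark {e : Fin N} {t : PlaneTree (Fin n) (Fin N)} :
    Follows ρ (mark e t) x y ↔ ρ x = .inl e ∧ Follows ρ t (.inl e) y := by
  simp only [Follows, steps, List.mem_cons]
  constructor
  · intro h
    exact ⟨h _ (.inl rfl), fun s hs => h s (.inr hs)⟩
  · rintro ⟨h1, h2⟩ s (rfl | hs)
    exacts [h1, h2 s hs]

/-- The tree can be read off the contraction: the value `ρ x` decides the next constructor. That `y`
differs from the inner labels is what identifies the end of the cycle with `leaf`. -/
theorem Follows.eq {t t' : PlaneTree (Fin n) (Fin N)} (h : Follows ρ t x y)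
    (h' : Follows ρ t' x y) (hn : (y :: t.inner).Nodup) (hn' : (y :: t'.inner).Nodup) : t = t' := by
  induction t generalizing t' x y with
  | leaf =>
    rw [follows_leaf] at h
    cases t' with
    | leaf => rfl
    | node v b t s => simp_all [inner]
    | mark e t => simp_all [inner]
  | node v b t s ht hs =>
    rw [follows_node] at h
    cases t' with
    | leaf => simp_all [inner]
    | node w b' t' s' =>
      rw [follows_node] at h'
      have := h.1.symm.trans h'.1
      simp only [Sum.inr.injEq, Prod.mk.injEq] at this
      obtain ⟨rfl, rfl⟩ := this
      rw [ht h.2.1 h'.2.1 (nodup_inner_left hn.of_cons) (nodup_inner_left hn'.of_cons),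
        hs h.2.2 h'.2.2 (nodup_inner_cons_right hn) (nodup_inner_cons_right hn')]
    | mark e t => simp_all
  | mark e t ht =>
    rw [follows_mark] at h
    cases t' with
    | leaf => simp_all [inner]
    | node w b' t' s' => simp_all
    | mark e' t' =>
      rw [follows_mark] at h'
      have := h.1.symm.trans h'.1
      simp only [Sum.inl.injEq] at this
      subst this
      simp only [inner, List.nodup_cons, List.mem_cons, not_or] at hn hn'
      rw [ht h.2 h'.2 (by simp_all) (by simp_all)]

end Follows

/-- Every corner and every mark occurs exactly once in the tree `t` with root `x`. -/
def Complete (t : PlaneTree (Fin n) (Fin N)) (x : Leg N n) : Prop :=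
  (x :: t.inner).Nodup ∧ ∀ a, a ∈ x :: t.inner

theorem Complete.perm_unique {t : PlaneTree (Fin n) (Fin N)} {x : Leg N n} (h : t.Complete x)
    {ρ ρ' : Equiv.Perm (Leg N n)} (hρ : Follows ρ t x x) (hρ' : Follows ρ' t x x) : ρ = ρ' := by
  ext1 a
  have := (steps_fst_perm t x x).mem_iff.2 (h.2 a)
  obtain ⟨s, hs, rfl⟩ := List.mem_map.1 this
  rw [hρ s hs, hρ' s hs]

theorem exists_fun_of_nodup {α β : Type*} (l : List (α × β)) (hl : (l.map Prod.fst).Nodup)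
    (hl' : ∀ a, a ∈ l.map Prod.fst) : ∃ f : α → β, ∀ s ∈ l, f s.1 = s.2 := by
  have : ∀ a, ∃ b, (a, b) ∈ l := fun a => by
    obtain ⟨⟨a, b⟩, hs, rfl⟩ := List.mem_map.1 (hl' a)
    exact ⟨b, hs⟩
  choose f hf using this
  refine ⟨f, fun s hs => ?_⟩
  have := List.inj_on_of_nodup_map hl (hf s.1) hs rfl
  exact congrArg Prod.snd this

theorem Complete.exists_perm {t : PlaneTree (Fin n) (Fin N)} {x : Leg N n} (h : t.Complete x) :
    ∃ ρ : Equiv.Perm (Leg N n), Follows ρ t x x := by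
  have h1 := steps_fst_perm t x x
  have h2 := steps_snd_perm t x x
  obtain ⟨f, hf⟩ := exists_fun_of_nodup (t.steps x x) (h1.nodup_iff.2 h.1)
    fun a => h1.mem_iff.2 (h.2 a)
  have hs : Function.Surjective f := fun a => by
    obtain ⟨s, hs, rfl⟩ := List.mem_map.1 (h2.mem_iff.2 (h.2 a))
    exact ⟨_, hf s hs⟩
  exact ⟨Equiv.ofBijective f (Finite.injective_iff_bijective.1 (Finite.injective_iff_surjective.2 hs)),
    hf⟩

end PlaneTree

/-! ### Contractions with a tree representation are those that follow a complete plane tree -/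

namespace PlaneTree

variable {N n : ℕ}

theorem mk_apply (ρ : Equiv.Perm (Leg N n)) (a : Leg N n) :
    (Quotient.mk _ (ρ a) : LoopVertex ρ) = Quotient.mk _ a :=
  Quotient.sound (Equiv.Perm.sameCycle_apply_left.2 (Equiv.Perm.SameCycle.refl _ _))

theorem intermediateGraph_reachable (ρ : Equiv.Perm (Leg N n)) (v : Fin n) (b : Bool) :
    (intermediateGraph ρ).Reachable (Quotient.mk _ (.inr (v, b))) (Quotient.mk _ (.inr (v, !b))) := by
  by_cases h : (Quotient.mk _ (.inr (v, b)) : LoopVertex ρ) = Quotient.mk _ (.inr (v, !b))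
  · rw [h]
  · refine SimpleGraph.Adj.reachable ((SimpleGraph.fromRel_adj _ _ _).2 ⟨h, ?_⟩)
    cases b
    · exact .inl ⟨v, rfl, rfl⟩
    · exact .inr ⟨v, rfl, rfl⟩

/-- The structure of a rooted tree on the intermediate field representation: each vertex `v` has a
corner `(v, b v)` which is nearer to the root, and its other corners are in different cycles. -/
theorem _root_.TGFT.IsTree.exists_depth {ρ : Equiv.Perm (Leg N n)} (h : IsTree ρ) (x : Leg N n) :
    ∃ (D : Leg N n → ℕ) (b : Fin n → Bool), (∀ a a', ρ.SameCycle a a' → D a = D a') ∧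
      (∀ v, D (.inr (v, b v)) < D (.inr (v, !b v))) ∧
      (∀ v w, ρ.SameCycle (.inr (v, !b v)) (.inr (w, !b w)) → v = w) ∧
      (∀ v, ¬ ρ.SameCycle x (.inr (v, !b v))) ∧
      ∀ a, ρ.SameCycle x a ∨ ∃ v, ρ.SameCycle (.inr (v, !b v)) a := by
  classical
  let q : Leg N n → LoopVertex ρ := fun a => Quotient.mk _ a
  have hq : ∀ a a', q a = q a' ↔ ρ.SameCycle a a' := fun a a' => Quotient.eq
  -- The first edge of a geodesic from `c` to the root: `s` is its corner nearer to the root, and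
  -- the opposite corner lies in `c`.
  have key : ∀ c : {c : LoopVertex ρ // c ≠ q x}, ∃ s : Fin n × Bool,
      q (.inr (s.1, !s.2)) = c ∧ (intermediateGraph ρ).dist (q (.inr s)) (q x) < (intermediateGraph ρ).dist c (q x) := by
    rintro ⟨c, hc⟩
    obtain ⟨p, hp⟩ := h.1.exists_walk_length_eq_dist c (q x)
    cases p with
    | nil => exact absurd rfl hc
    | @cons _ c' _ hadj p =>
      have hlt : (intermediateGraph ρ).dist c' (q x) < (intermediateGraph ρ).dist c (q x) := by
        have h1 := SimpleGraph.dist_le p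
        rw [SimpleGraph.Walk.length_cons] at hp
        omega
      obtain ⟨-, ⟨v, h1, h2⟩ | ⟨v, h1, h2⟩⟩ := (SimpleGraph.fromRel_adj _ _ _).1 hadj
      · exact ⟨(v, true), h1.symm, by rw [h2] at hlt; exact hlt⟩
      · exact ⟨(v, false), h2.symm, by rw [h1] at hlt; exact hlt⟩
  choose f hf1 hf2 using key
  -- An edge that serves two loop-vertices would be used from both its ends, and the distance to the
  -- root would decrease in both directions.
  have hinj : Function.Injective fun c => (f c).1 := by
    intro c c' hcc
    simp only at hcc
    have h1 := hf1 c
    have h2 := hf2 c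
    have h1' := hf1 c'
    have h2' := hf2 c'
    rcases hfc : f c with ⟨v, β⟩
    rcases hfc' : f c' with ⟨v', β'⟩
    rw [hfc, hfc'] at hcc
    rw [hfc] at h1 h2
    rw [hfc'] at h1' h2'
    obtain rfl : v = v' := hcc
    by_cases hb : β = β'
    · subst hb
      exact Subtype.ext (h1.symm.trans h1')
    · have : β' = !β := Bool.eq_not.2 (Ne.symm hb)
      subst this
      simp only [Bool.not_not] at *
      rw [← h1] at h2
      rw [← h1'] at h2'
      omega
  -- Here the count of `n + 1` loop-vertices enters: without the root there are as many as edges, so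
  -- the injection is a bijection and every edge is the parent edge of one loop-vertex.
  have hcard : Fintype.card {c : LoopVertex ρ // c ≠ q x} = Fintype.card (Fin n) := by
    have h1 := Set.card_ne_eq (q x)
    have h2 := h.2
    rw [Nat.card_eq_fintype_card] at h2
    rw [h2] at h1
    rw [Fintype.card_fin]
    exact (Fintype.card_congr (Equiv.refl _)).trans (h1.trans (by simp))
  have hbij := (Fintype.bijective_iff_injective_and_card _).2 ⟨hinj, hcard⟩
  have hb : ∀ v, ∃ β : Bool, ∃ c, f c = (v, β) := fun v => by
    obtain ⟨c, hc⟩ := hbij.2 v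
    exact ⟨(f c).2, c, Prod.ext hc rfl⟩
  choose b c hc using hb
  have h1 : ∀ v, q (.inr (v, !b v)) = c v := fun v => by
    have := hf1 (c v); rwa [hc] at this
  refine ⟨fun a => (intermediateGraph ρ).dist (q a) (q x), b, fun a a' ha => by simp only [(hq a a').2 ha],
    fun v => ?_, fun v w hvw => ?_, fun v hv => ?_, fun a => ?_⟩
  · have := hf2 (c v)
    rwa [hc, ← h1] at this
  · have h2 := (hq _ _).2 hvw
    rw [h1, h1] at h2
    have := hc v
    rw [Subtype.ext h2, hc w] at this
    exact (congrArg Prod.fst this).symm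
  · have h2 := (hq _ _).2 hv
    rw [h1] at h2
    exact (c v).2 h2.symm
  · by_cases ha : q a = q x
    · exact .inl ((hq _ _).1 ha.symm)
    · right
      refine ⟨(f ⟨q a, ha⟩).1, (hq _ _).1 ?_⟩
      rw [h1]
      have : c (f ⟨q a, ha⟩).1 = ⟨q a, ha⟩ := hinj (by simp only [hc])
      rw [this]

theorem count_inr_inner (t : PlaneTree (Fin n) (Fin N)) (v : Fin n) (b : Bool) :
    Multiset.count (.inr (v, b)) (t.inner : Multiset (Leg N n)) =
      Multiset.count v (t.labels : Multiset (Fin n)) := by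
  induction t with
  | leaf => simp [inner, labels]
  | node w b' t s ht hs =>
    simp only [inner, labels, ← Multiset.cons_coe, ← Multiset.coe_add, Multiset.count_cons,
      Multiset.count_add, ht, hs, Sum.inr.injEq, Prod.mk.injEq]
    by_cases h : v = w <;> cases b <;> cases b' <;> simp [h]
  | mark e t ht => simp [inner, labels, ht, ← Multiset.cons_coe]

/-- Parsing walks around a cycle and descends into the far corner of each edge it meets. Depth
increases at every descent, so the recursion ends. Completeness is a count: the multiset of labels
met is invariant under `ρ`, contains the root once and contains both corners of a vertex equally
often, so by induction on depth every field is met exactly once. -/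
theorem exists_follows {ρ : Equiv.Perm (Leg N n)} (h : IsTree ρ) (e₀ : Fin N) :
    ∃ t : PlaneTree (Fin n) (Fin N), Complete t (.inl e₀) ∧ Follows ρ t (.inl e₀) (.inl e₀) := by
  obtain ⟨D, b, hD, hlt, hinj, hroot, hcov⟩ := h.exists_depth (.inl e₀)
  set x : Leg N n := .inl e₀ with hx
  -- `m` bounds the depth still available below `y`. The inner induction `step` is on the number of
  -- fields left before the return to `y`.
  have claim : ∀ m : ℕ, ∀ y : Leg N n, (y = x ∨ ∃ v, y = .inr (v, !b v)) →
      Finset.univ.sup D ≤ D y + m →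
      ∃ t : PlaneTree (Fin n) (Fin N), x ∉ t.inner ∧ Follows ρ t y y := by
    intro m
    induction m using Nat.strong_induction_on with
    | _ m ih =>
      intro y hy hm
      have step : ∀ j : ℕ, ∀ z, ρ.SameCycle y z → (ρ ^ (j + 1)) z = y →
          ∃ t : PlaneTree (Fin n) (Fin N), x ∉ t.inner ∧ Follows ρ t z y := by
        intro j
        induction j with
        | zero => exact fun z _ hz => ⟨leaf, by simp [inner], by simpa using hz⟩
        | succ j ihj =>
          intro z hyz hz
          by_cases hρz : ρ z = y
          · exact ⟨leaf, by simp [inner], by simpa using hρz⟩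
          have hyz' : ρ.SameCycle y (ρ z) := Equiv.Perm.sameCycle_apply_right.2 hyz
          obtain ⟨s, hs, hs'⟩ := ihj (ρ z) hyz' (by
            rw [pow_succ, Equiv.Perm.mul_apply] at hz; exact hz)
          have hxz : ρ z ≠ x := by
            rintro hxz
            rcases hy with rfl | ⟨w, rfl⟩
            · exact hρz hxz
            · exact hroot w (hxz ▸ hyz'.symm)
          rcases hρ : ρ z with e | ⟨v, β⟩
          · refine ⟨mark e s, ?_, follows_mark.2 ⟨hρ, hρ ▸ hs'⟩⟩
            simp only [inner, List.mem_cons, not_or]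
            exact ⟨fun h => hxz (hρ.trans h.symm), hs⟩
          -- The walk meets only near corners. A far corner in the cycle of the root is excluded by
          -- `hroot`, and in the cycle of another far corner it must be the base point `y`, where
          -- the walk has already stopped.
          · have hβ : β = b v := by
              by_contra hne
              have : β = !b v := Bool.eq_not.2 hne
              subst this
              rcases hy with rfl | ⟨w, rfl⟩
              · exact hroot v (hρ ▸ hyz')
              · have := hinj w v (hρ ▸ hyz')
                subst this
                exact hρz hρ
            subst hβ
            have h1 := hlt v
            rw [← hρ, ← hD _ _ hyz'] at h1
            have h2 : D (.inr (v, !b v)) ≤ Finset.univ.sup D := Finset.le_sup (Finset.mem_univ _)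
            obtain ⟨t, ht, ht'⟩ := ih (m - 1) (by omega) (.inr (v, !b v)) (.inr ⟨v, rfl⟩) (by omega)
            refine ⟨node v (b v) t s, ?_, follows_node.2 ⟨hρ, ht', hρ ▸ hs'⟩⟩
            simp only [inner, List.mem_cons, List.mem_append, not_or]
            exact ⟨by simp [hx], by simp [hx], ht, hs⟩
      have hpos : 0 < orderOf ρ := orderOf_pos ρ
      -- The order of `ρ` bounds the length of the walk, which stops at the first return to `y`.
      obtain ⟨j, hj⟩ : ∃ j, orderOf ρ = j + 1 := ⟨orderOf ρ - 1, by omega⟩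
      exact step j y (Equiv.Perm.SameCycle.refl _ _) (by rw [← hj, pow_orderOf_eq_one]; rfl)
  obtain ⟨t, hxt, ht⟩ := claim (Finset.univ.sup D) x (.inl rfl) (by omega)
  refine ⟨t, ?_, ht⟩
  let S : Multiset (Leg N n) := (x :: t.inner : List (Leg N n))
  -- Sources and targets of the steps are the same multiset when the tree is read from `x` to `x`,
  -- and `ρ` carries the former to the latter.
  have hS : S.map ρ = S := by
    have h1 : ((t.steps x x).map Prod.fst : Multiset (Leg N n)) = S :=
      Multiset.coe_eq_coe.2 (steps_fst_perm t x x)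
    have h2 : ((t.steps x x).map Prod.snd : Multiset (Leg N n)) = S :=
      Multiset.coe_eq_coe.2 (steps_snd_perm t x x)
    rw [← h1, Multiset.map_coe, List.map_map, h1, ← h2]
    congr 1
    exact List.map_congr_left fun s hs => ht s hs
  have hcyc : ∀ a a', ρ.SameCycle a a' → S.count a = S.count a' := by
    intro a a' haa
    have hst : ∀ a, S.count (ρ a) = S.count a := fun a => by
      conv_lhs => rw [← hS]
      exact Multiset.count_map_eq_count' _ _ ρ.injective _
    obtain ⟨i, rfl⟩ := haa.exists_nat_pow_eq
    induction i with
    | zero => rfl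
    | succ i ihi =>
      rw [pow_succ', Equiv.Perm.mul_apply, hst]
      exact ihi ⟨i, by simp⟩
  have hx1 : S.count x = 1 := by
    simp only [S, ← Multiset.cons_coe, Multiset.count_cons_self]
    rw [Multiset.count_eq_zero.2 (by simpa using hxt)]
  have hflip : ∀ v, S.count (.inr (v, !b v)) = S.count (.inr (v, b v)) := fun v => by
    simp only [S, ← Multiset.cons_coe, Multiset.count_cons, count_inr_inner]
    simp [hx]
  -- A field off the root cycle shares its cycle with a far corner, whose multiplicity is that of
  -- the near corner, at smaller depth.
  have hone : ∀ m : ℕ, ∀ a, D a = m → S.count a = 1 := by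
    intro m
    induction m using Nat.strong_induction_on with
    | _ m ih =>
      rintro a rfl
      rcases hcov a with ha | ⟨v, hv⟩
      · rw [← hcyc _ _ ha, hx1]
      · rw [← hcyc _ _ hv, hflip]
        exact ih _ (by rw [← hD _ _ hv]; exact hlt v) _ rfl
  refine ⟨Multiset.coe_nodup.1 (Multiset.nodup_iff_count_le_one.2 fun a => (hone _ a rfl).le),
    fun a => ?_⟩
  have : a ∈ S := Multiset.count_pos.1 (by rw [hone _ a rfl]; exact one_pos)
  exact this

/-- `r` assigns to each field the vertex through which its loop-vertex hangs in the tree (`none` at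
the root), and `β v` is the corner of `v` nearer to the root. -/
def Owned (r : Leg N n → Option (Fin n)) (β : Fin n → Bool) :
    PlaneTree (Fin n) (Fin N) → Option (Fin n) → Leg N n → Prop
  | leaf, o, a => r a = o
  | node v b t s, o, a => r a = o ∧ β v = b ∧ Owned r β t (some v) (.inr (v, !b)) ∧
      Owned r β s o (.inr (v, b))
  | mark e t, o, a => r a = o ∧ Owned r β t o (.inl e)

section Owned

variable {r : Leg N n → Option (Fin n)} {β : Fin n → Bool} {t : PlaneTree (Fin n) (Fin N)}
  {o : Option (Fin n)} {a x y : Leg N n} {ρ : Equiv.Perm (Leg N n)}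

theorem Owned.start (h : Owned r β t o a) : r a = o := by
  cases t with
  | leaf => exact h
  | node v b t s => exact h.1
  | mark e t => exact h.1

/-- Owners do not change along lines, so `r` descends to the loop-vertices. This separates them in
`Complete.isTree`. -/
theorem Owned.step (h : Owned r β t o x) (hρ : Follows ρ t x y) (hy : r y = o) :
    ∀ s ∈ t.steps x y, r s.2 = r s.1 := by
  induction t generalizing o x y with
  | leaf =>
    simp only [steps, List.mem_singleton, forall_eq]
    rw [hy, h.start]
  | node v b t s ht hs =>
    obtain ⟨h1, -, h3, h4⟩ := h
    obtain ⟨g1, g2, g3⟩ := follows_node.1 hρ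
    simp only [steps, List.mem_cons, List.mem_append]
    rintro p (rfl | hp | hp)
    · exact h4.start.trans h1.symm
    · exact ht h3 g2 h3.start p hp
    · exact hs h4 g3 hy p hp
  | mark e t ht =>
    obtain ⟨h1, h2⟩ := h
    obtain ⟨g1, g2⟩ := follows_mark.1 hρ
    simp only [steps, List.mem_cons]
    rintro p (rfl | hp)
    · exact h2.start.trans h1.symm
    · exact ht h2 g2 hy p hp

theorem Owned.child (h : Owned r β t o a) {v : Fin n} (hv : v ∈ t.labels) :
    r (.inr (v, !β v)) = some v := by
  induction t generalizing o a with
  | leaf => simp [labels] at hv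
  | node w b t s ht hs =>
    obtain ⟨-, rfl, h3, h4⟩ := h
    simp only [labels, List.mem_cons, List.mem_append] at hv
    rcases hv with rfl | hv | hv
    · exact h3.start
    · exact ht h3 hv
    · exact hs h4 hv
  | mark e t ht => exact ht h.2 hv

end Owned

/-- The fields with their owners. -/
def owners : PlaneTree (Fin n) (Fin N) → Option (Fin n) → Leg N n →
    List (Leg N n × Option (Fin n))
  | leaf, o, a => [(a, o)]
  | node v b t s, o, a => (a, o) :: (owners t (some v) (.inr (v, !b)) ++ owners s o (.inr (v, b)))
  | mark e t, o, a => (a, o) :: owners t o (.inl e)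

/-- The labels with their orientations. -/
def bits {M : Type} : PlaneTree (Fin n) M → List (Fin n × Bool)
  | leaf => []
  | node v b t s => (v, b) :: (bits t ++ bits s)
  | mark _ t => bits t

theorem owners_fst_perm (t : PlaneTree (Fin n) (Fin N)) (o : Option (Fin n)) (a : Leg N n) :
    ((t.owners o a).map Prod.fst).Perm (a :: t.inner) := by
  induction t generalizing o a with
  | leaf => simp [owners, inner]
  | node v b t s ht hs =>
    simp only [owners, inner, List.map_cons, List.map_append]
    exact List.Perm.cons _ (((ht _ _).append (hs _ _)).trans List.perm_middle)
  | mark e t ht =>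
    simp only [owners, inner, List.map_cons]
    exact (ht _ _).cons _

theorem bits_fst {M : Type} (t : PlaneTree (Fin n) M) : t.bits.map Prod.fst = t.labels := by
  induction t with
  | leaf => rfl
  | node v b t s ht hs => simp [bits, labels, ht, hs]
  | mark e t ht => exact ht

theorem owned_of_lists {r : Leg N n → Option (Fin n)} {β : Fin n → Bool}
    (t : PlaneTree (Fin n) (Fin N)) (o : Option (Fin n)) (a : Leg N n)
    (h : ∀ s ∈ t.owners o a, r s.1 = s.2) (h' : ∀ s ∈ t.bits, β s.1 = s.2) : Owned r β t o a := by
  induction t generalizing o a with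
  | leaf => exact h (a, o) (by simp [owners])
  | node v b t s ht hs =>
    simp only [owners, bits, List.mem_cons, List.mem_append] at h h'
    exact ⟨h (a, o) (.inl rfl), h' (v, b) (.inl rfl),
      ht _ _ (fun p hp => h p (.inr (.inl hp))) (fun p hp => h' p (.inr (.inl hp))),
      hs _ _ (fun p hp => h p (.inr (.inr hp))) (fun p hp => h' p (.inr (.inr hp)))⟩
  | mark e t ht =>
    simp only [owners, bits, List.mem_cons] at h h'
    exact ⟨h (a, o) (.inl rfl), ht _ _ (fun p hp => h p (.inr hp)) h'⟩

theorem Complete.labels_nodup {t : PlaneTree (Fin n) (Fin N)} {x : Leg N n} (h : t.Complete x) :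
    t.labels.Nodup := by
  rw [← Multiset.coe_nodup, Multiset.nodup_iff_count_le_one]
  intro v
  rw [← count_inr_inner t v true]
  exact Multiset.nodup_iff_count_le_one.1 (Multiset.coe_nodup.2 h.1.of_cons) _

theorem Complete.mem_labels {t : PlaneTree (Fin n) (Fin N)} {e : Fin N}
    (h : t.Complete (.inl e)) (v : Fin n) : v ∈ t.labels := by
  rw [← inr_mem_inner t v true]
  simpa using h.2 (.inr (v, true))

theorem Complete.exists_owned {t : PlaneTree (Fin n) (Fin N)} {e : Fin N}
    (h : t.Complete (.inl e)) : ∃ r β, Owned r β t none (.inl e) := by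
  have h1 := owners_fst_perm t none (.inl e)
  obtain ⟨r, hr⟩ := exists_fun_of_nodup _ (h1.nodup_iff.2 h.1) fun a => h1.mem_iff.2 (h.2 a)
  obtain ⟨β, hβ⟩ := exists_fun_of_nodup t.bits (by rw [bits_fst]; exact h.labels_nodup)
    (by rw [bits_fst]; exact h.mem_labels)
  exact ⟨r, β, owned_of_lists t _ _ hr hβ⟩

theorem Owned.apply {r : Leg N n → Option (Fin n)} {β : Fin n → Bool}
    {t : PlaneTree (Fin n) (Fin N)} {x : Leg N n} (h : Owned r β t none x) (ht : t.Complete x)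
    {ρ : Equiv.Perm (Leg N n)} (hρ : Follows ρ t x x) (a : Leg N n) : r (ρ a) = r a := by
  obtain ⟨s, hs, rfl⟩ := List.mem_map.1 ((steps_fst_perm t x x).mem_iff.2 (ht.2 a))
  rw [hρ s hs, h.step hρ h.start s hs]

/-- Connectedness follows by walking down the tree. There are at most `n + 1` loop-vertices because
a connected graph has at most one vertex more than it has edges, and at least `n + 1` because the
owner map reaches `none` and every `some v`. -/
theorem Complete.isTree {t : PlaneTree (Fin n) (Fin N)} {e : Fin N} (h : t.Complete (.inl e))
    {ρ : Equiv.Perm (Leg N n)} (hρ : Follows ρ t (.inl e) (.inl e)) : IsTree ρ := by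
  classical
  have hreach : ∀ (t : PlaneTree (Fin n) (Fin N)) (x y : Leg N n), Follows ρ t x y →
      ∀ a ∈ t.inner, (intermediateGraph ρ).Reachable (Quotient.mk _ x) (Quotient.mk _ a) := by
    intro t
    induction t with
    | leaf => simp [inner]
    | node v b t s ht hs =>
      intro x y hxy a ha
      obtain ⟨h1, h2, h3⟩ := follows_node.1 hxy
      have hx := mk_apply ρ x
      rw [h1] at hx
      have h4 := intermediateGraph_reachable ρ v b
      rw [← hx]
      simp only [inner, List.mem_cons, List.mem_append] at ha
      rcases ha with rfl | rfl | ha | ha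
      · exact SimpleGraph.Reachable.rfl
      · exact h4
      · exact h4.trans (ht _ _ h2 a ha)
      · exact hs _ _ h3 a ha
    | mark e t ht =>
      intro x y hxy a ha
      obtain ⟨h1, h2⟩ := follows_mark.1 hxy
      have hx := mk_apply ρ x
      rw [h1] at hx
      rw [← hx]
      simp only [inner, List.mem_cons] at ha
      rcases ha with rfl | ha
      · exact SimpleGraph.Reachable.rfl
      · exact ht _ _ h2 a ha
  have hconn : (intermediateGraph ρ).Connected := by
    rw [SimpleGraph.connected_iff_exists_forall_reachable]
    refine ⟨Quotient.mk _ (.inl e), fun c => ?_⟩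
    induction c using Quotient.inductionOn with
    | _ a =>
      rcases List.mem_cons.1 (h.2 a) with rfl | ha
      · exact SimpleGraph.Reachable.rfl
      · exact hreach t _ _ hρ a ha
  refine ⟨hconn, le_antisymm ?_ ?_⟩
  · refine hconn.card_vert_le_card_edgeSet_add_one.trans (Nat.add_le_add_right ?_ 1)
    have hsub : (intermediateGraph ρ).edgeSet ⊆ Set.range fun v : Fin n =>
        s((Quotient.mk _ (.inr (v, false)) : LoopVertex ρ), Quotient.mk _ (.inr (v, true))) := by
      intro e he
      induction e with
      | _ c c' =>
        obtain ⟨-, ⟨v, h1, h2⟩ | ⟨v, h1, h2⟩⟩ := (SimpleGraph.fromRel_adj _ _ _).1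
          ((SimpleGraph.mem_edgeSet _).1 he)
        · exact ⟨v, by rw [h1, h2]⟩
        · exact ⟨v, by rw [h1, h2]; exact Sym2.eq_swap⟩
    rw [Nat.card_coe_set_eq]
    refine (Set.ncard_le_ncard hsub (Set.finite_range _)).trans ?_
    rw [← Set.image_univ]
    exact (Set.ncard_image_le Set.finite_univ).trans (by simp [Set.ncard_univ])
  · obtain ⟨r, β, hr⟩ := h.exists_owned
    have hinv : ∀ a a', ρ.SameCycle a a' → r a = r a' := by
      intro a a' haa
      obtain ⟨i, rfl⟩ := haa.exists_nat_pow_eq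
      clear haa
      induction i with
      | zero => rfl
      | succ i ihi => rw [pow_succ', Equiv.Perm.mul_apply, hr.apply h hρ, ← ihi]
    have hsurj : Function.Surjective (Quotient.lift r hinv : LoopVertex ρ → Option (Fin n)) := by
      rintro (_ | v)
      · exact ⟨Quotient.mk _ (.inl e), hr.start⟩
      · exact ⟨Quotient.mk _ (.inr (v, !β v)), hr.child (h.mem_labels v)⟩
    have := Nat.card_le_card_of_surjective _ hsurj
    simpa using this

end PlaneTree

/-! ### One-particle irreducibility and faces in terms of trees -/

namespace PlaneTree

variable {A M : Type} {N n d : ℕ}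

/-- Marks occur only as `mark e leaf`, alone in the loop-vertex that hangs from an edge. -/
def Adm : PlaneTree A M → Prop
  | leaf => True
  | node _ _ t s => (Adm t ∨ ∃ e, t = mark e leaf) ∧ Adm s
  | mark _ _ => False

theorem adm_of_marks_eq_nil {t : PlaneTree A M} (h : t.marks = []) : t.Adm := by
  induction t with
  | leaf => trivial
  | node a b t s ht hs =>
    obtain ⟨h1, h2⟩ := List.append_eq_nil_iff.1 h
    exact ⟨.inl (ht h1), hs h2⟩
  | mark e t => simp [marks] at h

theorem not_connected_of_closed {G : SimpleGraph (Fin n)} {S : Set (Fin n)} {v w : Fin n}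
    (hv : v ∈ S) (hw : w ∉ S) (h : ∀ a b, G.Adj a b → (a ∈ S ↔ b ∈ S)) : ¬ G.Connected := by
  intro hG
  obtain ⟨p⟩ := hG.preconnected v w
  induction p with
  | nil => exact hw hv
  | cons hadj _ ih => exact ih ((h _ _ hadj).1 hv) hw

theorem vertexGraph_mem_iff {σ : Wick N n} {cut : Set (Fin n × Bool)} {S : Set (Fin n)}
    (h : ∀ v b w b', (v, b) ∉ cut → σ (.inr (v, b)) = .inr (w, b') → (v ∈ S ↔ w ∈ S))
    (v w : Fin n) (hvw : (vertexGraph σ cut).Adj v w) : v ∈ S ↔ w ∈ S := by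
  obtain ⟨-, ⟨b, b', h1, h2⟩ | ⟨b, b', h1, h2⟩⟩ := (SimpleGraph.fromRel_adj _ _ _).1 hvw
  · exact h _ _ _ _ h1 h2
  · exact (h _ _ _ _ h1 h2).symm

section Follows

variable {ρ : Equiv.Perm (Leg N n)} {t : PlaneTree (Fin n) (Fin N)} {x y : Leg N n}

theorem Follows.apply_mem (h : Follows ρ t x y) {a : Leg N n} (ha : a ∈ x :: t.inner) :
    ρ a ∈ y :: t.inner := by
  obtain ⟨s, hs, rfl⟩ := List.mem_map.1 ((steps_fst_perm t x y).mem_iff.2 ha)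
  rw [h s hs]
  exact (steps_snd_perm t x y).mem_iff.1 (List.mem_map_of_mem hs)

theorem Follows.mem_of_apply (h : Follows ρ t x y) {a : Leg N n} (ha : ρ a ∈ y :: t.inner) :
    a ∈ x :: t.inner := by
  obtain ⟨s, hs, hs'⟩ := List.mem_map.1 ((steps_snd_perm t x y).mem_iff.2 ha)
  rw [← h s hs, ρ.apply_eq_iff_eq] at hs'
  rw [← hs']
  exact (steps_fst_perm t x y).mem_iff.1 (List.mem_map_of_mem hs)

/-- Lines join a subtree to the rest only at its entrance `x` and its exit `y`. One of the two is an
external line, so at most one internal line is involved. Deleting it would isolate a nonempty proper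
set of vertices, which 1PI forbids. -/
theorem Follows.mem_labels_of_onePI (h : Follows ρ t x y) (hρ : IsOnePI ρ)
    (hxy : (∃ e, x = .inl e) ∨ ∃ e, y = .inl e) (hne : t.labels ≠ []) (w : Fin n) :
    w ∈ t.labels := by
  by_contra hw
  obtain ⟨v, hv⟩ := List.exists_mem_of_ne_nil _ hne
  have h1 : ∀ v b w b', ρ (.inr (v, b)) = .inr (w, b') → v ∈ t.labels →
      w ∈ t.labels ∨ ρ (.inr (v, b)) = y := by
    intro v b w b' hvw hv
    have := h.apply_mem (List.mem_cons_of_mem _ ((inr_mem_inner t v b).2 hv))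
    rw [List.mem_cons] at this
    refine this.symm.imp_left fun h => ?_
    rwa [hvw, inr_mem_inner] at h
  have h2 : ∀ v b w b', ρ (.inr (v, b)) = .inr (w, b') → w ∈ t.labels →
      v ∈ t.labels ∨ .inr (v, b) = x := by
    intro v b w b' hvw hw
    have := h.mem_of_apply (a := .inr (v, b)) (by
      rw [hvw]; exact List.mem_cons_of_mem _ ((inr_mem_inner t w b').2 hw))
    rw [List.mem_cons] at this
    refine this.symm.imp_left fun h => ?_
    rwa [inr_mem_inner] at h
  -- `cut` is the one internal line at the other end, or empty if that end is external too.
  have key : ∃ cut, (vertexGraph ρ cut).Connected ∧ ∀ v b w b', (v, b) ∉ cut →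
      ρ (.inr (v, b)) = .inr (w, b') → (v ∈ t.labels ↔ w ∈ t.labels) := by
    rcases hxy with ⟨e, rfl⟩ | ⟨e, rfl⟩
    · rcases hy : ρ.symm y with e' | p
      · refine ⟨∅, hρ.2.1, fun v b w b' _ hvw => ⟨fun hv => ?_, fun hw => ?_⟩⟩
        · refine (h1 _ _ _ _ hvw hv).resolve_right fun h => ?_
          rw [← h, ρ.symm_apply_apply] at hy
          simp at hy
        · simpa using h2 _ _ _ _ hvw hw
      · refine ⟨{p}, hρ.2.2 p, fun v b w b' hp hvw => ⟨fun hv => ?_, fun hw => ?_⟩⟩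
        · refine (h1 _ _ _ _ hvw hv).resolve_right fun h => ?_
          rw [← h, ρ.symm_apply_apply] at hy
          exact hp (Sum.inr_injective hy)
        · simpa using h2 _ _ _ _ hvw hw
    · rcases hx : x with e' | p
      · refine ⟨∅, hρ.2.1, fun v b w b' _ hvw => ⟨fun hv => ?_, fun hw => ?_⟩⟩
        · simpa [hvw] using h1 _ _ _ _ hvw hv
        · simpa [hx] using h2 _ _ _ _ hvw hw
      · refine ⟨{p}, hρ.2.2 p, fun v b w b' hp hvw => ⟨fun hv => ?_, fun hw => ?_⟩⟩
        · simpa [hvw] using h1 _ _ _ _ hvw hv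
        · refine (h2 _ _ _ _ hvw hw).resolve_right fun h => hp ?_
          rw [hx] at h
          exact Sum.inr_injective h
  obtain ⟨cut, hc, hcut⟩ := key
  exact not_connected_of_closed (S := {v | v ∈ t.labels}) hv hw (vertexGraph_mem_iff hcut) hc

/-- A part that misses a vertex has no vertex at all. Only marks could remain, and no line joins two
external fields; `mark e leaf` between two corners is the exception that `hx` removes. -/
theorem Follows.eq_leaf_of_onePI (h : Follows ρ t x y) (hρ : IsOnePI ρ)
    (hxy : (∃ e, x = .inl e) ∨ ∃ e, y = .inl e) (hx : (∃ e, x = .inl e) ∨ ¬ ∃ e, t = mark e leaf)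
    {w : Fin n} (hw : w ∉ t.labels) : t = leaf := by
  have hne : t.labels = [] := by
    by_contra hne
    exact hw (h.mem_labels_of_onePI hρ hxy hne w)
  cases t with
  | leaf => rfl
  | node v b t s => simp [labels] at hne
  | mark e t =>
    obtain ⟨h1, h2⟩ := follows_mark.1 h
    rcases hx with ⟨e', rfl⟩ | hx
    · exact absurd h1 (hρ.1 _ _)
    · cases t with
      | leaf => exact absurd ⟨e, rfl⟩ hx
      | node v b t s => simp [labels] at hne
      | mark e' t => exact absurd (follows_mark.1 h2).1 (hρ.1 _ _)

/-- If a mark shared its cycle with an edge, the piece of the cycle that ends at the mark would hang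
from a single internal line, and would have to contain the missing vertex `w`. -/
theorem Follows.adm_of_onePI (h : Follows ρ t x y) (hρ : IsOnePI ρ) {w : Fin n}
    (hw : w ∉ t.labels) (hx : ∃ p, x = .inr p) : Adm t ∨ ∃ e, t = mark e leaf := by
  induction t generalizing x y with
  | leaf => exact .inl trivial
  | node v b t s ht hs =>
    obtain ⟨h1, h2, h3⟩ := follows_node.1 h
    simp only [labels, List.mem_cons, List.mem_append, not_or] at hw
    refine .inl ⟨ht h2 hw.2.1 ⟨_, rfl⟩, (hs h3 hw.2.2 ⟨_, rfl⟩).resolve_right ?_⟩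
    rintro ⟨e, rfl⟩
    have h4 : Follows ρ (node v b t leaf) x (.inl e) :=
      follows_node.2 ⟨h1, h2, follows_leaf.2 (follows_mark.1 h3).1⟩
    have := h4.mem_labels_of_onePI hρ (.inr ⟨e, rfl⟩) (by simp [labels]) w
    simp [labels, hw.1, hw.2.1] at this
  | mark e t ht =>
    obtain ⟨h1, h2⟩ := follows_mark.1 h
    rw [h2.eq_leaf_of_onePI hρ (.inl ⟨e, rfl⟩) (.inl ⟨e, rfl⟩) hw]
    exact .inr ⟨e, rfl⟩

/-- After the first edge, the root cycle ends at an external mark and misses the vertex `v` of this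
edge, so nothing else can sit on it. -/
theorem Complete.exists_node_of_onePI {e₀ : Fin N} (ht : t.Complete (.inl e₀))
    (h : Follows ρ t (.inl e₀) (.inl e₀)) (hρ : IsOnePI ρ) :
    ∃ v b s, t = node v b s leaf ∧ (Adm s ∨ ∃ e, s = mark e leaf) := by
  cases t with
  | leaf => exact absurd (follows_leaf.1 h) (hρ.1 _ _)
  | mark e t => exact absurd (follows_mark.1 h).1 (hρ.1 _ _)
  | node v b t s =>
    obtain ⟨h1, h2, h3⟩ := follows_node.1 h
    have hn := ht.labels_nodup
    simp only [labels, List.nodup_cons, List.mem_append, not_or] at hn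
    have hs := h3.eq_leaf_of_onePI hρ (.inr ⟨_, rfl⟩) (.inr ?_) hn.1.2
    · subst hs
      exact ⟨v, b, t, rfl, h2.adm_of_onePI hρ hn.1.1 ⟨_, rfl⟩⟩
    · rintro ⟨e, rfl⟩
      exact hρ.1 _ _ (follows_leaf.1 (follows_mark.1 h3).2)

theorem Adm.steps_isRight (ht : t.Adm) (hxy : x.isRight ∨ y.isRight) :
    ∀ s ∈ t.steps x y, s.1.isRight ∨ s.2.isRight := by
  induction t generalizing x y with
  | leaf => simpa [steps] using hxy
  | node v b t s iht ihs =>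
    simp only [steps, List.mem_cons, List.mem_append]
    rintro p (rfl | hp | hp)
    · simp
    · rcases ht.1 with h | ⟨e, rfl⟩
      · exact iht h (.inl rfl) p hp
      · simp only [steps, List.mem_cons, List.not_mem_nil, or_false] at hp
        rcases hp with rfl | rfl <;> simp
    · exact ihs ht.2 (.inl rfl) p hp
  | mark e t => exact ht.elim

/-- Removing one line breaks the path from `p` to `q` into at most two pieces, one attached to each
end. For a closed cycle, `p = q`, both pieces stay together, so hanging subtrees never come off. The
second clause is the case where the path itself is intact. -/
theorem Adm.reachable (ht : t.Adm) {H : Set (Fin n × Bool)} (hH : H.Subsingleton)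
    {p q : Fin n × Bool} (h : Follows ρ t (.inr p) (.inr q))
    (hn : (.inr p :: t.inner : List (Leg N n)).Nodup) :
    (∀ w ∈ t.labels, (vertexGraph ρ H).Reachable p.1 w ∨ (vertexGraph ρ H).Reachable q.1 w) ∧
      ((∀ a ∈ H, .inr a ∉ (.inr p :: t.inner : List (Leg N n))) →
        (vertexGraph ρ H).Reachable p.1 q.1) := by
  have hline : ∀ p q : Fin n × Bool, ρ (.inr p) = .inr q → p ∉ H →
      (vertexGraph ρ H).Reachable p.1 q.1 := by
    rintro ⟨v, b⟩ ⟨w, b'⟩ hpq hp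
    by_cases hvw : v = w
    · subst hvw; exact SimpleGraph.Reachable.rfl
    · exact SimpleGraph.Adj.reachable
        ((SimpleGraph.fromRel_adj _ _ _).2 ⟨hvw, .inl ⟨b, b', hp, hpq⟩⟩)
  induction t generalizing p q with
  | leaf =>
    refine ⟨by simp [labels], fun hp => hline _ _ (follows_leaf.1 h) fun hpH => ?_⟩
    exact hp p hpH (by simp)
  | node v b t s iht ihs =>
    obtain ⟨h1, h2, h3⟩ := follows_node.1 h
    have ht' : ∀ w ∈ t.labels, (vertexGraph ρ H).Reachable v w := by
      intro w hw
      rcases ht.1 with h | ⟨e, rfl⟩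
      · exact or_self_iff.1 ((iht h h2 (nodup_inner_left hn.of_cons)).1 w hw)
      · simp [labels] at hw
    obtain ⟨hs1, hs2⟩ := ihs ht.2 h3 (nodup_inner_right hn.of_cons)
    constructor
    -- If the deleted line is the one that leaves `p`, the rest of the path is intact and everything
    -- is reached from `q`.
    · by_cases hp : p ∈ H
      · have hv : (vertexGraph ρ H).Reachable q.1 v := by
          refine (hs2 fun a ha hmem => ?_).symm
          rw [hH ha hp] at hmem
          refine (List.nodup_cons.1 hn).1 ?_
          simp only [inner, List.mem_cons, List.mem_append] at hmem ⊢
          exact hmem.imp_right fun h => .inr (.inr h)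
        intro w hw
        simp only [labels, List.mem_cons, List.mem_append] at hw
        rcases hw with rfl | hw | hw
        · exact .inr hv
        · exact .inr (hv.trans (ht' w hw))
        · exact .inr ((hs1 w hw).elim (hv.trans ·) id)
      · have hv := hline _ _ h1 hp
        intro w hw
        simp only [labels, List.mem_cons, List.mem_append] at hw
        rcases hw with rfl | hw | hw
        · exact .inl hv
        · exact .inl (hv.trans (ht' w hw))
        · exact (hs1 w hw).imp_left (hv.trans ·)
    · intro hno
      refine (hline _ _ h1 fun hp => hno p hp (by simp)).trans (hs2 fun a ha hmem => hno a ha ?_)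
      simp only [inner, List.mem_cons, List.mem_append] at hmem ⊢
      exact .inr (hmem.imp_right fun h => .inr (.inr h))
  | mark e t => exact ht.elim

/-- Every vertex lies on or beyond the loop-vertex that hangs from the single root edge, and this is
a closed cycle, so one deletion does not disconnect it. -/
theorem Complete.onePI {v : Fin n} {b : Bool} {e₀ : Fin N} (hs : Adm t ∨ ∃ e, t = mark e leaf)
    (hc : (node v b t leaf).Complete (.inl e₀))
    (h : Follows ρ (node v b t leaf) (.inl e₀) (.inl e₀)) : IsOnePI ρ := by
  obtain ⟨h1, h2, h3⟩ := follows_node.1 h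
  have hconn : ∀ H : Set (Fin n × Bool), H.Subsingleton → (vertexGraph ρ H).Connected := by
    intro H hH
    rw [SimpleGraph.connected_iff_exists_forall_reachable]
    refine ⟨v, fun w => ?_⟩
    have hw := hc.mem_labels w
    simp only [labels, List.append_nil, List.mem_cons] at hw
    rcases hw with rfl | hw
    · exact SimpleGraph.Reachable.rfl
    · rcases hs with hs | ⟨e, rfl⟩
      · exact or_self_iff.1 ((hs.reachable hH h2 (nodup_inner_left hc.1.of_cons)).1 w hw)
      · simp [labels] at hw
  refine ⟨fun e e' he => ?_, hconn ∅ Set.subsingleton_empty,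
    fun p => hconn {p} Set.subsingleton_singleton⟩
  obtain ⟨s, hs1, hs2⟩ := List.mem_map.1
    ((steps_fst_perm (node v b t leaf) (.inl e₀) (.inl e₀)).mem_iff.2 (hc.2 (.inl e)))
  have h4 := h s hs1
  rw [hs2, he] at h4
  have hne : ¬ (s.1.isRight ∨ s.2.isRight) := by rw [hs2, ← h4]; simp
  simp only [steps, List.mem_cons, List.mem_append, List.not_mem_nil, or_false] at hs1
  rcases hs1 with rfl | hs1 | rfl
  · simp at hne
  · rcases hs with hs | ⟨e, rfl⟩
    · exact hne (hs.steps_isRight (.inl rfl) s hs1)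
    · simp only [steps, List.mem_cons, List.not_mem_nil, or_false] at hs1
      rcases hs1 with rfl | rfl <;> simp at hne
  · simp at hne

/-! ### Faces -/

/-- The edges between the root and the single mark all have the colour `i`, and the mark is alone in
its loop-vertex. -/
def Heart (i : A) : PlaneTree A M → Prop
  | leaf => False
  | node j _ t s => (j = i ∧ (Heart i t ∨ ∃ e, t = mark e leaf) ∧ s.marks = []) ∨
      (t.marks = [] ∧ Heart i s)
  | mark _ _ => False

theorem map_eq_mark_leaf {B : Type} {f : A → B} {t : PlaneTree A M} {e : M} :
    t.map f = mark e leaf ↔ t = mark e leaf := by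
  rcases t with _ | _ | ⟨e', _ | _ | _⟩ <;> simp [map]

theorem Heart.adm {i : A} {c : Fin n → A} {t : PlaneTree (Fin n) M} (h : (t.map c).Heart i) :
    t.Adm := by
  induction t with
  | leaf => exact h.elim
  | mark e t => exact h.elim
  | node v b t s ht hs =>
    rcases h with ⟨-, h | ⟨e, h⟩, h'⟩ | ⟨h, h'⟩
    · exact ⟨.inl (ht h), adm_of_marks_eq_nil (by rwa [marks_map] at h')⟩
    · exact ⟨.inr ⟨e, map_eq_mark_leaf.1 h⟩, adm_of_marks_eq_nil (by rwa [marks_map] at h')⟩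
    · exact ⟨.inl (adm_of_marks_eq_nil (by rwa [marks_map] at h)), hs h'⟩

variable {c : Fin n → Fin d} {i : Fin d}

theorem strand_of_eq {v : Fin n} (hv : c v = i) (b : Bool) :
    strand c i (.inr (v, b) : Leg N n) = .inr (v, !b) := by simp [strand, hv]

theorem strand_of_ne {v : Fin n} (hv : c v ≠ i) (b : Bool) :
    strand c i (.inr (v, b) : Leg N n) = .inr (v, b) := by simp [strand, hv]

/-- A face of colour `i` follows the contour of the tree around the edges of colour `i` and passes
by the other edges at their corner. In both cases it comes out at the end of the subtree. -/
theorem Follows.face_exists (h : Follows ρ t x y) :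
    ∃ k z, (fun x => strand c i (ρ x))^[k] x = z ∧ ρ z = y := by
  induction t generalizing x y with
  | leaf => exact ⟨0, x, rfl, follows_leaf.1 h⟩
  | node v b t s ht hs =>
    obtain ⟨h1, h2, h3⟩ := follows_node.1 h
    obtain ⟨k', z', hk', hz'⟩ := hs h3
    by_cases hv : c v = i
    · obtain ⟨k, z, hk, hz⟩ := ht h2
      refine ⟨k' + (1 + (k + 1)), z', ?_, hz'⟩
      rw [Function.iterate_add_apply, Function.iterate_add_apply, Function.iterate_add_apply,
        Function.iterate_one]
      simp only [h1, strand_of_eq hv]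
      rw [hk, hz]
      simpa only [strand_of_eq hv, Bool.not_not] using hk'
    · refine ⟨k' + 1, z', ?_, hz'⟩
      rw [Function.iterate_add_apply, Function.iterate_one]
      simp only [h1, strand_of_ne hv]
      exact hk'
  | mark e t ht =>
    obtain ⟨h1, h2⟩ := follows_mark.1 h
    obtain ⟨k, z, hk, hz⟩ := ht h2
    refine ⟨k + 1, z, ?_, hz⟩
    rw [Function.iterate_add_apply, Function.iterate_one]
    simp only [h1, strand]
    exact hk

/-- The face crosses each edge of colour `i`, hence all the edges towards the mark. What precedes
them on a cycle is traversed by `Follows.face_exists`. -/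
theorem Heart.face_exists (hh : (t.map c).Heart i) (h : Follows ρ t x y) :
    ∃ e ∈ t.marks, ∃ k, (fun x => strand c i (ρ x))^[k] x = .inl e := by
  induction t generalizing x y with
  | leaf => exact hh.elim
  | mark e t => exact hh.elim
  | node v b t s ht hs =>
    obtain ⟨h1, h2, h3⟩ := follows_node.1 h
    rcases hh with ⟨hv, hh, -⟩ | ⟨-, hh⟩
    · obtain ⟨e, he, k, hk⟩ : ∃ e ∈ t.marks,
          ∃ k, (fun x => strand c i (ρ x))^[k] (.inr (v, !b)) = .inl e := by
        rcases hh with hh | ⟨e, hh⟩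
        · exact ht hh h2
        · rw [map_eq_mark_leaf] at hh
          subst hh
          exact ⟨e, by simp [marks], 1, by simp [(follows_mark.1 h2).1, strand]⟩
      refine ⟨e, by simp [marks, he], k + 1, ?_⟩
      rw [Function.iterate_add_apply, Function.iterate_one]
      simp only [h1, strand_of_eq hv]
      exact hk
    · obtain ⟨e, he, k, hk⟩ := hs hh h3
      refine ⟨e, by simp [marks, he], ?_⟩
      by_cases hv : c v = i
      · obtain ⟨k', z, hk', hz⟩ := h2.face_exists (c := c) (i := i)
        refine ⟨k + (1 + (k' + 1)), ?_⟩
        rw [Function.iterate_add_apply, Function.iterate_add_apply, Function.iterate_add_apply,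
          Function.iterate_one]
        simp only [h1, strand_of_eq hv]
        rw [hk', hz]
        simpa only [strand_of_eq hv, Bool.not_not] using hk
      · refine ⟨k + 1, ?_⟩
        rw [Function.iterate_add_apply, Function.iterate_one]
        simp only [h1, strand_of_ne hv]
        exact hk

/-- The mark is alone in its loop-vertex, so the line that leaves it returns to the edge it hangs
from. -/
theorem Heart.apply_mark (hh : (t.map c).Heart i) (h : Follows ρ t x y) {e : Fin N}
    (he : e ∈ t.marks) : ∃ v b, ρ (.inl e) = .inr (v, b) ∧ c v = i := by
  induction t generalizing x y with
  | leaf => exact hh.elim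
  | mark e t => exact hh.elim
  | node v b t s ht hs =>
    obtain ⟨h1, h2, h3⟩ := follows_node.1 h
    rw [marks, List.mem_append] at he
    rcases hh with ⟨hv, hh, hm⟩ | ⟨hm, hh⟩
    · rw [marks_map] at hm
      rw [hm] at he
      simp only [List.not_mem_nil, or_false] at he
      rcases hh with hh | ⟨e', hh⟩
      · exact ht hh h2 he
      · rw [map_eq_mark_leaf] at hh
        subst hh
        simp only [marks, List.mem_singleton] at he
        subst he
        exact ⟨v, !b, follows_leaf.1 (follows_mark.1 h2).2, hv⟩
    · rw [marks_map] at hm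
      rw [hm] at he
      simp only [List.not_mem_nil, false_or] at he
      exact hs hh h3 he

/-- An edge of another colour on the way to the mark is a barrier: the face of colour `i` through
the mark cannot cross it and stays in the subtree beyond. The set `S` witnesses this, and it keeps
the mark off the face of the root. -/
theorem Adm.heart_or_closed (ht : t.Adm) (h : Follows ρ t x y) {e : Fin N} (he : t.marks = [e]) :
    (t.map c).Heart i ∨ ∃ S : Set (Leg N n), .inl e ∈ S ∧ (∀ a ∈ S, a ∈ t.inner) ∧
      ∀ a ∈ S, strand c i (ρ a) ∈ S := by
  induction t generalizing x y with
  | leaf => simp [marks] at he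
  | mark e t => exact ht.elim
  | node v b t s iht ihs =>
    obtain ⟨h1, h2, h3⟩ := follows_node.1 h
    rw [marks, List.append_eq_singleton_iff] at he
    rcases he with ⟨he1, he2⟩ | ⟨he1, he2⟩
    · rcases ihs ht.2 h3 he2 with hh | ⟨S, hS1, hS2, hS3⟩
      · exact .inl (.inr ⟨by rwa [marks_map], hh⟩)
      · exact .inr ⟨S, hS1, fun a ha => by simp [inner, hS2 a ha], hS3⟩
    · by_cases hv : c v = i
      · rcases ht.1 with hadm | ⟨e', rfl⟩
        · rcases iht hadm h2 he1 with hh | ⟨S, hS1, hS2, hS3⟩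
          · exact .inl (.inl ⟨hv, .inl hh, by rwa [marks_map]⟩)
          · exact .inr ⟨S, hS1, fun a ha => by simp [inner, hS2 a ha], hS3⟩
        · exact .inl (.inl ⟨hv, .inr ⟨e', rfl⟩, by rwa [marks_map]⟩)
      · right
        -- The far corner of the barrier with all labels beyond it. A line that returns to this
        -- corner is sent back into the set, as the strand stays at the corner.
        refine ⟨{a | a ∈ (.inr (v, !b) :: t.inner : List (Leg N n))}, ?_, ?_, ?_⟩
        · refine List.mem_cons_of_mem _ ((inl_mem_inner t e).2 (by simp [he1]))
        · intro a ha
          rcases List.mem_cons.1 ha with rfl | ha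
          · simp [inner]
          · simp [inner, ha]
        · intro a ha
          have hm := h2.apply_mem ha
          rcases List.mem_cons.1 hm with hm | hm
          · rw [hm]
            simp [strand, hv]
          · refine List.mem_cons_of_mem _ ?_
            rcases hρ : ρ a with e | ⟨w, β⟩
            · rw [hρ] at hm; exact hm
            · rw [hρ, inr_mem_inner] at hm
              exact (inr_mem_inner _ _ _).2 hm

end Follows

end PlaneTree

namespace PlaneTree

variable {A B M : Type} {N n d : ℕ}

/-! ### Ordered and labelled trees -/

theorem count_inl_inner (t : PlaneTree (Fin n) (Fin N)) (e : Fin N) :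
    Multiset.count (.inl e) (t.inner : Multiset (Leg N n)) =
      Multiset.count e (t.marks : Multiset (Fin N)) := by
  induction t with
  | leaf => simp [inner, marks]
  | node w b' t s ht hs =>
    simp only [inner, marks, ← Multiset.cons_coe, ← Multiset.coe_add, Multiset.count_cons,
      Multiset.count_add, ht, hs]
    simp
  | mark e' t ht =>
    simp only [inner, marks, ← Multiset.cons_coe, Multiset.count_cons, ht, Sum.inl.injEq]

theorem complete_iff {t : PlaneTree (Fin n) (Fin N)} {e : Fin N} : t.Complete (.inl e) ↔
    (t.labels.Nodup ∧ ∀ v, v ∈ t.labels) ∧ (e :: t.marks).Nodup ∧ ∀ e', e' ∈ e :: t.marks := by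
  constructor
  · intro h
    refine ⟨⟨h.labels_nodup, h.mem_labels⟩, ?_, fun e' => ?_⟩
    · rw [← Multiset.coe_nodup, Multiset.nodup_iff_count_le_one]
      intro e'
      have := Multiset.nodup_iff_count_le_one.1 (Multiset.coe_nodup.2 h.1) (.inl e')
      simpa only [← Multiset.cons_coe, Multiset.count_cons, count_inl_inner, Sum.inl.injEq] using this
    · simpa [inl_mem_inner] using h.2 (.inl e')
  · rintro ⟨⟨h1, h2⟩, h3, h4⟩
    refine ⟨?_, ?_⟩
    · rw [← Multiset.coe_nodup, Multiset.nodup_iff_count_le_one]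
      rintro (e' | ⟨v, b⟩)
      · have := Multiset.nodup_iff_count_le_one.1 (Multiset.coe_nodup.2 h3) e'
        simpa only [← Multiset.cons_coe, Multiset.count_cons, count_inl_inner, Sum.inl.injEq]
          using this
      · have := Multiset.nodup_iff_count_le_one.1 (Multiset.coe_nodup.2 h1) v
        simpa only [← Multiset.cons_coe, Multiset.count_cons, count_inr_inner, reduceCtorEq,
          if_false, add_zero] using this
    · rintro (e' | ⟨v, b⟩)
      · simpa [inl_mem_inner] using h4 e'
      · simpa [inr_mem_inner] using h2 v

theorem exists_zip (s : PlaneTree B M) (l : List A) (hl : l.length = s.labels.length) :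
    ∃ u : PlaneTree (A × B) M, u.map Prod.snd = s ∧ (u.map Prod.fst).labels = l := by
  induction s generalizing l with
  | leaf => exact ⟨leaf, rfl, by simpa [labels, map, eq_comm] using hl⟩
  | mark e s hs =>
    obtain ⟨u, h1, h2⟩ := hs l hl
    exact ⟨mark e u, by simp [map, h1], h2⟩
  | node a b t s ht hs =>
    obtain _ | ⟨x, l⟩ := l
    · simp [labels] at hl
    · simp only [labels, List.length_cons, List.length_append, Nat.add_right_cancel_iff] at hl
      obtain ⟨u, h1, h2⟩ := ht (l.take t.labels.length) (by simp; omega)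
      obtain ⟨u', h1', h2'⟩ := hs (l.drop t.labels.length) (by simp; omega)
      exact ⟨node (x, a) b u u', by simp [map, h1, h1'], by simp [map, labels, h2, h2']⟩

theorem map_congr_of_labels {f : A → B} {g : A → B} {t : PlaneTree A M}
    (h : ∀ a ∈ t.labels, f a = g a) : t.map f = t.map g := by
  induction t with
  | leaf => rfl
  | mark e t ht => simp [map, ht h]
  | node a b t s ht hs =>
    simp only [labels, List.mem_cons, List.mem_append] at h
    simp [map, h a (.inl rfl), ht fun a ha => h a (.inr (.inl ha)),
      hs fun a ha => h a (.inr (.inr ha))]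

theorem map_map {C : Type} (f : A → B) (g : B → C) (t : PlaneTree A M) :
    (t.map f).map g = t.map (g ∘ f) := by
  induction t with
  | leaf => rfl
  | mark e t ht => simp [map, ht]
  | node a b t s ht hs => simp [map, ht, hs]

theorem eq_of_map_eq {f g : A → B} {t t' : PlaneTree A M} (h : t.map f = t'.map g)
    (hl : t.labels = t'.labels) : t = t' := by
  induction t generalizing t' with
  | leaf => cases t' <;> simp_all [map]
  | mark e t ht =>
    cases t' with
    | leaf => simp [map] at h
    | node a b t s => simp [map] at h
    | mark e' t' =>
      simp only [map, mark.injEq] at h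
      rw [h.1, ht h.2 hl]
  | node a b t s ht hs =>
    cases t' with
    | leaf => simp [map] at h
    | mark e' t' => simp [map] at h
    | node a' b' t' s' =>
      simp only [map, node.injEq] at h
      simp only [labels, List.cons.injEq] at hl
      have hlen : t.labels.length = t'.labels.length := by
        have := congrArg (fun t => t.labels.length) h.2.2.1
        simpa [labels_map] using this
      obtain ⟨h1, h2⟩ := List.append_inj hl.2 hlen
      rw [hl.1, h.2.1, ht h.2.2.1 h1, hs h.2.2.2 h2]

theorem exists_perm_ofFn {l : List (Fin n)} (hl : l.Nodup) (hl' : ∀ v, v ∈ l) :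
    ∃ e : Equiv.Perm (Fin n), List.ofFn e = l := by
  have hlen : l.length = n := by
    have := Fintype.card_congr (hl.getEquivOfForallMemList l hl')
    simpa using this
  refine ⟨(finCongr hlen.symm).trans (hl.getEquivOfForallMemList l hl'), ?_⟩
  apply List.ext_get
  · simp [hlen]
  · intro k h1 h2
    simp [List.Nodup.getEquivOfForallMemList]

open Classical in
/-- Each tree with ordered vertices is obtained from `n!` labelled vacuum graphs. -/
theorem sum_eq_factorial_mul_sum (e₀ : Fin N) (T : Finset (PlaneTree (Fin d) (Fin N)))
    (hT : ∀ s ∈ T, s.labels.length = n ∧ (e₀ :: s.marks).Nodup ∧ ∀ e, e ∈ e₀ :: s.marks)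
    (f : (Fin n → Fin d) → Equiv.Perm (Leg N n) → ℝ) (w : PlaneTree (Fin d) (Fin N) → ℝ)
    (hw : ∀ c ρ t, t.Complete (.inl e₀) → Follows ρ t (.inl e₀) (.inl e₀) → t.map c ∈ T →
      f c ρ = w (t.map c)) :
    (∑ c : Fin n → Fin d, ∑ ρ : Equiv.Perm (Leg N n),
      if ∃ t, t.Complete (.inl e₀) ∧ Follows ρ t (.inl e₀) (.inl e₀) ∧ t.map c ∈ T
      then f c ρ else 0) = n.factorial * ∑ s ∈ T, w s := by
  -- A coloured tree and an ordering of the vertices determine a labelled tree by writing the labels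
  -- in depth first order, hence a colouring and a contraction.
  have key : ∀ p : {s // s ∈ T} × Equiv.Perm (Fin n),
      ∃ q : (Fin n → Fin d) × Equiv.Perm (Leg N n),
        ∃ t, t.Complete (.inl e₀) ∧ Follows q.2 t (.inl e₀) (.inl e₀) ∧ t.map q.1 = p.1 ∧
          t.labels = List.ofFn p.2 := by
    rintro ⟨⟨s, hs⟩, e⟩
    obtain ⟨h1, h2, h3⟩ := hT s hs
    obtain ⟨u, hu1, hu2⟩ := exists_zip s (List.ofFn e) (by simp [h1])
    have hnd : (List.ofFn e).Nodup := List.nodup_ofFn.2 e.injective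
    have hmem : ∀ v, v ∈ List.ofFn e := fun v => by
      rw [List.mem_ofFn]; exact e.surjective v
    have hul : u.labels.map Prod.fst = List.ofFn e := by rw [← labels_map, hu2]
    obtain ⟨c, hc⟩ := exists_fun_of_nodup u.labels (by rwa [hul]) (by rwa [hul])
    have hcomp : (u.map Prod.fst).Complete (.inl e₀) := by
      rw [complete_iff, hu2, marks_map, ← marks_map Prod.snd u, hu1]
      exact ⟨⟨hnd, hmem⟩, h2, h3⟩
    obtain ⟨ρ, hρ⟩ := hcomp.exists_perm
    refine ⟨(c, ρ), u.map Prod.fst, hcomp, hρ, ?_, hu2⟩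
    rw [map_map]
    exact (map_congr_of_labels hc).trans hu1
  choose g t hg1 hg2 hg3 hg4 using key
  rw [← Fintype.sum_prod_type', ← Finset.sum_filter]
  have hR : (n.factorial : ℝ) * ∑ s ∈ T, w s =
      ∑ p : {s // s ∈ T} × Equiv.Perm (Fin n), w p.1 := by
    rw [Fintype.sum_prod_type]
    simp only [Finset.sum_const, Finset.card_univ, Fintype.card_perm, Fintype.card_fin,
      nsmul_eq_mul]
    rw [← Finset.mul_sum, Finset.sum_coe_sort T w]
  rw [hR]
  symm
  refine Finset.sum_bij (fun p _ => g p) ?_ ?_ ?_ ?_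
  · intro p _
    rw [Finset.mem_filter]
    exact ⟨Finset.mem_univ _, t p, hg1 p, hg2 p, by rw [hg3 p]; exact p.1.2⟩
  -- Uniqueness of parsing recovers the labelled tree from the contraction, and with it the coloured
  -- tree and the ordering.
  · intro p _ p' _ hpp
    have h2 := hg2 p'
    rw [← hpp] at h2
    have ht := (hg2 p).eq h2 (hg1 p).1 (hg1 p').1
    refine Prod.ext (Subtype.ext ?_) (Equiv.ext fun k => ?_)
    · rw [← hg3 p, ← hg3 p', ht, hpp]
    · have := hg4 p
      rw [ht, hg4 p'] at this
      exact (congrFun (List.ofFn_injective this) k).symm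
  · rintro ⟨c, ρ⟩ hq
    rw [Finset.mem_filter] at hq
    obtain ⟨-, t', h1, h2, h3⟩ := hq
    obtain ⟨e, he⟩ := exists_perm_ofFn h1.labels_nodup h1.mem_labels
    let p : {s // s ∈ T} × Equiv.Perm (Fin n) := (⟨_, h3⟩, e)
    refine ⟨p, Finset.mem_univ _, ?_⟩
    have ht : t p = t' := eq_of_map_eq (hg3 p) ((hg4 p).trans he)
    have hc : (g p).1 = c := by
      funext v
      have := congrArg labels (hg3 p)
      simp only [p] at this
      rw [labels_map, labels_map, ht] at this
      exact List.map_inj_left.1 this v (h1.mem_labels v)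
    have hρ : (g p).2 = ρ := h1.perm_unique (ht ▸ hg2 p) h2
    exact Prod.ext hc hρ
  · intro p _
    rw [hw _ _ (t p) (hg1 p) (hg2 p) (by rw [hg3 p]; exact p.1.2), hg3 p]

/-! ### Enumeration of trees -/

theorem finite_size_le (A M : Type) [Finite A] [Finite M] (k : ℕ) :
    {t : PlaneTree A M | t.labels.length + t.marks.length ≤ k}.Finite := by
  induction k with
  | zero =>
    refine (Set.finite_singleton leaf).subset ?_
    rintro (_ | ⟨a, b, t, s⟩ | ⟨e, t⟩) ht
    · rfl
    · simp [labels] at ht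
    · simp [marks] at ht
  | succ k ih =>
    have h1 := ((Set.finite_univ (α := A × Bool)).prod (ih.prod ih)).image
      fun p => node p.1.1 p.1.2 p.2.1 p.2.2
    have h2 := ((Set.finite_univ (α := M)).prod ih).image fun p => mark p.1 p.2
    refine (((Set.finite_singleton leaf).union h1).union h2).subset ?_
    rintro (_ | ⟨a, b, t, s⟩ | ⟨e, t⟩) ht
    · exact .inl (.inl rfl)
    · simp only [Set.mem_ofPred_eq, labels, marks, List.length_cons, List.length_append] at ht
      exact .inl (.inr ⟨((a, b), t, s), ⟨trivial, by simp only [Set.mem_ofPred_eq]; omega,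
        by simp only [Set.mem_ofPred_eq]; omega⟩, rfl⟩)
    · simp only [Set.mem_ofPred_eq, labels, marks, List.length_cons] at ht
      exact .inr ⟨(e, t), ⟨trivial, by simp only [Set.mem_ofPred_eq]; omega⟩, rfl⟩

/-- The trees without marks that have `n` edges. -/
noncomputable def trees (A M : Type) [Finite A] [Finite M] (n : ℕ) : Finset (PlaneTree A M) :=
  ((finite_size_le A M n).subset (t := {t | t.labels.length = n ∧ t.marks = []})
    fun t ht => by simp [ht.1, ht.2]).toFinset

/-- The trees with `n` edges and a mark `e`, such that all edges between the root and the mark have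
the colour `i`, and the mark is alone in its loop-vertex. -/
noncomputable def hearts [Finite A] [Finite M] (i : A) (e : M) (n : ℕ) : Finset (PlaneTree A M) :=
  ((finite_size_le A M (n + 1)).subset (t := {t | t.labels.length = n ∧ t.marks = [e] ∧ t.Heart i})
    fun t ht => by simp [ht.1, ht.2.1]).toFinset

section Enumeration

variable [Finite M]

@[simp] theorem mem_trees [Finite A] {t : PlaneTree A M} :
    t ∈ trees A M n ↔ t.labels.length = n ∧ t.marks = [] := by
  simp [trees]

@[simp] theorem mem_hearts [Finite A] {i : A} {e : M} {t : PlaneTree A M} :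
    t ∈ hearts i e n ↔ t.labels.length = n ∧ t.marks = [e] ∧ t.Heart i := by
  simp [hearts]

theorem sum_trees_zero [Finite A] (F : PlaneTree A M → ℝ) : ∑ t ∈ trees A M 0, F t = F leaf := by
  have : trees A M 0 = {leaf} := by
    ext t
    simp only [mem_trees, Finset.mem_singleton]
    rcases t with _ | ⟨a, b, t, s⟩ | ⟨e, t⟩ <;> simp [labels, marks]
  rw [this, Finset.sum_singleton]

/-- A nonempty tree without marks is its first root edge, the tree that hangs from it and the
remainder. This is the combinatorial form of the Dyson equation. -/
theorem sum_trees_succ [Fintype A] (F : PlaneTree A M → ℝ) (n : ℕ) :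
    ∑ t ∈ trees A M (n + 1), F t = ∑ p ∈ antidiagonal n, ∑ a : A, ∑ b : Bool,
      ∑ t ∈ trees A M p.1, ∑ s ∈ trees A M p.2, F (node a b t s) := by
  have hR : ∀ p : ℕ × ℕ, (∑ a : A, ∑ b : Bool, ∑ t ∈ trees A M p.1, ∑ s ∈ trees A M p.2,
      F (node a b t s)) = ∑ q ∈ (Finset.univ : Finset (A × Bool)) ×ˢ (trees A M p.1 ×ˢ trees A M p.2),
        F (node q.1.1 q.1.2 q.2.1 q.2.2) := by
    intro p
    simp only [Finset.sum_product, ← Finset.univ_product_univ]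
  simp only [hR]
  rw [Finset.sum_sigma']
  symm
  refine Finset.sum_bij (fun q _ => node q.2.1.1 q.2.1.2 q.2.2.1 q.2.2.2) ?_ ?_ ?_ ?_
  · rintro ⟨⟨k, l⟩, ⟨a, b⟩, t, s⟩ h
    simp only [Finset.mem_sigma, mem_antidiagonal, Finset.mem_product, mem_trees] at h
    obtain ⟨h1, -, ⟨h2, h3⟩, h4, h5⟩ := h
    exact mem_trees.2 ⟨by simp [labels, h2, h4, h1], by simp [marks, h3, h5]⟩
  · rintro ⟨⟨k, l⟩, ⟨a, b⟩, t, s⟩ h ⟨⟨k', l'⟩, ⟨a', b'⟩, t', s'⟩ h' hh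
    simp only [Finset.mem_sigma, mem_antidiagonal, Finset.mem_product, mem_trees] at h h'
    simp only [node.injEq] at hh
    obtain ⟨rfl, rfl, rfl, rfl⟩ := hh
    obtain rfl : k = k' := h.2.2.1.1.symm.trans h'.2.2.1.1
    obtain rfl : l = l' := h.2.2.2.1.symm.trans h'.2.2.2.1
    rfl
  · rintro (_ | ⟨a, b, t, s⟩ | ⟨e, t⟩) h
    · simp [labels] at h
    · simp only [mem_trees, labels, marks, List.length_cons, List.length_append,
        Nat.add_right_cancel_iff, List.append_eq_nil_iff] at h
      exact ⟨⟨(t.labels.length, s.labels.length), (a, b), t, s⟩, by simp [h], rfl⟩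
    · simp [marks] at h
  · intro q _
    rfl

theorem sum_hearts_zero [Finite A] (i : A) (e : M) (F : PlaneTree A M → ℝ) :
    ∑ t ∈ hearts i e 0, F t = 0 := by
  refine Finset.sum_eq_zero fun t ht => ?_
  rcases t with _ | ⟨a, b, t, s⟩ | ⟨e, t⟩ <;> simp [labels, marks, Heart] at ht

/-- The first root edge either leads to the mark, and then has colour `i` with a smaller heart or
the bare mark behind it, or it carries an unmarked tree. The position of the mark makes the two
cases disjoint. -/
theorem sum_hearts_succ [Fintype A] [DecidableEq A] (i : A) (e : M) (F : PlaneTree A M → ℝ)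
    (n : ℕ) :
    ∑ t ∈ hearts i e (n + 1), F t = ∑ p ∈ antidiagonal n, ((∑ b : Bool,
      ((∑ t ∈ hearts i e p.1, ∑ s ∈ trees A M p.2, F (node i b t s)) +
        if p.1 = 0 then ∑ s ∈ trees A M p.2, F (node i b (mark e leaf) s) else 0)) +
      ∑ a : A, ∑ b : Bool, ∑ t ∈ trees A M p.1, ∑ s ∈ hearts i e p.2, F (node a b t s)) := by
  classical
  let Q : ℕ → Finset (PlaneTree A M) := fun k => hearts i e k ∪ if k = 0 then {mark e leaf} else ∅
  have hQ : ∀ k (G : PlaneTree A M → ℝ), ∑ t ∈ Q k, G t =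
      (∑ t ∈ hearts i e k, G t) + if k = 0 then G (mark e leaf) else 0 := by
    intro k G
    simp only [Q]
    rw [Finset.sum_union]
    · split_ifs <;> simp
    · split_ifs
      · rw [Finset.disjoint_singleton_right]
        simp [Heart]
      · simp
  have hmQ : ∀ k t, t ∈ Q k ↔ t.labels.length = k ∧ t.marks = [e] ∧
      (t.Heart i ∨ ∃ e, t = mark e leaf) := by
    intro k t
    simp only [Q, Finset.mem_union, mem_hearts]
    constructor
    · rintro (h | h)
      · exact ⟨h.1, h.2.1, .inl h.2.2⟩
      · split_ifs at h with hk
        · rw [Finset.mem_singleton] at h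
          subst h
          exact ⟨by simp [labels, hk], by simp [marks], .inr ⟨e, rfl⟩⟩
        · simp at h
    · rintro ⟨h1, h2, h | ⟨e', rfl⟩⟩
      · exact .inl ⟨h1, h2, h⟩
      · simp only [labels, marks, List.length_nil, List.cons.injEq, and_true] at h1 h2
        right
        simp [← h1, h2]
  let T₁ := (antidiagonal n).sigma fun p =>
    (Finset.univ : Finset Bool) ×ˢ (Q p.1 ×ˢ trees A M p.2)
  let T₂ := (antidiagonal n).sigma fun p =>
    (Finset.univ : Finset (A × Bool)) ×ˢ (trees A M p.1 ×ˢ hearts i e p.2)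
  have h1 : ∀ p : ℕ × ℕ, (∑ b : Bool, ((∑ t ∈ hearts i e p.1, ∑ s ∈ trees A M p.2, F (node i b t s)) +
        if p.1 = 0 then ∑ s ∈ trees A M p.2, F (node i b (mark e leaf) s) else 0)) =
      ∑ q ∈ (Finset.univ : Finset Bool) ×ˢ (Q p.1 ×ˢ trees A M p.2),
        F (node i q.1 q.2.1 q.2.2) := by
    intro p
    simp only [Finset.sum_product, hQ]
  have h2 : ∀ p : ℕ × ℕ, (∑ a : A, ∑ b : Bool, ∑ t ∈ trees A M p.1, ∑ s ∈ hearts i e p.2,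
      F (node a b t s)) = ∑ q ∈ (Finset.univ : Finset (A × Bool)) ×ˢ (trees A M p.1 ×ˢ hearts i e p.2),
        F (node q.1.1 q.1.2 q.2.1 q.2.2) := by
    intro p
    simp only [Finset.sum_product, ← Finset.univ_product_univ]
  simp only [h1, h2]
  rw [Finset.sum_add_distrib, Finset.sum_sigma', Finset.sum_sigma']
  have himg : hearts i e (n + 1) =
      T₁.image (fun q => node i q.2.1 q.2.2.1 q.2.2.2) ∪
        T₂.image (fun q => node q.2.1.1 q.2.1.2 q.2.2.1 q.2.2.2) := by
    ext t
    simp only [Finset.mem_union, Finset.mem_image, T₁, T₂, Finset.mem_sigma, Finset.mem_product,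
      mem_antidiagonal, Finset.mem_univ, true_and, hmQ]
    constructor
    · intro h
      rcases t with _ | ⟨a, b, t, s⟩ | ⟨e', t⟩
      · simp [labels] at h
      · simp only [mem_hearts, labels, marks, List.length_cons, List.length_append,
          Nat.add_right_cancel_iff, Heart] at h
        obtain ⟨g1, g2, ⟨rfl, h4, h5⟩ | ⟨h3, h4⟩⟩ := h
        · rw [h5, List.append_nil] at g2
          exact .inl ⟨⟨(t.labels.length, s.labels.length), b, t, s⟩,
            ⟨g1, ⟨rfl, g2, h4⟩, mem_trees.2 ⟨rfl, h5⟩⟩, rfl⟩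
        · rw [h3, List.nil_append] at g2
          exact .inr ⟨⟨(t.labels.length, s.labels.length), (a, b), t, s⟩,
            ⟨g1, mem_trees.2 ⟨rfl, h3⟩, mem_hearts.2 ⟨rfl, g2, h4⟩⟩, rfl⟩
      · simp [Heart] at h
    · rintro (⟨⟨⟨k, l⟩, b, t, s⟩, ⟨h1, ⟨h2, h3, h4⟩, h5⟩, rfl⟩ |
        ⟨⟨⟨k, l⟩, ⟨a, b⟩, t, s⟩, ⟨h1, h2, h3⟩, rfl⟩)
      · rw [mem_trees] at h5
        simp only at h1 h2 h5
        refine mem_hearts.2 ⟨?_, ?_, .inl ⟨rfl, h4, h5.2⟩⟩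
        · simp [labels, h2, h5.1, h1]
        · simp [marks, h3, h5.2]
      · rw [mem_trees] at h2
        rw [mem_hearts] at h3
        simp only at h1 h2 h3
        refine mem_hearts.2 ⟨?_, ?_, .inr ⟨h2.2, h3.2.2⟩⟩
        · simp [labels, h2.1, h3.1, h1]
        · simp [marks, h3.2.1, h2.2]
  rw [himg, Finset.sum_union, Finset.sum_image, Finset.sum_image]
  · rintro ⟨⟨k, l⟩, ⟨a, b⟩, t, s⟩ h ⟨⟨k', l'⟩, ⟨a', b'⟩, t', s'⟩ h' hh
    simp only [T₂, Finset.coe_sigma, Set.mem_sigma_iff, Finset.coe_product, Set.mem_prod,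
      Finset.mem_coe, mem_trees, mem_hearts] at h h'
    simp only [node.injEq] at hh
    obtain ⟨rfl, rfl, rfl, rfl⟩ := hh
    obtain rfl : k = k' := h.2.2.1.1.symm.trans h'.2.2.1.1
    obtain rfl : l = l' := h.2.2.2.1.symm.trans h'.2.2.2.1
    rfl
  · rintro ⟨⟨k, l⟩, b, t, s⟩ h ⟨⟨k', l'⟩, b', t', s'⟩ h' hh
    simp only [T₁, Finset.coe_sigma, Set.mem_sigma_iff, Finset.coe_product, Set.mem_prod,
      Finset.mem_coe, mem_trees, hmQ] at h h'
    simp only [node.injEq] at hh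
    obtain ⟨-, rfl, rfl, rfl⟩ := hh
    obtain rfl : k = k' := h.2.2.1.1.symm.trans h'.2.2.1.1
    obtain rfl : l = l' := h.2.2.2.1.symm.trans h'.2.2.2.1
    rfl
  · rw [Finset.disjoint_left]
    intro t ht ht'
    simp only [Finset.mem_image, T₁, T₂, Finset.mem_sigma, Finset.mem_product, hmQ, mem_trees] at ht ht'
    obtain ⟨q, hq, rfl⟩ := ht
    obtain ⟨q', hq', hh⟩ := ht'
    simp only [node.injEq] at hh
    have h1 := hq.2.2.1.2.1
    rw [← hh.2.2.1, hq'.2.2.1.2] at h1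
    simp at h1

end Enumeration

end PlaneTree

namespace PlaneTree

variable {A M : Type} {N n d : ℕ}

/-! ### One-particle irreducible trees -/

open Classical in
/-- The trees with a single edge at the root, of a colour in `J`, and the rest of the tree in `R`. -/
noncomputable def stems (J : Finset A) (R : Finset (PlaneTree A M)) : Finset (PlaneTree A M) :=
  (J ×ˢ ((Finset.univ : Finset Bool) ×ˢ R)).image fun q => node q.1 q.2.1 q.2.2 leaf

theorem mem_stems {J : Finset A} {R : Finset (PlaneTree A M)} {t : PlaneTree A M} :
    t ∈ stems J R ↔ ∃ j ∈ J, ∃ b, ∃ s ∈ R, t = node j b s leaf := by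
  simp only [stems, Finset.mem_image, Finset.mem_product, Finset.mem_univ, true_and, Prod.exists]
  constructor
  · rintro ⟨j, b, s, ⟨h1, h2⟩, rfl⟩
    exact ⟨j, h1, b, s, h2, rfl⟩
  · rintro ⟨j, h1, b, s, h2, rfl⟩
    exact ⟨j, b, s, ⟨h1, h2⟩, rfl⟩

theorem sum_stems (J : Finset A) (R : Finset (PlaneTree A M)) (F : PlaneTree A M → ℝ) :
    ∑ t ∈ stems J R, F t = ∑ j ∈ J, ∑ b : Bool, ∑ s ∈ R, F (node j b s leaf) := by
  classical
  rw [stems, Finset.sum_image]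
  · simp only [Finset.sum_product]
  · rintro ⟨j, b, s⟩ - ⟨j', b', s'⟩ - h
    simp only [node.injEq] at h
    obtain ⟨rfl, rfl, rfl, -⟩ := h
    rfl

open Classical in
/-- The possible rests of a tree with a heart face of colour `i`. -/
noncomputable def cores [Finite A] [Finite M] (i : A) (e : M) (n : ℕ) : Finset (PlaneTree A M) :=
  hearts i e n ∪ if n = 0 then {mark e leaf} else ∅

theorem mem_cores [Finite A] [Finite M] {i : A} {e : M} {t : PlaneTree A M} :
    t ∈ cores i e n ↔ t.labels.length = n ∧ t.marks = [e] ∧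
      (t.Heart i ∨ ∃ e, t = mark e leaf) := by
  simp only [cores, Finset.mem_union, mem_hearts]
  constructor
  · rintro (h | h)
    · exact ⟨h.1, h.2.1, .inl h.2.2⟩
    · split_ifs at h with hk
      · rw [Finset.mem_singleton] at h
        subst h
        exact ⟨by simp [labels, hk], by simp [marks], .inr ⟨e, rfl⟩⟩
      · simp at h
  · rintro ⟨h1, h2, h | ⟨e', rfl⟩⟩
    · exact .inl ⟨h1, h2, h⟩
    · simp only [labels, marks, List.length_nil, List.cons.injEq, and_true] at h1 h2
      right
      simp [← h1, h2]

theorem sum_cores [Finite A] [Finite M] (i : A) (e : M) (n : ℕ) (F : PlaneTree A M → ℝ) :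
    ∑ t ∈ cores i e n, F t = (∑ t ∈ hearts i e n, F t) + if n = 0 then F (mark e leaf) else 0 := by
  classical
  rw [cores, Finset.sum_union]
  · split_ifs <;> simp
  · split_ifs
    · rw [Finset.disjoint_singleton_right]
      simp [Heart]
    · simp

theorem Complete.labels_length {t : PlaneTree (Fin n) (Fin N)} {e : Fin N}
    (h : t.Complete (.inl e)) : t.labels.length = n := by
  obtain ⟨π, hπ⟩ := exists_perm_ofFn h.labels_nodup h.mem_labels
  rw [← hπ, List.length_ofFn]

theorem Complete.marks_one {t : PlaneTree (Fin n) (Fin 1)} (h : t.Complete (.inl 0)) :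
    t.marks = [] := by
  have h1 := (complete_iff.1 h).2.1
  rw [List.nodup_cons] at h1
  refine List.eq_nil_iff_forall_not_mem.2 fun e he => h1.1 ?_
  rwa [Subsingleton.elim e 0] at he

theorem Complete.marks_two {t : PlaneTree (Fin n) (Fin 2)} (h : t.Complete (.inl 0)) :
    t.marks = [1] := by
  obtain ⟨-, h1, h2⟩ := complete_iff.1 h
  have h3 : (1 : Fin 2) ∈ t.marks := by simpa using h2 1
  rw [List.nodup_cons] at h1
  have h4 : ∀ e ∈ t.marks, e = 1 := fun e he => by
    have : e ≠ 0 := fun h0 => h1.1 (h0 ▸ he)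
    omega
  rcases hl : t.marks with _ | ⟨a, _ | ⟨b, l⟩⟩
  · simp [hl] at h3
  · rw [h4 a (by simp [hl])]
  · have ha := h4 a (by simp [hl])
    have hb := h4 b (by simp [hl])
    have := h1.2
    rw [hl, ha, hb] at this
    simp at this

theorem onePI_isTree_iff {c : Fin (n + 1) → Fin d} {J : Finset (Fin d)} {σ : Wick 1 (n + 1)} :
    (IsOnePI σ ∧ IsTree σ ∧ ∀ v b, σ (.inl 0) = .inr (v, b) → c v ∈ J) ↔
      ∃ t, t.Complete (.inl 0) ∧ Follows σ t (.inl 0) (.inl 0) ∧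
        t.map c ∈ stems J (trees (Fin d) (Fin 1) n) := by
  constructor
  · rintro ⟨h1, h2, h3⟩
    obtain ⟨t, ht, hσ⟩ := exists_follows h2 0
    obtain ⟨v, b, s, rfl, -⟩ := ht.exists_node_of_onePI hσ h1
    refine ⟨_, ht, hσ, mem_stems.2 ⟨c v, h3 v b (follows_node.1 hσ).1, b, s.map c,
      mem_trees.2 ⟨?_, ?_⟩, rfl⟩⟩
    · have := ht.labels_length
      simpa [labels_map, labels] using this
    · have := ht.marks_one
      simpa [marks_map, marks] using this
  · rintro ⟨t, ht, hσ, hc⟩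
    obtain ⟨j, hj, b, s, hs, hts⟩ := mem_stems.1 hc
    rcases t with _ | ⟨v, b', t, _ | _ | _⟩ | _ <;> simp only [map, node.injEq, reduceCtorEq,
      and_false] at hts
    obtain ⟨rfl, rfl, rfl, -⟩ := hts
    have hm : t.marks = [] := by
      have := ht.marks_one
      simpa [marks] using this
    refine ⟨ht.onePI (.inl (adm_of_marks_eq_nil hm)) hσ, ht.isTree hσ, fun w β hw => ?_⟩
    rw [(follows_node.1 hσ).1] at hw
    obtain ⟨rfl, -⟩ := Prod.ext_iff.1 (Sum.inr_injective hw)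
    exact hj

theorem iterate_symm {α : Type*} [Finite α] {f : α → α} (hf : Function.Injective f) {a b : α}
    {k : ℕ} (h : f^[k] a = b) : ∃ k, f^[k] b = a := by
  let e : Equiv.Perm α := Equiv.ofBijective f (Finite.injective_iff_bijective.1 hf)
  have he : ∀ k x, (e ^ k) x = f^[k] x := fun k x => by
    rw [← Equiv.Perm.iterate_eq_pow]; rfl
  have : e.SameCycle b a := by
    refine Equiv.Perm.SameCycle.symm ⟨k, ?_⟩
    rw [zpow_natCast, he, h]
  obtain ⟨k, hk⟩ := this.exists_nat_pow_eq
  exact ⟨k, by rw [← he, hk]⟩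

theorem strand_involutive (c : Fin n → Fin d) (i : Fin d) :
    Function.Involutive (strand c i : Leg N n → Leg N n) := by
  rintro (e | ⟨v, b⟩)
  · rfl
  · by_cases hv : c v = i
    · simp [strand_of_eq hv]
    · simp [strand_of_ne hv]

/-- The face condition rules out the closed set of `Adm.heart_or_closed`, which would confine the
face of mark 1 away from the root. In the other direction the face is followed from the root across
the edges of colour `i`. -/
theorem melonic_two_iff {c : Fin (n + 1) → Fin d} {i : Fin d} {ρ : Wick 2 (n + 1)} :
    (IsOnePI ρ ∧ IsTree ρ ∧ (∀ e e', OnSameFace c i ρ e e') ∧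
      ∀ e v b, ρ (.inl e) = .inr (v, b) → c v = i) ↔
      ∃ t, t.Complete (.inl 0) ∧ Follows ρ t (.inl 0) (.inl 0) ∧
        t.map c ∈ stems {i} (cores i 1 n) := by
  constructor
  · rintro ⟨h1, h2, h3, h4⟩
    obtain ⟨t, ht, hσ⟩ := exists_follows h2 0
    obtain ⟨v, b, s, rfl, hs⟩ := ht.exists_node_of_onePI hσ h1
    obtain ⟨g1, g2, -⟩ := follows_node.1 hσ
    have hm : s.marks = [1] := by
      have := ht.marks_two
      simpa [marks] using this
    refine ⟨_, ht, hσ, mem_stems.2 ⟨c v, by simpa using h4 0 v b g1, b, s.map c,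
      mem_cores.2 ⟨?_, ?_, ?_⟩, rfl⟩⟩
    · have := ht.labels_length
      simpa [labels_map, labels] using this
    · rw [marks_map, hm]
    · rcases hs with hs | ⟨e, rfl⟩
      · refine (hs.heart_or_closed g2 hm).imp_right ?_
        rintro ⟨S, hS1, hS2, hS3⟩
        exfalso
        obtain ⟨k, hk⟩ := h3 1 0
        have hmem : ∀ k, (fun x => strand c i (ρ x))^[k] (.inl 1) ∈ S := by
          intro k
          induction k with
          | zero => exact hS1
          | succ k ih =>
            rw [Function.iterate_succ_apply']
            exact hS3 _ ih
        have h5 := hS2 _ (hk ▸ hmem k)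
        have := (List.nodup_cons.1 ht.1).1
        simp [inner, h5] at this
      · exact .inr ⟨e, rfl⟩
  · rintro ⟨t, ht, hσ, hc⟩
    obtain ⟨j, hj, b, s, hs, hts⟩ := mem_stems.1 hc
    rcases t with _ | ⟨v, b', t, _ | _ | _⟩ | _ <;> simp only [map, node.injEq, reduceCtorEq,
      and_false] at hts
    obtain ⟨rfl, rfl, rfl, -⟩ := hts
    rw [Finset.mem_singleton] at hj
    obtain ⟨g1, g2, -⟩ := follows_node.1 hσ
    have hm : t.marks = [1] := by
      have := ht.marks_two
      simpa [marks] using this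
    have hh : (t.map c).Heart i ∨ t = mark 1 leaf := by
      refine (mem_cores.1 hs).2.2.imp_right ?_
      rintro ⟨e, he⟩
      rw [map_eq_mark_leaf] at he
      subst he
      simp only [marks, List.cons.injEq, and_true] at hm
      rw [hm]
    have h01 : OnSameFace c i ρ 0 1 := by
      obtain ⟨k, hk⟩ : ∃ k, (fun x => strand c i (ρ x))^[k] (.inr (v, !b')) = .inl 1 := by
        rcases hh with hh | rfl
        · obtain ⟨e, he, k, hk⟩ := hh.face_exists g2
          rw [hm, List.mem_singleton] at he
          exact ⟨k, by rw [hk, he]⟩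
        · exact ⟨1, by simp [(follows_mark.1 g2).1, strand]⟩
      refine ⟨k + 1, ?_⟩
      rw [Function.iterate_add_apply, Function.iterate_one]
      simp only [g1, strand_of_eq hj]
      exact hk
    -- The face map is a permutation of a finite set, so its orbits can be followed backwards.
    have h10 : OnSameFace c i ρ 1 0 := by
      obtain ⟨k, hk⟩ := h01
      exact iterate_symm (((strand_involutive c i).injective).comp ρ.injective) hk
    refine ⟨ht.onePI ?_ hσ, ht.isTree hσ, ?_, ?_⟩
    · rcases hh with hh | rfl
      · exact .inl hh.adm
      · exact .inr ⟨1, rfl⟩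
    · intro e e'
      fin_cases e <;> fin_cases e'
      exacts [⟨0, rfl⟩, h01, h10, ⟨0, rfl⟩]
    · intro e w β hw
      fin_cases e
      · simp only [Fin.zero_eta] at hw
        rw [g1] at hw
        obtain ⟨rfl, -⟩ := Prod.ext_iff.1 (Sum.inr_injective hw)
        exact hj
      · simp only [Fin.mk_one] at hw
        rcases hh with hh | rfl
        · obtain ⟨w', β', h1, h2⟩ := hh.apply_mark g2 (e := 1) (by simp [hm])
          rw [h1] at hw
          obtain ⟨rfl, -⟩ := Prod.ext_iff.1 (Sum.inr_injective hw)
          exact h2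
        · rw [follows_leaf.1 (follows_mark.1 g2).2] at hw
          obtain ⟨rfl, -⟩ := Prod.ext_iff.1 (Sum.inr_injective hw)
          exact hj

end PlaneTree

/-! ### Amplitudes of trees -/

section IteratedSum

variable {V E : Type} [DecidableEq V]

/-- The iterated sum over the variables in a list. -/
def iterSum (K : Finset E) : List V → ((V → E) → ℝ) → (V → E) → ℝ
  | [], F, Q => F Q
  | v :: l, F, Q => ∑ q ∈ K, iterSum K l F (Function.update Q v q)

variable {K : Finset E}

theorem iterSum_append (l l' : List V) (F : (V → E) → ℝ) (Q : V → E) :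
    iterSum K (l ++ l') F Q = iterSum K l (iterSum K l' F) Q := by
  induction l generalizing Q with
  | nil => rfl
  | cons v l ih => simp [iterSum, ih]

theorem iterSum_congr {l : List V} {F F' : (V → E) → ℝ} {Q : V → E}
    (h : ∀ Q', (∀ v, v ∉ l → Q' v = Q v) → F Q' = F' Q') : iterSum K l F Q = iterSum K l F' Q := by
  induction l generalizing Q with
  | nil => exact h Q fun _ _ => rfl
  | cons v l ih =>
    refine Finset.sum_congr rfl fun q _ => ih fun Q' hQ' => h Q' fun w hw => ?_
    simp only [List.mem_cons, not_or] at hw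
    rw [hQ' w hw.2, Function.update_of_ne hw.1]

theorem iterSum_mul (l : List V) (a : ℝ) (F : (V → E) → ℝ) (Q : V → E) :
    iterSum K l (fun Q => a * F Q) Q = a * iterSum K l F Q := by
  induction l generalizing Q with
  | nil => rfl
  | cons v l ih => simp [iterSum, ih, Finset.mul_sum]

theorem sum_piFinset_eq_iterSum [Fintype V] [DecidableEq E] {l : List V} (hl : l.Nodup)
    (F : (V → E) → ℝ) (Q : V → E) :
    ∑ Q' ∈ Fintype.piFinset (fun v => if v ∈ l then K else {Q v}), F Q' = iterSum K l F Q := by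
  induction l generalizing Q with
  | nil =>
    have : Fintype.piFinset (fun v => ({Q v} : Finset E)) = {Q} := by
      ext Q'; simp [funext_iff]
    simp [iterSum, this]
  | cons v l ih =>
    rw [List.nodup_cons] at hl
    rw [iterSum, ← Finset.sum_fiberwise_of_maps_to (g := fun Q' : V → E => Q' v) (t := K)]
    · refine Finset.sum_congr rfl fun q hq => ?_
      rw [← ih hl.2]
      refine Finset.sum_congr ?_ fun _ _ => rfl
      ext Q'
      simp only [Finset.mem_filter, Fintype.mem_piFinset, List.mem_cons]
      constructor
      · rintro ⟨h, rfl⟩ w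
        have := h w
        by_cases hw : w = v
        · subst hw; simp [hl.1]
        · simpa [hw] using this
      · intro h
        have hv : Q' v = q := by simpa [hl.1] using h v
        refine ⟨fun w => ?_, hv⟩
        by_cases hw : w = v
        · subst hw; simpa [hv] using hq
        · simpa [hw] using h w
    · intro Q' hQ'
      simpa using Fintype.mem_piFinset.1 hQ' v

end IteratedSum

namespace PlaneTree

variable {M : Type} {N n d : ℕ}

open Classical in
/-- The amplitude of a tree with propagator `C`, with momenta in `K` and with momentum `P` at the
marks. The propagators of the first and of the last line occur if `bx` resp. `b'` holds. -/
noncomputable def weight (C : (Fin d → ℤ) → ℝ) (K : Finset (Fin d → ℤ)) (P : Fin d → ℤ) :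
    PlaneTree (Fin d) M → Bool → Bool → (Fin d → ℤ) → ℝ
  | leaf, b, b', p => if b ∧ b' then C p else 1
  | node j _ t s, b, b', p => (if b then C p else 1) *
      ((∑ q ∈ K with q j = p j, weight C K P t true true q) * weight C K P s true b' p)
  | mark _ t, _, b', p => (if p = P then 1 else 0) * weight C K P t false b' p

open Classical in
/-- The amplitude of a labelled tree before the summation over the momenta `Q v`. -/
noncomputable def preWeight (c : Fin n → Fin d) (C : (Fin d → ℤ) → ℝ) (P : Fin d → ℤ)
    (Q : Fin n → Fin d → ℤ) : PlaneTree (Fin n) M → Bool → Bool → (Fin d → ℤ) → ℝ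
  | leaf, b, b', p => if b ∧ b' then C p else 1
  | node v _ t s, b, b', p => (if b then C p else 1) *
      (((if Q v (c v) = p (c v) then 1 else 0) * preWeight c C P Q t true true (Q v)) *
        preWeight c C P Q s true b' p)
  | mark _ t, _, b', p => (if p = P then 1 else 0) * preWeight c C P Q t false b' p

section Weight

variable {c : Fin n → Fin d} {C : (Fin d → ℤ) → ℝ} {P : Fin d → ℤ} {K : Finset (Fin d → ℤ)}

theorem preWeight_congr {t : PlaneTree (Fin n) M} {Q Q' : Fin n → Fin d → ℤ}
    (h : ∀ v ∈ t.labels, Q v = Q' v) (b b' : Bool) (p : Fin d → ℤ) :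
    preWeight c C P Q t b b' p = preWeight c C P Q' t b b' p := by
  induction t generalizing b b' p with
  | leaf => rfl
  | mark e t ht => simp only [preWeight]; rw [ht h]
  | node v β t s ht hs =>
    simp only [labels, List.mem_cons, List.mem_append] at h
    simp only [preWeight]
    rw [h v (.inl rfl), ht fun v hv => h v (.inr (.inl hv)), hs fun v hv => h v (.inr (.inr hv))]

/-- Different subtrees involve different summation variables and interact only through the momentum
at the node, so the iterated sum factorizes along the tree. -/
theorem iterSum_preWeight {t : PlaneTree (Fin n) M} (hn : t.labels.Nodup) (b b' : Bool)
    (p : Fin d → ℤ) (Q : Fin n → Fin d → ℤ) :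
    iterSum K t.labels (fun Q => preWeight c C P Q t b b' p) Q =
      weight C K P (t.map c) b b' p := by
  classical
  induction t generalizing b b' p Q with
  | leaf => rfl
  | mark e t ht =>
    simp only [labels, preWeight, map, weight]
    rw [iterSum_mul, ht hn]
  | node v β t s ht hs =>
    simp only [labels, List.nodup_cons, List.mem_append, not_or, List.nodup_append] at hn
    obtain ⟨⟨hv1, hv2⟩, hn1, hn2, hdis⟩ := hn
    simp only [labels, map, weight, iterSum]
    rw [Finset.sum_filter, Finset.sum_mul, Finset.mul_sum]
    refine Finset.sum_congr rfl fun q _ => ?_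
    rw [iterSum_append]
    have h1 : ∀ Q', (∀ w, w ∉ t.labels → Q' w = Function.update Q v q w) →
        iterSum K s.labels (fun Q => preWeight c C P Q (node v β t s) b b' p) Q' =
        ((if b then C p else 1) * (if q (c v) = p (c v) then 1 else 0) *
          weight C K P (s.map c) true b' p) * preWeight c C P Q' t true true q := by
      intro Q' hQ'
      have h2 : ∀ Q'', (∀ w, w ∉ s.labels → Q'' w = Q' w) →
          preWeight c C P Q'' (node v β t s) b b' p = ((if b then C p else 1) *
            (if q (c v) = p (c v) then 1 else 0) * preWeight c C P Q' t true true q) *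
              preWeight c C P Q'' s true b' p := by
        intro Q'' hQ''
        have hq : Q'' v = q := by rw [hQ'' v hv2, hQ' v hv1, Function.update_self]
        simp only [preWeight]
        rw [hq, preWeight_congr (t := t) (Q := Q'') (Q' := Q') fun w hw =>
          hQ'' w fun hw' => hdis w hw w hw' rfl]
        ring
      rw [iterSum_congr h2, iterSum_mul, hs hn2]
      ring
    rw [iterSum_congr h1, iterSum_mul, ht hn1]
    split_ifs <;> ring

/-- The cycle that hangs from a vertex begins with a propagator or with a mark. The former confines
its momentum to the support of `C`, the latter sets it to `P`. -/
theorem mem_of_preWeight_ne_zero (hC : ∀ q, C q ≠ 0 → q ∈ K) (hP : P ∈ K)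
    {t : PlaneTree (Fin n) M} {b b' : Bool} {p : Fin d → ℤ} {Q : Fin n → Fin d → ℤ}
    (h : preWeight c C P Q t b b' p ≠ 0) : (b = true → b' = true → p ∈ K) ∧
      ∀ v ∈ t.labels, Q v ∈ K := by
  induction t generalizing b b' p with
  | leaf =>
    refine ⟨?_, by simp [labels]⟩
    rintro rfl rfl
    exact hC _ (by simpa [preWeight] using h)
  | mark e t ht =>
    simp only [preWeight, ne_eq, mul_eq_zero, not_or] at h
    refine ⟨fun _ _ => ?_, (ht h.2).2⟩
    have : p = P := by by_contra hne; simp [hne] at h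
    rwa [this]
  | node v β t s ht hs =>
    simp only [preWeight, ne_eq, mul_eq_zero, not_or] at h
    refine ⟨?_, fun w hw => ?_⟩
    · rintro rfl -
      exact hC _ (by simpa using h.1)
    · simp only [labels, List.mem_cons, List.mem_append] at hw
      rcases hw with rfl | hw | hw
      · exact (ht h.2.1.2).1 rfl rfl
      · exact (ht h.2.1.2).2 w hw
      · exact (hs h.2.2).2 w hw

end Weight

theorem vertexTensor_self (i : Fin d) (p q : Fin d → ℤ) :
    vertexTensor i p p q q = if p i = q i then 1 else 0 := by
  simp only [vertexTensor, if_true, mul_one, Finset.prod_const_one]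
  split_ifs <;> simp

theorem vertexTensor_ne_zero {i : Fin d} {p₁ p₂ p₃ p₄ : Fin d → ℤ}
    (h : vertexTensor i p₁ p₂ p₃ p₄ ≠ 0) :
    p₁ i = p₄ i ∧ p₂ i = p₃ i ∧ ∀ j, j ≠ i → p₁ j = p₂ j ∧ p₃ j = p₄ j := by
  simp only [vertexTensor, ne_eq, mul_eq_zero, not_or, Finset.prod_eq_zero_iff, not_exists,
    not_and] at h
  refine ⟨by by_contra hne; simp [hne] at h, by by_contra hne; simp [hne] at h, fun j hj => ?_⟩
  have := h.2 j (by simp [hj])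
  exact ⟨by by_contra hne; simp [hne] at this, by by_contra hne; simp [hne] at this⟩

section Amplitude

variable {r : Leg N n → Option (Fin n)} {β : Fin n → Bool} {t : PlaneTree (Fin n) (Fin N)}
  {o : Option (Fin n)} {x y : Leg N n} {ρ : Equiv.Perm (Leg N n)} {c : Fin n → Fin d}
  {k : Leg N n → Fin d → ℤ} {P : Fin d → ℤ}

/-- Momentum is constant on each loop-vertex. The cycle that hangs from `v` closes up, so by
induction the momenta on the two sides of the far corner agree. The deltas of the vertex then
identify the momenta at the near corner: components other than `c v` directly, the component `c v`
by passing through the far corner. -/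
theorem Owned.conservation (h : Owned r β t o x) (hρ : Follows ρ t x y)
    (hv : ∀ v, vertexTensor (c v) (k (.inr (v, false))) (k (ρ.symm (.inr (v, false))))
      (k (.inr (v, true))) (k (ρ.symm (.inr (v, true)))) ≠ 0)
    (hP : ∀ e, k (.inl e) = P ∧ k (ρ.symm (.inl e)) = P)
    (hx : k x = o.elim P fun v => k (.inr (v, !β v))) :
    (∀ a ∈ x :: t.inner, k a = (r a).elim P fun v => k (.inr (v, !β v))) ∧
      k (ρ.symm y) = k x := by
  induction t generalizing o x y with
  | leaf =>
    have hr : r x = o := h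
    refine ⟨fun a ha => ?_, ?_⟩
    · simp only [inner, List.mem_singleton] at ha
      rw [ha, hr, hx]
    · rw [← follows_leaf.1 hρ, ρ.symm_apply_apply]
  | node v b t s ht hs =>
    obtain ⟨h1, h2, h3, h4⟩ := h
    obtain ⟨g1, g2, g3⟩ := follows_node.1 hρ
    subst h2
    obtain ⟨ht1, ht2⟩ := ht h3 g2 rfl
    have hvb : k (.inr (v, β v)) = k x := by
      have hw := vertexTensor_ne_zero (hv v)
      have hsym : ρ.symm (.inr (v, β v)) = x := by rw [← g1, ρ.symm_apply_apply]
      cases hβ : β v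
      · rw [hβ] at hsym ht2
        simp only [Bool.not_false] at ht2
        rw [hsym, ht2] at hw
        funext j
        by_cases hj : j = c v
        · subst hj; rw [hw.1, hw.2.1]
        · exact (hw.2.2 j hj).1
      · rw [hβ] at hsym ht2
        simp only [Bool.not_true] at ht2
        rw [hsym, ht2] at hw
        funext j
        by_cases hj : j = c v
        · subst hj; rw [← hw.1, hw.2.1]
        · exact (hw.2.2 j hj).2
    obtain ⟨hs1, hs2⟩ := hs h4 g3 (hvb.trans hx)
    refine ⟨fun a ha => ?_, hs2.trans hvb⟩
    simp only [inner, List.mem_cons, List.mem_append] at ha hs1 ht1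
    rcases ha with rfl | rfl | rfl | ha | ha
    · rw [h1, hx]
    · exact hs1 _ (.inl rfl)
    · exact ht1 _ (.inl rfl)
    · exact ht1 _ (.inr ha)
    · exact hs1 _ (.inr ha)
  | mark e t ht =>
    obtain ⟨h1, h2⟩ := h
    obtain ⟨g1, g2⟩ := follows_mark.1 hρ
    have hke : k (.inl e) = k x := by
      have := (hP e).2
      rw [← g1, ρ.symm_apply_apply] at this
      rw [(hP e).1, this]
    obtain ⟨ht1, ht2⟩ := ht h2 g2 (hke.trans hx)
    refine ⟨fun a ha => ?_, ht2.trans hke⟩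
    simp only [inner, List.mem_cons] at ha ht1
    rcases ha with rfl | rfl | ha
    · rw [h1, hx]
    · exact ht1 _ (.inl rfl)
    · exact ht1 _ (.inr ha)

open Classical in
-- This unfolds the recursive weight into a product over lines, vertices and marks, the shape of the
-- Feynman amplitude.
theorem Owned.preWeight_eq (h : Owned r β t o x) (hρ : Follows ρ t x y)
    (C : (Fin d → ℤ) → ℝ) (Q : Fin n → Fin d → ℤ) :
    preWeight c C P Q t x.isRight y.isRight (o.elim P Q) =
      ((t.steps x y).map fun s =>
        if s.1.isRight ∧ (ρ s.1).isRight then C ((r s.1).elim P Q) else 1).prod *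
      (t.labels.map fun v => if (r (.inr (v, false))).elim P Q (c v) =
        (r (.inr (v, true))).elim P Q (c v) then (1 : ℝ) else 0).prod *
      (t.marks.map fun e => if (r (.inl e)).elim P Q = P then (1 : ℝ) else 0).prod := by
  induction t generalizing o x y with
  | leaf =>
    have hr : r x = o := h
    simp [preWeight, steps, labels, marks, follows_leaf.1 hρ, hr]
  | node v b t s ht hs =>
    obtain ⟨h1, rfl, h3, h4⟩ := h
    obtain ⟨g1, g2, g3⟩ := follows_node.1 hρ
    have ht' := ht h3 g2
    have hs' := hs h4 g3
    have hg : (if Q v (c v) = o.elim P Q (c v) then (1 : ℝ) else 0) =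
        if (r (.inr (v, false))).elim P Q (c v) = (r (.inr (v, true))).elim P Q (c v) then
          1 else 0 := by
      have h5 := h3.start
      have h6 := h4.start
      cases hβ : β v
      · rw [hβ] at h5 h6
        simp only [Bool.not_false] at h5
        rw [h5, h6]
        simp [eq_comm]
      · rw [hβ] at h5 h6
        simp only [Bool.not_true] at h5
        rw [h5, h6]
        simp only [Option.elim_some]
        congr
    simp only [Sum.isRight_inr, Option.elim_some] at ht' hs'
    simp only [preWeight, ht', hs', hg, steps, labels, marks, List.map_cons, List.map_append,
      List.prod_cons, List.prod_append, g1, h1, Sum.isRight_inr, and_true]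
    ring
  | mark e t ht =>
    obtain ⟨h1, h2⟩ := h
    obtain ⟨g1, g2⟩ := follows_mark.1 hρ
    have ht' := ht h2 g2
    simp only [Sum.isRight_inl] at ht'
    simp only [preWeight, ht', steps, labels, marks, List.map_cons,
      List.prod_cons, g1, h2.start, Sum.isRight_inl, and_false, Bool.false_eq_true, if_false]
    ring

theorem prod_eq_list_prod {α : Type*} [Fintype α] {l : List α} (hl : l.Nodup) (hl' : ∀ a, a ∈ l)
    (f : α → ℝ) : ∏ a, f a = (l.map f).prod := by
  classical
  rw [← List.prod_toFinset f hl]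
  congr 1
  ext a
  simp [hl' a]

open Classical in
theorem list_prod_indicator {α : Type*} (l : List α) (p : α → Prop) [DecidablePred p] :
    (l.map fun a => if p a then (1 : ℝ) else 0).prod = if ∀ a ∈ l, p a then 1 else 0 := by
  induction l with
  | nil => simp
  | cons a l ih =>
    rw [List.map_cons, List.prod_cons, ih]
    by_cases h1 : p a <;> by_cases h2 : ∀ a ∈ l, p a <;> simp [h1, h2]

/-- The amplitude of a tree at equal external momenta. -/
theorem Complete.amplitude_eq {e₀ : Fin N} (ht : t.Complete (.inl e₀))
    (hρ : Follows ρ t (.inl e₀) (.inl e₀)) (Λ m : ℝ) {K : Finset (Fin d → ℤ)} (hP : P ∈ K)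
    (hK : ∀ q, BelowCutoff d Λ q → q ∈ K) :
    amplitude Λ m c ρ (fun _ => P) (fun _ => P) =
      weight (propagator d Λ m) K P (t.map c) false false P := by
  classical
  obtain ⟨r, β, hr⟩ := ht.exists_owned
  have hrρ := hr.apply ht hρ
  have hrs : ∀ a, r (ρ.symm a) = r a := fun a => by
    conv_rhs => rw [← ρ.apply_symm_apply a, hrρ]
  -- The conserved assignment: momentum `Q v` on the loop-vertex that hangs from `v`, momentum `P`
  -- on the root.
  let g : (Fin n → Fin d → ℤ) → Leg N n → Fin d → ℤ := fun Q a => (r a).elim P Q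
  have hg : Function.Injective g := by
    intro Q Q' h
    funext v
    have := congrFun h (.inr (v, !β v))
    simpa [g, hr.child (ht.mem_labels v)] using this
  set F : (Leg N n → Fin d → ℤ) → ℝ := fun k =>
    if ∀ e, k (.inl e) = P ∧ k (ρ.symm (.inl e)) = P then
      (∏ v, vertexTensor (c v) (k (.inr (v, false))) (k (ρ.symm (.inr (v, false))))
        (k (.inr (v, true))) (k (ρ.symm (.inr (v, true))))) * ∏ x, lineFactor Λ m ρ k x
    else 0 with hF
  have hamp : amplitude Λ m c ρ (fun _ => P) (fun _ => P) = ∑ᶠ k, F k := by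
    rw [amplitude]
  have hsupp : Function.support F ⊆ Set.range g := by
    intro k hk
    simp only [hF, Function.mem_support, ne_eq, ite_eq_right_iff, Classical.not_imp, mul_eq_zero,
      not_or, Finset.prod_eq_zero_iff, not_exists, not_and] at hk
    obtain ⟨hk1, hk2, -⟩ := hk
    obtain ⟨h1, -⟩ := hr.conservation hρ (fun v => hk2 v (Finset.mem_univ _)) hk1 (hk1 e₀).1
    refine ⟨fun v => k (.inr (v, !β v)), funext fun a => (h1 a (ht.2 a)).symm⟩
  have hFg : ∀ Q, F (g Q) = preWeight c (propagator d Λ m) P Q t false false P := by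
    intro Q
    have h1 := hr.preWeight_eq (c := c) (P := P) hρ (propagator d Λ m) Q
    simp only [Sum.isRight_inl, Option.elim_none] at h1
    rw [h1, list_prod_indicator t.marks]
    have h2 : ∏ x, lineFactor Λ m ρ (g Q) x = (((t.steps (.inl e₀) (.inl e₀))).map fun s =>
        if s.1.isRight ∧ (ρ s.1).isRight then propagator d Λ m ((r s.1).elim P Q) else 1).prod := by
      have hp := steps_fst_perm t (.inl e₀) (.inl e₀)
      rw [prod_eq_list_prod (hp.nodup_iff.2 ht.1) (fun a => hp.mem_iff.2 (ht.2 a)), List.map_map]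
      rfl
    have h3 : (∏ v, vertexTensor (c v) (g Q (.inr (v, false))) (g Q (ρ.symm (.inr (v, false))))
        (g Q (.inr (v, true))) (g Q (ρ.symm (.inr (v, true))))) =
        (t.labels.map fun v => if (r (.inr (v, false))).elim P Q (c v) =
          (r (.inr (v, true))).elim P Q (c v) then (1 : ℝ) else 0).prod := by
      rw [prod_eq_list_prod ht.labels_nodup ht.mem_labels]
      refine congrArg _ (List.map_congr_left fun v _ => ?_)
      simp only [g, hrs]
      rw [vertexTensor_self]
    have h4 : (∀ e, g Q (.inl e) = P ∧ g Q (ρ.symm (.inl e)) = P) ↔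
        ∀ e ∈ t.marks, (r (.inl e)).elim P Q = P := by
      simp only [g, hrs, and_self]
      refine ⟨fun h e _ => h e, fun h e => ?_⟩
      rcases List.mem_cons.1 ((complete_iff.1 ht).2.2 e) with rfl | he
      · rw [hr.start]; rfl
      · exact h e he
    simp only [hF]
    rw [h2, h3]
    simp only [h4]
    split_ifs <;> ring
  have hrange : ∑ᶠ k, F k = ∑ᶠ Q, F (g Q) := by
    rw [← finsum_mem_range hg, finsum_mem_def]
    congr 1
    funext k
    rw [Set.indicator_apply]
    split_ifs with hk
    · rfl
    · by_contra hne
      exact hk (hsupp hne)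
  rw [hamp, hrange]
  simp only [hFg]
  rw [finsum_eq_sum_of_support_subset (s := Fintype.piFinset fun _ => K)]
  · rw [← iterSum_preWeight ht.labels_nodup (K := K) false false P fun _ => P,
      ← sum_piFinset_eq_iterSum ht.labels_nodup]
    simp only [ht.mem_labels, if_true]
  · intro Q hQ
    rw [Finset.mem_coe, Fintype.mem_piFinset]
    refine fun v => (mem_of_preWeight_ne_zero (K := K) (fun q hq => hK q ?_) hP hQ).2 v
      (ht.mem_labels v)
    by_contra hne
    exact hq (by simp [propagator, hne])

end Amplitude

end PlaneTree

/-! ### The momenta below the cutoff -/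

section Box

variable {d : ℕ} {Λ m : ℝ}

theorem momentumPow_nonneg (p : Fin d → ℤ) : 0 ≤ momentumPow d p :=
  Finset.sum_nonneg fun _ _ => Real.rpow_nonneg (abs_nonneg _) _

theorem kinetic_pos (hm : 0 < m) (p : Fin d → ℤ) : 0 < kinetic d m p :=
  add_pos_of_nonneg_of_pos (momentumPow_nonneg p) (Real.rpow_pos_of_pos hm _)

theorem two_eta_pos (hd : 2 ≤ d) : 0 < 2 * eta d := by
  have : (2 : ℝ) ≤ d := by exact_mod_cast hd
  unfold eta
  linarith

theorem abs_le_of_belowCutoff (hd : 2 ≤ d) (hΛ : 0 ≤ Λ) {q : Fin d → ℤ} (hq : BelowCutoff d Λ q)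
    (i : Fin d) : |(q i : ℝ)| ≤ Λ := by
  by_contra h
  rw [not_le] at h
  have h1 : Λ ^ (2 * eta d) < |(q i : ℝ)| ^ (2 * eta d) :=
    Real.rpow_lt_rpow hΛ h (two_eta_pos hd)
  have h2 : |(q i : ℝ)| ^ (2 * eta d) ≤ momentumPow d q :=
    Finset.single_le_sum (f := fun i => |(q i : ℝ)| ^ (2 * eta d))
      (fun _ _ => Real.rpow_nonneg (abs_nonneg _) _) (Finset.mem_univ i)
  have h3 : momentumPow d q ≤ Λ ^ (2 * eta d) := hq
  linarith

theorem finite_belowCutoff (hd : 2 ≤ d) (hΛ : 0 ≤ Λ) : {q : Fin d → ℤ | BelowCutoff d Λ q}.Finite := by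
  refine (Set.finite_Icc (fun _ : Fin d => -⌈Λ⌉) (fun _ => ⌈Λ⌉)).subset fun q hq => ?_
  have h1 : ∀ i, |(q i : ℝ)| ≤ ⌈Λ⌉ := fun i =>
    (abs_le_of_belowCutoff hd hΛ hq i).trans (Int.le_ceil _)
  constructor <;> intro i
  · have := (abs_le.1 (h1 i)).1
    exact_mod_cast this
  · have := (abs_le.1 (h1 i)).2
    exact_mod_cast this

theorem propagator_ne_zero {q : Fin d → ℤ} (h : propagator d Λ m q ≠ 0) : BelowCutoff d Λ q := by
  by_contra hne
  exact h (by simp [propagator, hne])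

theorem belowCutoff_zero (hd : 2 ≤ d) (hΛ : 0 ≤ Λ) : BelowCutoff d Λ 0 := by
  have h := two_eta_pos hd
  simp only [BelowCutoff, momentumPow, Pi.zero_apply, Int.cast_zero, abs_zero]
  rw [Real.zero_rpow h.ne']
  simpa using Real.rpow_nonneg hΛ _

theorem momentumPow_comp (p : Fin d → ℤ) (π : Equiv.Perm (Fin d)) :
    momentumPow d (p ∘ π) = momentumPow d p :=
  Equiv.sum_comp π fun i => |(p i : ℝ)| ^ (2 * eta d)

theorem belowCutoff_comp (p : Fin d → ℤ) (π : Equiv.Perm (Fin d)) :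
    BelowCutoff d Λ (p ∘ π) ↔ BelowCutoff d Λ p := by
  simp only [BelowCutoff, momentumPow_comp]

theorem propagator_comp (p : Fin d → ℤ) (π : Equiv.Perm (Fin d)) :
    propagator d Λ m (p ∘ π) = propagator d Λ m p := by
  by_cases h : BelowCutoff d Λ p
  · simp [propagator, (belowCutoff_comp p π).2 h, h, kinetic, momentumPow_comp]
  · simp [propagator, mt (belowCutoff_comp p π).1 h, h]

end Box

namespace PlaneTree

/-! ### The sum over trees -/

section TreeSum

variable {d : ℕ} {M M' : Type} [Finite M] [Finite M'] {C : (Fin d → ℤ) → ℝ}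
  {K K' : Finset (Fin d → ℤ)} {P P' : Fin d → ℤ}

/-- The weight does not see the orientation of an edge; this is the source of the factor 2 in all
recursions. -/
theorem sum_bool_sum_sum {α β γ : Type*} (R : Finset α) (S : Finset β) (F : Finset γ) (a : ℝ)
    (f : α → γ → ℝ) (g : β → ℝ) :
    ∑ _b : Bool, ∑ t ∈ R, ∑ s ∈ S, a * ((∑ q ∈ F, f t q) * g s) =
      a * ((2 * ∑ q ∈ F, ∑ t ∈ R, f t q) * ∑ s ∈ S, g s) := by
  simp only [Fintype.sum_bool, ← Finset.mul_sum, ← Finset.sum_mul]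
  rw [Finset.sum_comm]
  ring

/-- The sum over the trees with `n` edges: the coefficients of the full propagator. -/
noncomputable def treeSum (M : Type) [Finite M] (C : (Fin d → ℤ) → ℝ) (K : Finset (Fin d → ℤ))
    (P : Fin d → ℤ) (n : ℕ) (p : Fin d → ℤ) : ℝ :=
  ∑ t ∈ trees (Fin d) M n, weight C K P t true true p

theorem treeSum_zero (p : Fin d → ℤ) : treeSum M C K P 0 p = C p := by
  rw [treeSum, sum_trees_zero]
  simp [weight]

theorem treeSum_succ (n : ℕ) (p : Fin d → ℤ) : treeSum M C K P (n + 1) p =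
    C p * ∑ x ∈ antidiagonal n, (∑ j, 2 * ∑ q ∈ K with q j = p j, treeSum M C K P x.1 q) *
      treeSum M C K P x.2 p := by
  rw [treeSum, sum_trees_succ, Finset.mul_sum]
  refine Finset.sum_congr rfl fun x _ => ?_
  rw [Finset.sum_mul, Finset.mul_sum]
  refine Finset.sum_congr rfl fun j _ => ?_
  simp only [treeSum, weight, if_true, sum_bool_sum_sum]

theorem treeSum_eq_zero {p : Fin d → ℤ} (hp : C p = 0) (n : ℕ) : treeSum M C K P n p = 0 := by
  cases n with
  | zero => rw [treeSum_zero, hp]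
  | succ n => rw [treeSum_succ, hp, zero_mul]

theorem sum_treeSum_eq (hK : ∀ q, C q ≠ 0 → q ∈ K) (hK' : ∀ q, C q ≠ 0 → q ∈ K') {n : ℕ}
    (p : Fin d → ℤ) (j : Fin d)
    (h : ∀ q, treeSum M C K P n q = treeSum M' C K' P' n q) :
    ∑ q ∈ K with q j = p j, treeSum M C K P n q = ∑ q ∈ K' with q j = p j, treeSum M' C K' P' n q := by
  classical
  have h1 : ∀ K : Finset (Fin d → ℤ), (∀ q, C q ≠ 0 → q ∈ K) →
      ∑ q ∈ K with q j = p j, treeSum M' C K' P' n q =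
        ∑ᶠ q, if q j = p j then treeSum M' C K' P' n q else 0 := by
    intro K hK
    rw [finsum_eq_sum_of_support_subset (s := K), Finset.sum_filter]
    intro q hq
    refine hK q fun hC => hq ?_
    simp [treeSum_eq_zero hC]
  rw [h1 K' hK', ← h1 K hK]
  simp only [h]

/-- The external momentum may exceed the cutoff and then has to be added to the summation set, and
the mark types differ between two-point and four-point functions. Neither matters, as an unmarked
tree vanishes wherever `C` does. -/
theorem treeSum_indep (hK : ∀ q, C q ≠ 0 → q ∈ K) (hK' : ∀ q, C q ≠ 0 → q ∈ K') (n : ℕ)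
    (p : Fin d → ℤ) : treeSum M C K P n p = treeSum M' C K' P' n p := by
  induction n using Nat.strong_induction_on generalizing p with
  | _ n ih =>
    cases n with
    | zero => rw [treeSum_zero, treeSum_zero]
    | succ n =>
      rw [treeSum_succ, treeSum_succ]
      congr 1
      refine Finset.sum_congr rfl fun x hx => ?_
      rw [mem_antidiagonal] at hx
      congr 1
      · refine Finset.sum_congr rfl fun j _ => ?_
        rw [sum_treeSum_eq hK hK' p j fun q => ih x.1 (by omega) q]
      · exact ih x.2 (by omega) p

theorem sum_filter_comp {f : (Fin d → ℤ) → ℝ} {π : Equiv.Perm (Fin d)}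
    (hK : ∀ q, q ∘ π ∈ K ↔ q ∈ K) (hf : ∀ q, f (q ∘ π) = f q) (j : Fin d) (s : ℤ) :
    ∑ q ∈ K with q (π j) = s, f q = ∑ q ∈ K with q j = s, f q := by
  refine Finset.sum_bij (fun q _ => q ∘ π) ?_ ?_ ?_ ?_
  · intro q hq
    rw [Finset.mem_filter] at hq ⊢
    exact ⟨(hK q).2 hq.1, hq.2⟩
  · intro q _ q' _ h
    exact π.surjective.injective_comp_right h
  · intro q hq
    rw [Finset.mem_filter] at hq
    have hcomp : (q ∘ π.symm) ∘ π = q := by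
      funext k
      simp
    refine ⟨q ∘ π.symm, ?_, hcomp⟩
    rw [Finset.mem_filter]
    exact ⟨(hK _).1 (by rw [hcomp]; exact hq.1), by simpa using hq.2⟩
  · intro q _
    exact (hf q).symm

/-- The invariance under permutations of the components makes the one-colour self energy the same
function for every colour. -/
theorem treeSum_comp {π : Equiv.Perm (Fin d)} (hC : ∀ q, C (q ∘ π) = C q)
    (hK : ∀ q, q ∘ π ∈ K ↔ q ∈ K) (n : ℕ) (p : Fin d → ℤ) :
    treeSum M C K P n (p ∘ π) = treeSum M C K P n p := by
  induction n using Nat.strong_induction_on generalizing p with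
  | _ n ih =>
    cases n with
    | zero => rw [treeSum_zero, treeSum_zero, hC]
    | succ n =>
      rw [treeSum_succ, treeSum_succ, hC]
      congr 1
      refine Finset.sum_congr rfl fun x hx => ?_
      rw [mem_antidiagonal] at hx
      congr 1
      · rw [← Equiv.sum_comp π fun j => 2 * ∑ q ∈ K with q j = p j, treeSum M C K P x.1 q]
        refine Finset.sum_congr rfl fun j _ => ?_
        rw [sum_filter_comp hK (fun q => ih x.1 (by omega) q) j]
        rfl
      · exact ih x.2 (by omega) p

variable {e : M} {i : Fin d}

/-- The sum over the trees with `n` edges and a mark, on a heart face of colour `i`. -/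
noncomputable def heartSum (i : Fin d) (e : M) (C : (Fin d → ℤ) → ℝ) (K : Finset (Fin d → ℤ))
    (P : Fin d → ℤ) (n : ℕ) (p : Fin d → ℤ) : ℝ :=
  ∑ t ∈ hearts i e n, weight C K P t true true p

/-- As `heartSum`, where the mark may be at the root. -/
noncomputable def coreSum (i : Fin d) (e : M) (C : (Fin d → ℤ) → ℝ) (K : Finset (Fin d → ℤ))
    (P : Fin d → ℤ) (n : ℕ) (p : Fin d → ℤ) : ℝ :=
  ∑ t ∈ cores i e n, weight C K P t true true p

theorem coreSum_eq (n : ℕ) (p : Fin d → ℤ) : coreSum i e C K P n p =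
    heartSum i e C K P n p + if n = 0 ∧ p = P then 1 else 0 := by
  rw [coreSum, sum_cores, heartSum]
  simp only [weight]
  by_cases h : n = 0 <;> by_cases h' : p = P <;> simp [h, h']

theorem heartSum_zero (p : Fin d → ℤ) : heartSum i e C K P 0 p = 0 := sum_hearts_zero _ _ _

theorem heartSum_succ (n : ℕ) (p : Fin d → ℤ) : heartSum i e C K P (n + 1) p =
    C p * ((∑ x ∈ antidiagonal n, (2 * ∑ q ∈ K with q i = p i, coreSum i e C K P x.1 q) *
      treeSum M C K P x.2 p) +
      ∑ x ∈ antidiagonal n, (∑ j, 2 * ∑ q ∈ K with q j = p j, treeSum M C K P x.1 q) *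
        heartSum i e C K P x.2 p) := by
  rw [heartSum, sum_hearts_succ, Finset.sum_add_distrib, mul_add, Finset.mul_sum, Finset.mul_sum]
  congr 1
  · refine Finset.sum_congr rfl fun x _ => ?_
    have h1 : ∀ b : Bool, ((∑ t ∈ hearts i e x.1, ∑ s ∈ trees (Fin d) M x.2,
        weight C K P (node i b t s) true true p) + if x.1 = 0 then
          ∑ s ∈ trees (Fin d) M x.2, weight C K P (node i b (mark e leaf) s) true true p else 0) =
        ∑ t ∈ cores i e x.1, ∑ s ∈ trees (Fin d) M x.2, weight C K P (node i b t s) true true p :=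
      fun b => (sum_cores i e x.1 _).symm
    simp only [h1]
    simp only [treeSum, coreSum, weight, if_true, sum_bool_sum_sum]
  · refine Finset.sum_congr rfl fun x _ => ?_
    rw [Finset.sum_mul, Finset.mul_sum]
    refine Finset.sum_congr rfl fun j _ => ?_
    simp only [treeSum, heartSum, weight, if_true, sum_bool_sum_sum]

end TreeSum

end PlaneTree

open PlaneTree

/-! ### Dyson equations for the melonic functions -/

section Dyson

variable {d : ℕ} {Λ m : ℝ} {K : Finset (Fin d → ℤ)} {i : Fin d}

theorem not_isOnePI_zero {N : ℕ} (σ : Wick N 0) : ¬ IsOnePI σ := fun h =>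
  h.2.1.nonempty.elim fun v => v.elim0

open Classical in
theorem sum_onePI (hK : ∀ q, q ∈ K ↔ BelowCutoff d Λ q) (J : Finset (Fin d)) (n : ℕ)
    (p : Fin d → ℤ) :
    (-1 : ℝ) ^ (n + 1) / ((n + 1).factorial : ℝ) *
      (∑ c : Fin (n + 1) → Fin d, ∑ σ : Wick 1 (n + 1),
        if IsOnePI σ ∧ IsTree σ ∧ ∀ v b, σ (.inl 0) = .inr (v, b) → c v ∈ J then
          amplitude Λ m c σ (fun _ => p) (fun _ => p) else 0) =
      (-1) ^ (n + 1) * ∑ j ∈ J, 2 * ∑ q ∈ K with q j = p j,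
        treeSum (Fin 1) (propagator d Λ m) K 0 n q := by
  -- `p` is the momentum of the root and need not be below the cutoff.
  have hK' : ∀ q, BelowCutoff d Λ q → q ∈ insert p K := fun q hq =>
    Finset.mem_insert_of_mem ((hK q).2 hq)
  simp only [onePI_isTree_iff]
  rw [sum_eq_factorial_mul_sum (0 : Fin 1) (stems J (trees (Fin d) (Fin 1) n)) ?_ _
    (fun s => weight (propagator d Λ m) (insert p K) p s false false p)]
  · rw [← mul_assoc, div_mul_cancel₀ _ (Nat.cast_ne_zero.2 (Nat.factorial_ne_zero _)), sum_stems]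
    congr 1
    refine Finset.sum_congr rfl fun j _ => ?_
    simp only [weight, Bool.false_eq_true, if_false, and_false, mul_one, one_mul, Fintype.sum_bool]
    rw [Finset.sum_comm, ← two_mul]
    congr 1
    exact sum_treeSum_eq (fun q hq => hK' q (propagator_ne_zero hq))
      (fun q hq => (hK q).2 (propagator_ne_zero hq)) p j
      (treeSum_indep (fun q hq => hK' q (propagator_ne_zero hq))
      (fun q hq => (hK q).2 (propagator_ne_zero hq)) n)
  · intro c ρ t ht hρ _
    exact ht.amplitude_eq hρ Λ m (Finset.mem_insert_self _ _) hK'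
  · intro s hs'
    obtain ⟨j, -, b, s, hs, rfl⟩ := mem_stems.1 hs'
    rw [mem_trees] at hs
    refine ⟨by simp [labels, hs.1], by simp [marks, hs.2], fun e => ?_⟩
    rw [Subsingleton.elim e 0]
    simp

/-- The full melonic propagator, at the momentum `p`. -/
noncomputable def fullProp (d : ℕ) (Λ m : ℝ) (K : Finset (Fin d → ℤ)) (p : Fin d → ℤ) :
    PowerSeries ℝ :=
  PowerSeries.mk fun n => (-1) ^ n * treeSum (Fin 1) (propagator d Λ m) K 0 n p

theorem coeff_colorSum (j : Fin d) (s : ℤ) (n : ℕ) :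
    PowerSeries.coeff (n + 1) (-(PowerSeries.C 2 * PowerSeries.X) *
      ∑ q ∈ K with q j = s, fullProp d Λ m K q) =
      (-1) ^ (n + 1) * (2 * ∑ q ∈ K with q j = s,
        treeSum (Fin 1) (propagator d Λ m) K 0 n q) := by
  rw [neg_mul, map_neg, mul_assoc, PowerSeries.coeff_C_mul, PowerSeries.coeff_succ_X_mul, map_sum]
  simp only [fullProp, PowerSeries.coeff_mk, ← Finset.mul_sum]
  ring

theorem constantCoeff_colorSum (j : Fin d) (s : ℤ) :
    PowerSeries.coeff 0 (-(PowerSeries.C 2 * PowerSeries.X) *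
      ∑ q ∈ K with q j = s, fullProp d Λ m K q) = 0 := by
  simp

open Classical in
theorem selfEnergy_eq (hK : ∀ q, q ∈ K ↔ BelowCutoff d Λ q) (p : Fin d → ℤ) :
    selfEnergy d Λ m p = ∑ j, -(PowerSeries.C 2 * PowerSeries.X) *
      ∑ q ∈ K with q j = p j, fullProp d Λ m K q := by
  ext n
  rw [map_sum, selfEnergy, PowerSeries.coeff_mk]
  cases n with
  | zero =>
    simp only [constantCoeff_colorSum, Finset.sum_const_zero]
    simp [not_isOnePI_zero]
  | succ n =>
    have := sum_onePI (m := m) hK Finset.univ n p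
    simp only [coeff_colorSum]
    rw [← Finset.mul_sum, ← this]
    congr 1
    refine Finset.sum_congr rfl fun c _ => Finset.sum_congr rfl fun σ _ => if_congr ?_ rfl rfl
    simp

theorem isMelonic_one_iff {n : ℕ} {c : Fin n → Fin d} {σ : Wick 1 n} :
    IsMelonic c i σ ↔ IsTree σ := by
  have hclose : ∀ π, close π σ = σ := by
    intro π
    rw [Subsingleton.elim π 1]
    ext1 x
    simp only [close, Equiv.trans_apply]
    rcases σ x with e | q <;> rfl
  simp only [IsMelonic, hclose]
  refine ⟨fun ⟨_, h, _⟩ => h, fun h => ⟨1, h, fun e e' => ?_⟩⟩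
  rw [Subsingleton.elim e e']
  exact ⟨0, rfl⟩

open Classical in
theorem tau_eq (hK : ∀ q, q ∈ K ↔ BelowCutoff d Λ q) (s : ℤ) :
    tau d i Λ m s = -(PowerSeries.C 2 * PowerSeries.X) *
      ∑ q ∈ K with q i = s, fullProp d Λ m K q := by
  ext n
  rw [tau, melonicSum, PowerSeries.coeff_mk]
  cases n with
  | zero =>
    rw [constantCoeff_colorSum]
    simp [not_isOnePI_zero]
  | succ n =>
    have := sum_onePI (m := m) hK {i} n (Pi.single i s)
    simp only [Finset.mem_singleton, Finset.sum_singleton, Pi.single_eq_same] at this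
    rw [coeff_colorSum, ← this]
    congr 1
    refine Finset.sum_congr rfl fun c _ => Finset.sum_congr rfl fun σ _ => if_congr ?_ rfl rfl
    rw [isMelonic_one_iff, Fin.forall_fin_one]

/-- The Dyson equation: generating function of `treeSum_succ`, with the sign of the detached vertex
absorbed in the self energy. -/
theorem fullProp_eq (hK : ∀ q, q ∈ K ↔ BelowCutoff d Λ q) (p : Fin d → ℤ) :
    fullProp d Λ m K p = PowerSeries.C (propagator d Λ m p) *
      (1 + selfEnergy d Λ m p * fullProp d Λ m K p) := by
  rw [selfEnergy_eq hK]
  ext n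
  rw [PowerSeries.coeff_C_mul, map_add]
  cases n with
  | zero => simp [fullProp, treeSum_zero]
  | succ n =>
    rw [PowerSeries.coeff_one, if_neg (Nat.succ_ne_zero n), zero_add, ← Finset.mul_sum, neg_mul,
      neg_mul, mul_assoc, mul_assoc, map_neg, PowerSeries.coeff_C_mul,
      PowerSeries.coeff_succ_X_mul, PowerSeries.coeff_mul, fullProp, PowerSeries.coeff_mk,
      treeSum_succ]
    simp only [fullProp, map_sum, PowerSeries.coeff_mk]
    rw [mul_left_comm]
    congr 1
    rw [Finset.mul_sum, Finset.mul_sum, ← Finset.sum_neg_distrib]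
    refine Finset.sum_congr rfl fun x hx => ?_
    rw [mem_antidiagonal] at hx
    simp only [← Finset.mul_sum]
    rw [← hx, pow_succ, pow_add]
    ring

theorem fullProp_mul_gammaTwo (hK : ∀ q, q ∈ K ↔ BelowCutoff d Λ q) (hm : 0 < m) {p : Fin d → ℤ}
    (hp : BelowCutoff d Λ p) : fullProp d Λ m K p * gammaTwo d Λ m p = 1 := by
  have h1 := fullProp_eq (m := m) hK p
  have h2 : PowerSeries.C (kinetic d m p) * PowerSeries.C (propagator d Λ m p) =
      (1 : PowerSeries ℝ) := by
    rw [← map_mul, propagator, if_pos hp, mul_inv_cancel₀ (kinetic_pos hm p).ne', map_one]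
  rw [gammaTwo]
  linear_combination PowerSeries.C (kinetic d m p) * h1 +
    (1 + selfEnergy d Λ m p * fullProp d Λ m K p) * h2

theorem constantCoeff_selfEnergy (p : Fin d → ℤ) :
    PowerSeries.constantCoeff (selfEnergy d Λ m p) = 0 := by
  rw [← PowerSeries.coeff_zero_eq_constantCoeff_apply, selfEnergy, PowerSeries.coeff_mk]
  simp [not_isOnePI_zero]

theorem constantCoeff_gammaTwo (p : Fin d → ℤ) :
    PowerSeries.constantCoeff (gammaTwo d Λ m p) = kinetic d m p := by
  simp [gammaTwo, constantCoeff_selfEnergy]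

theorem fullProp_eq_inv (hK : ∀ q, q ∈ K ↔ BelowCutoff d Λ q) (hm : 0 < m) {p : Fin d → ℤ}
    (hp : BelowCutoff d Λ p) : fullProp d Λ m K p = (gammaTwo d Λ m p)⁻¹ := by
  rw [PowerSeries.eq_inv_iff_mul_eq_one, fullProp_mul_gammaTwo hK hm hp]
  rw [constantCoeff_gammaTwo]
  exact (kinetic_pos hm p).ne'

theorem fullProp_comp (hK : ∀ q, q ∈ K ↔ BelowCutoff d Λ q) (π : Equiv.Perm (Fin d))
    (p : Fin d → ℤ) : fullProp d Λ m K (p ∘ π) = fullProp d Λ m K p := by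
  ext n
  simp only [fullProp, PowerSeries.coeff_mk]
  rw [treeSum_comp (fun q => propagator_comp q π)]
  intro q
  rw [hK, hK, belowCutoff_comp]

theorem sum_fullProp_eq (hK : ∀ q, q ∈ K ↔ BelowCutoff d Λ q) (i j : Fin d) (s : ℤ) :
    ∑ q ∈ K with q i = s, fullProp d Λ m K q = ∑ q ∈ K with q j = s, fullProp d Λ m K q := by
  ext n
  rw [map_sum, map_sum]
  have := sum_filter_comp (K := K) (π := Equiv.swap i j)
    (f := fun q => PowerSeries.coeff n (fullProp d Λ m K q))
    (fun q => by rw [hK, hK, belowCutoff_comp]) (fun q => by rw [fullProp_comp hK]) j s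
  rwa [Equiv.swap_apply_right] at this

theorem selfEnergy_eq_sum_tau (hK : ∀ q, q ∈ K ↔ BelowCutoff d Λ q) (i : Fin d) (p : Fin d → ℤ) :
    selfEnergy d Λ m p = ∑ j, tau d i Λ m (p j) := by
  rw [selfEnergy_eq hK]
  refine Finset.sum_congr rfl fun j _ => ?_
  rw [tau_eq hK, sum_fullProp_eq hK i j]

theorem tau_eq_sum_inv (hK : ∀ q, q ∈ K ↔ BelowCutoff d Λ q) (hm : 0 < m) (i : Fin d) (s : ℤ) :
    tau d i Λ m s = -(PowerSeries.C 2 * PowerSeries.X) *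
      ∑ q ∈ K with q i = s, (gammaTwo d Λ m q)⁻¹ := by
  rw [tau_eq hK]
  congr 1
  refine Finset.sum_congr rfl fun q hq => ?_
  rw [fullProp_eq_inv hK hm ((hK q).1 (Finset.mem_filter.1 hq).1)]

theorem loop_eq (hK : ∀ q, q ∈ K ↔ BelowCutoff d Λ q) (i : Fin d) :
    loop d i Λ m = ∑ q ∈ K with q i = 0, ((gammaTwo d Λ m q)⁻¹) ^ 2 := by
  classical
  rw [loop, finsum_eq_sum_of_support_subset (s := K), Finset.sum_filter]
  · refine Finset.sum_congr rfl fun q hq => ?_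
    simp [(hK q).1 hq]
  · intro q hq
    refine (hK q).2 ?_
    by_contra h
    exact hq (by simp [h])

/-! ### The four-point function -/

theorem close_eq_mul {N n : ℕ} (π : Equiv.Perm (Fin N)) (σ : Wick N n) :
    close π σ = (Equiv.sumCongr π (Equiv.refl _) : Equiv.Perm (Leg N n)) * σ := rfl

theorem isOnePI_close {N n : ℕ} (π : Equiv.Perm (Fin N)) (σ : Wick N n) :
    IsOnePI (close π σ) ↔ IsOnePI σ := by
  have h1 : ∀ a p, close π σ a = .inr p ↔ σ a = .inr p := by
    intro a p
    simp only [close, Equiv.trans_apply]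
    rcases σ a with e | q <;> simp
  have h2 : ∀ cut, vertexGraph (close π σ) cut = vertexGraph σ cut := by
    intro cut
    simp only [vertexGraph, h1]
  have h3 : (∀ e e', close π σ (.inl e) ≠ .inl e') ↔ ∀ e e', σ (.inl e) ≠ .inl e' := by
    refine forall_congr' fun e => ?_
    simp only [close, Equiv.trans_apply]
    rcases σ (.inl e) with e' | q
    · simp
    · simp
  simp only [IsOnePI, h2, h3]

/-- All external momenta are equal, so it does not matter which external fields are glued. -/
theorem amplitude_close {N n : ℕ} (π : Equiv.Perm (Fin N)) (σ : Wick N n) (c : Fin n → Fin d)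
    (P : Fin d → ℤ) : amplitude Λ m c (close π σ) (fun _ => P) (fun _ => P) =
      amplitude Λ m c σ (fun _ => P) (fun _ => P) := by
  have h1 : ∀ p : Fin n × Bool, (close π σ).symm (.inr p) = σ.symm (.inr p) := fun p => rfl
  have h2 : ∀ e, (close π σ).symm (.inl e) = σ.symm (.inl (π.symm e)) := fun e => rfl
  have h3 : ∀ x, ((close π σ) x).isRight = (σ x).isRight := by
    intro x
    simp only [close, Equiv.trans_apply]
    rcases σ x with e | q <;> rfl
  unfold amplitude
  simp only [h1, h2, lineFactor, h3]
  refine finsum_congr fun k => if_congr ?_ rfl rfl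
  simp only [forall_and]
  refine and_congr_right fun _ => ⟨fun h e => ?_, fun h e => h _⟩
  simpa using h (π e)

open Classical in
-- A contraction with two marks can be glued in two ways, but at most one gluing gives a heart tree.
-- The sum over contractions thus becomes twice the sum over heart trees, and the orientation of the
-- root edge supplies the other factor 2.
theorem melonicSum_two_succ (hK : ∀ q, q ∈ K ↔ BelowCutoff d Λ q) (hK0 : (0 : Fin d → ℤ) ∈ K)
    (i : Fin d) (n : ℕ) :
    PowerSeries.coeff (n + 1) (melonicSum d 2 i Λ m 0 0) = (-1) ^ (n + 1) *
      (4 * ∑ q ∈ K with q i = 0, coreSum i (1 : Fin 2) (propagator d Λ m) K 0 n q) := by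
  have hgood : ∀ (c : Fin (n + 1) → Fin d) (σ : Wick 2 (n + 1)),
      (IsOnePI σ ∧ IsMelonic c i σ ∧ ∀ e v b, σ (.inl e) = .inr (v, b) → c v = i) ↔
      ∃ π, (IsOnePI (close π σ) ∧ IsTree (close π σ) ∧
        (∀ e e', OnSameFace c i (close π σ) e e') ∧
        ∀ e v b, close π σ (.inl e) = .inr (v, b) → c v = i) := by
    intro c σ
    have h1 : ∀ π e v b, close π σ (.inl e) = .inr (v, b) ↔ σ (.inl e) = .inr (v, b) := by
      intro π e v b
      simp only [close, Equiv.trans_apply]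
      rcases σ (.inl e) with e | q <;> simp
    simp only [isOnePI_close, h1, IsMelonic]
    constructor
    · rintro ⟨h1, ⟨π, h2, h3⟩, h4⟩
      exact ⟨π, h1, h2, h3, h4⟩
    · rintro ⟨π, h1, h2, h3, h4⟩
      exact ⟨h1, ⟨π, h2, h3⟩, h4⟩
  have huniq : ∀ (c : Fin (n + 1) → Fin d) (σ : Wick 2 (n + 1)) (π π' : Equiv.Perm (Fin 2)),
      (∃ t, t.Complete (.inl 0) ∧ Follows (close π σ) t (.inl 0) (.inl 0) ∧
        t.map c ∈ stems {i} (cores i 1 n)) →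
      (∃ t, t.Complete (.inl 0) ∧ Follows (close π' σ) t (.inl 0) (.inl 0) ∧
        t.map c ∈ stems {i} (cores i 1 n)) → π = π' := by
    -- The root cycle of a heart tree is mark 0, one corner, mark 0. So the external end reached
    -- from mark 0 after two lines must be glued to 0, which determines a permutation of two
    -- elements.
    have hroot : ∀ (c : Fin (n + 1) → Fin d) (σ : Wick 2 (n + 1)) (π : Equiv.Perm (Fin 2)),
        (∃ t, t.Complete (.inl 0) ∧ Follows (close π σ) t (.inl 0) (.inl 0) ∧
          t.map c ∈ stems {i} (cores i 1 n)) →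
        ∃ x, σ (σ (.inl 0)) = .inl x ∧ π x = 0 := by
      rintro c σ π ⟨t, -, hσ, hc⟩
      obtain ⟨j, hj, b, s, hs, hts⟩ := mem_stems.1 hc
      rcases t with _ | ⟨v, b', t, _ | _ | _⟩ | _ <;> simp only [PlaneTree.map, node.injEq,
        reduceCtorEq, and_false] at hts
      obtain ⟨g1, -, g3⟩ := follows_node.1 hσ
      rw [follows_leaf] at g3
      simp only [close, Equiv.trans_apply] at g1 g3
      have g4 : σ (.inl 0) = .inr (v, b') := by
        rcases hx : σ (.inl 0) with e | q
        · rw [hx] at g1; simp at g1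
        · rw [hx] at g1; simpa using g1
      rw [g4]
      rcases hx : σ (.inr (v, b')) with e | q
      · rw [hx] at g3
        exact ⟨e, rfl, by simpa using g3⟩
      · rw [hx] at g3; simp at g3
    have hperm : ∀ (π π' : Equiv.Perm (Fin 2)) (x : Fin 2), π x = π' x → π = π' := by decide
    intro c σ π π' h h'
    obtain ⟨x, h1, h2⟩ := hroot c σ π h
    obtain ⟨x', h1', h2'⟩ := hroot c σ π' h'
    rw [h1] at h1'
    obtain rfl := Sum.inl_injective h1'
    exact hperm π π' x (h2.trans h2'.symm)
  rw [melonicSum, PowerSeries.coeff_mk]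
  simp only [hgood, melonic_two_iff]
  have hsum : ∀ c : Fin (n + 1) → Fin d, (∑ σ : Wick 2 (n + 1),
      if ∃ π, ∃ t, t.Complete (.inl 0) ∧ Follows (close π σ) t (.inl 0) (.inl 0) ∧
        t.map c ∈ stems {i} (cores i 1 n) then amplitude Λ m c σ 0 0 else 0) =
      2 * ∑ ρ : Wick 2 (n + 1), if ∃ t, t.Complete (.inl 0) ∧ Follows ρ t (.inl 0) (.inl 0) ∧
        t.map c ∈ stems {i} (cores i 1 n) then amplitude Λ m c ρ 0 0 else 0 := by
    intro c
    set g : Wick 2 (n + 1) → ℝ := fun ρ =>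
      if ∃ t, t.Complete (.inl 0) ∧ Follows ρ t (.inl 0) (.inl 0) ∧
        t.map c ∈ stems {i} (cores i 1 n) then amplitude Λ m c ρ 0 0 else 0 with hg
    have h1 : ∀ σ : Wick 2 (n + 1), (if ∃ π, ∃ t, t.Complete (.inl 0) ∧
        Follows (close π σ) t (.inl 0) (.inl 0) ∧
        t.map c ∈ stems {i} (cores i 1 n) then amplitude Λ m c σ 0 0 else 0) =
        ∑ π : Equiv.Perm (Fin 2), g (close π σ) := by
      intro σ
      have hamp : ∀ π, amplitude Λ m c (close π σ) 0 0 = amplitude Λ m c σ 0 0 := fun π =>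
        amplitude_close π σ c 0
      simp only [hg, hamp]
      split_ifs with h
      · obtain ⟨π, hπ⟩ := h
        rw [Finset.sum_eq_single π]
        · rw [if_pos hπ]
        · intro π' _ hne
          rw [if_neg fun h' => hne (huniq c σ _ _ h' hπ)]
        · simp
      · rw [Finset.sum_eq_zero]
        intro π _
        rw [if_neg fun h' => h ⟨π, h'⟩]
    simp only [h1]
    rw [Finset.sum_comm]
    have h2 : ∀ π : Equiv.Perm (Fin 2), ∑ σ : Wick 2 (n + 1), g (close π σ) = ∑ ρ, g ρ := by
      intro π
      simp only [close_eq_mul]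
      exact Equiv.sum_comp (Equiv.mulLeft (Equiv.sumCongr π (Equiv.refl _) :
        Equiv.Perm (Leg 2 (n + 1)))) g
    simp only [h2, Finset.sum_const, Finset.card_univ, Fintype.card_perm, Fintype.card_fin,
      Nat.factorial_two, nsmul_eq_mul, Nat.cast_ofNat]
  simp only [hsum, ← Finset.mul_sum]
  rw [sum_eq_factorial_mul_sum (0 : Fin 2) (stems {i} (cores i 1 n)) ?_ _
    (fun s => weight (propagator d Λ m) K 0 s false false 0)]
  · rw [mul_left_comm, ← mul_assoc _ (((n + 1).factorial : ℕ) : ℝ),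
      div_mul_cancel₀ _ (Nat.cast_ne_zero.2 (Nat.factorial_ne_zero _)), sum_stems]
    simp only [weight, Bool.false_eq_true, if_false, and_false, mul_one, one_mul, Fintype.sum_bool,
      Finset.sum_singleton, Pi.zero_apply]
    rw [Finset.sum_comm]
    simp only [coreSum]
    ring
  · intro c ρ t ht hρ _
    exact ht.amplitude_eq hρ Λ m hK0 fun q hq => (hK q).2 hq
  · intro s hs'
    obtain ⟨j, -, b, s, hs, rfl⟩ := mem_stems.1 hs'
    rw [mem_cores] at hs
    refine ⟨by simp [labels, hs.1], by simp [marks, hs.2.1], fun e => ?_⟩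
    fin_cases e <;> simp [marks, hs.2.1]

/-- The sum over the heart trees, at the momentum `p`. -/
noncomputable def heartProp (d : ℕ) (i : Fin d) (Λ m : ℝ) (K : Finset (Fin d → ℤ))
    (p : Fin d → ℤ) : PowerSeries ℝ :=
  PowerSeries.mk fun n => (-1) ^ n * heartSum i (1 : Fin 2) (propagator d Λ m) K 0 n p

/-- The chain of loops on the heart face. -/
noncomputable def chain (d : ℕ) (i : Fin d) (Λ m : ℝ) (K : Finset (Fin d → ℤ)) (s : ℤ) :
    PowerSeries ℝ :=
  PowerSeries.mk fun n => (-1) ^ n *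
    ∑ q ∈ K with q i = s, coreSum i (1 : Fin 2) (propagator d Λ m) K 0 n q

theorem gammaFour_eq_chain (hK : ∀ q, q ∈ K ↔ BelowCutoff d Λ q) (hK0 : (0 : Fin d → ℤ) ∈ K)
    (i : Fin d) : gammaFour d i Λ m = PowerSeries.C 4 * PowerSeries.X * chain d i Λ m K 0 := by
  ext n
  rw [gammaFour, map_neg]
  cases n with
  | zero =>
    rw [melonicSum, PowerSeries.coeff_mk]
    simp [not_isOnePI_zero]
  | succ n =>
    rw [melonicSum_two_succ hK hK0, mul_assoc, PowerSeries.coeff_C_mul,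
      PowerSeries.coeff_succ_X_mul, chain, PowerSeries.coeff_mk]
    ring

/-- The term 1 is the core in which the mark hangs directly from the root edge, that is the
four-point graph with a single vertex. -/
theorem chain_zero (hK0 : (0 : Fin d → ℤ) ∈ K) (i : Fin d) :
    chain d i Λ m K 0 = (∑ q ∈ K with q i = 0, heartProp d i Λ m K q) + 1 := by
  classical
  ext n
  rw [map_add, map_sum]
  simp only [chain, heartProp, PowerSeries.coeff_mk, coreSum_eq, Finset.sum_add_distrib, mul_add,
    Finset.mul_sum]
  congr 1
  by_cases hn : n = 0
  · subst hn
    rw [Finset.sum_filter, Finset.sum_eq_single 0] <;> simp_all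
  · simp [hn, PowerSeries.coeff_one]

/-- Generating function of `heartSum_succ`: the first root edge continues the chain towards the
mark, or belongs to a self energy insertion. -/
theorem heartProp_eq (hK : ∀ q, q ∈ K ↔ BelowCutoff d Λ q) (i : Fin d) (p : Fin d → ℤ) :
    heartProp d i Λ m K p = PowerSeries.C (propagator d Λ m p) *
      (-(PowerSeries.C 2 * PowerSeries.X) * chain d i Λ m K (p i) * fullProp d Λ m K p +
        selfEnergy d Λ m p * heartProp d i Λ m K p) := by
  have hind : ∀ n q, treeSum (Fin 2) (propagator d Λ m) K 0 n q =
      treeSum (Fin 1) (propagator d Λ m) K 0 n q :=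
    treeSum_indep (fun q hq => (hK q).2 (propagator_ne_zero hq))
      (fun q hq => (hK q).2 (propagator_ne_zero hq))
  rw [selfEnergy_eq hK]
  ext n
  rw [PowerSeries.coeff_C_mul, map_add]
  cases n with
  | zero => simp [heartProp, heartSum_zero]
  | succ n =>
    rw [← Finset.mul_sum, neg_mul, neg_mul, neg_mul, neg_mul, mul_assoc, mul_assoc, mul_assoc,
      mul_assoc, map_neg, map_neg, PowerSeries.coeff_C_mul, PowerSeries.coeff_C_mul,
      PowerSeries.coeff_succ_X_mul, PowerSeries.coeff_succ_X_mul, PowerSeries.coeff_mul,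
      PowerSeries.coeff_mul, heartProp, PowerSeries.coeff_mk, heartSum_succ]
    simp only [fullProp, chain, map_sum, PowerSeries.coeff_mk, hind]
    rw [mul_left_comm]
    congr 1
    rw [mul_add, Finset.mul_sum, Finset.mul_sum, Finset.mul_sum, Finset.mul_sum,
      ← Finset.sum_neg_distrib, ← Finset.sum_neg_distrib]
    congr 1
    · refine Finset.sum_congr rfl fun x hx => ?_
      rw [mem_antidiagonal] at hx
      rw [← hx, pow_succ, pow_add]
      ring
    · refine Finset.sum_congr rfl fun x hx => ?_
      rw [mem_antidiagonal] at hx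
      simp only [← Finset.mul_sum]
      rw [← hx, pow_succ, pow_add]
      ring

/-- The linear equation for the heart sum has the operator `Γ⁽²⁾`; its source carries one full
propagator and its inversion brings the second. -/
theorem heartProp_eq_sq (hK : ∀ q, q ∈ K ↔ BelowCutoff d Λ q) (hm : 0 < m) (i : Fin d)
    {p : Fin d → ℤ} (hp : BelowCutoff d Λ p) : heartProp d i Λ m K p =
      -(PowerSeries.C 2 * PowerSeries.X) * chain d i Λ m K (p i) * ((gammaTwo d Λ m p)⁻¹) ^ 2 := by
  have h1 := heartProp_eq (m := m) hK i p
  have h2 : PowerSeries.C (kinetic d m p) * PowerSeries.C (propagator d Λ m p) =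
      (1 : PowerSeries ℝ) := by
    rw [← map_mul, propagator, if_pos hp, mul_inv_cancel₀ (kinetic_pos hm p).ne', map_one]
  have h3 := fullProp_mul_gammaTwo hK hm hp
  rw [← fullProp_eq_inv hK hm hp]
  rw [gammaTwo] at h3
  linear_combination (fullProp d Λ m K p * PowerSeries.C (kinetic d m p)) * h1 -
    heartProp d i Λ m K p * h3 + fullProp d Λ m K p *
      (-(PowerSeries.C 2 * PowerSeries.X) * chain d i Λ m K (p i) * fullProp d Λ m K p +
        selfEnergy d Λ m p * heartProp d i Λ m K p) * h2

/-- At zero momentum the chain satisfies `chain = 1 - 2λ𝓛 chain`, the geometric series of loops on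
the heart face. -/
theorem gammaFour_mul (hK : ∀ q, q ∈ K ↔ BelowCutoff d Λ q) (hK0 : (0 : Fin d → ℤ) ∈ K)
    (hm : 0 < m) (i : Fin d) : gammaFour d i Λ m *
      (1 + PowerSeries.C 2 * PowerSeries.X * loop d i Λ m) = PowerSeries.C 4 * PowerSeries.X := by
  have h1 := chain_zero (m := m) (Λ := Λ) hK0 i
  have h2 : ∑ q ∈ K with q i = 0, heartProp d i Λ m K q =
      -(PowerSeries.C 2 * PowerSeries.X) * chain d i Λ m K 0 * loop d i Λ m := by
    rw [loop_eq hK, Finset.mul_sum]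
    refine Finset.sum_congr rfl fun q hq => ?_
    rw [Finset.mem_filter] at hq
    rw [heartProp_eq_sq hK hm i ((hK q).1 hq.1), hq.2]
  rw [gammaFour_eq_chain hK hK0]
  rw [h2] at h1
  linear_combination PowerSeries.C 4 * PowerSeries.X * h1

end Dyson

/-! ### Coefficients of inverse power series -/

section Coefficients

/-- With the inverse of the constant coefficient as a variable, `Φ` is a polynomial. Limits,
measurability and bounds for inverse power series all reduce to its continuity. -/
theorem exists_coeff_inv (n : ℕ) : ∃ Φ : ℝ × (Fin n → ℝ) → ℝ, Continuous Φ ∧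
    ∀ f : PowerSeries ℝ, PowerSeries.coeff n f⁻¹ =
      Φ ((PowerSeries.constantCoeff f)⁻¹, fun j => PowerSeries.coeff (j + 1) f) := by
  induction n using Nat.strong_induction_on with
  | _ n ih =>
    choose Φ hΦ hΦ' using ih
    by_cases hn : n = 0
    · subst hn
      exact ⟨Prod.fst, continuous_fst, fun f => by simp⟩
    -- In the recursion for the inverse only the terms with `x.2 < n` occur, where `x.1 ≥ 1`;
    -- coefficient `x.1` is stored at the index `x.1 - 1`.
    · refine ⟨fun z => -z.1 * ∑ x ∈ antidiagonal n, if h : x.2 < n then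
        (if h' : x.1 - 1 < n then z.2 ⟨x.1 - 1, h'⟩ else 0) *
          Φ x.2 h (z.1, fun j => z.2 ⟨j, j.2.trans h⟩) else 0, ?_, fun f => ?_⟩
      · refine continuous_fst.neg.mul (continuous_finsetSum _ fun x _ => ?_)
        split_ifs with h h'
        · exact ((continuous_apply _).comp continuous_snd).mul ((hΦ x.2 h).comp
            (continuous_fst.prodMk (continuous_pi fun j => (continuous_apply _).comp continuous_snd)))
        · exact continuous_const.mul ((hΦ x.2 h).comp
            (continuous_fst.prodMk (continuous_pi fun j => (continuous_apply _).comp continuous_snd)))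
        · exact continuous_const
      · rw [PowerSeries.coeff_inv, if_neg hn]
        congr 1
        refine Finset.sum_congr rfl fun x hx => ?_
        rw [mem_antidiagonal] at hx
        by_cases h : x.2 < n
        · rw [if_pos h, dif_pos h, dif_pos (by omega), hΦ' x.2 h f]
          simp only [Nat.sub_add_cancel (show 1 ≤ x.1 by omega)]
        · rw [if_neg h, dif_neg h]

/-- The coefficients of order at most `n` of `f⁻¹ ^ r` depend continuously on the inverse of the
constant coefficient of `f` and on its next `n` coefficients. -/
theorem exists_coeff_inv_pow (r n : ℕ) : ∃ Φ : ℝ × (Fin n → ℝ) → ℝ, Continuous Φ ∧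
    ∀ f : PowerSeries ℝ, PowerSeries.coeff n (f⁻¹ ^ r) =
      Φ ((PowerSeries.constantCoeff f)⁻¹, fun j => PowerSeries.coeff (j + 1) f) := by
  induction r generalizing n with
  | zero => exact ⟨fun _ => PowerSeries.coeff n 1, continuous_const, fun f => by rw [pow_zero]⟩
  | succ r ih =>
    choose Φ hΦ hΦ' using ih
    choose Ψ hΨ hΨ' using exists_coeff_inv
    have hres : ∀ a, a ≤ n → Continuous fun z : ℝ × (Fin n → ℝ) =>
        ((z.1, fun j : Fin a => if h : (j : ℕ) < n then z.2 ⟨j, h⟩ else 0) : ℝ × (Fin a → ℝ)) := by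
      intro a _
      refine continuous_fst.prodMk (continuous_pi fun j => ?_)
      split_ifs
      · exact (continuous_apply _).comp continuous_snd
      · exact continuous_const
    refine ⟨fun z => ∑ x ∈ antidiagonal n,
      Φ x.1 (z.1, fun j => if h : (j : ℕ) < n then z.2 ⟨j, h⟩ else 0) *
      Ψ x.2 (z.1, fun j => if h : (j : ℕ) < n then z.2 ⟨j, h⟩ else 0),
      continuous_finsetSum _ fun x hx => ?_, fun f => ?_⟩
    · rw [mem_antidiagonal] at hx
      exact ((hΦ _).comp (hres x.1 (by omega))).mul ((hΨ _).comp (hres x.2 (by omega)))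
    · rw [pow_succ, PowerSeries.coeff_mul]
      refine Finset.sum_congr rfl fun x hx => ?_
      rw [mem_antidiagonal] at hx
      rw [hΦ' x.1 f, hΨ' x.2 f]
      congr 3
      · funext j
        rw [dif_pos (by omega)]
      · funext j
        rw [dif_pos (by omega)]

theorem tendsto_coeff_inv_pow {α : Type*} {l : Filter α} {f : α → PowerSeries ℝ}
    {f₀ : PowerSeries ℝ} {n : ℕ} (h₀ : PowerSeries.constantCoeff f₀ ≠ 0)
    (h : ∀ j ≤ n, Tendsto (fun x => PowerSeries.coeff j (f x)) l (𝓝 (PowerSeries.coeff j f₀)))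
    (r : ℕ) : Tendsto (fun x => PowerSeries.coeff n ((f x)⁻¹ ^ r)) l
      (𝓝 (PowerSeries.coeff n (f₀⁻¹ ^ r))) := by
  obtain ⟨Φ, hΦ, hΦ'⟩ := exists_coeff_inv_pow r n
  simp only [hΦ']
  refine (hΦ.tendsto _).comp (Tendsto.prodMk_nhds ?_ (tendsto_pi_nhds.2 fun j => h _ (by omega)))
  refine Tendsto.inv₀ ?_ h₀
  simpa only [PowerSeries.coeff_zero_eq_constantCoeff] using h 0 (Nat.zero_le n)

theorem measurable_coeff_inv_pow {α : Type*} [MeasurableSpace α] {f : α → PowerSeries ℝ} {n : ℕ}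
    (h : ∀ j ≤ n, Measurable fun x => PowerSeries.coeff j (f x)) (r : ℕ) :
    Measurable fun x => PowerSeries.coeff n ((f x)⁻¹ ^ r) := by
  obtain ⟨Φ, hΦ, hΦ'⟩ := exists_coeff_inv_pow r n
  simp only [hΦ']
  refine hΦ.measurable.comp (Measurable.prodMk ?_ (measurable_pi_lambda _ fun j => h _ (by omega)))
  refine Measurable.inv ?_
  simpa only [PowerSeries.coeff_zero_eq_constantCoeff] using h 0 (Nat.zero_le n)

theorem exists_bound_coeff_inv_pow (r n : ℕ) (R : ℝ) : ∃ B : ℝ, 0 ≤ B ∧ ∀ f : PowerSeries ℝ,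
    |(PowerSeries.constantCoeff f)⁻¹| ≤ R →
    (∀ j < n, |PowerSeries.coeff (j + 1) f| ≤ R) → |PowerSeries.coeff n (f⁻¹ ^ r)| ≤ B := by
  obtain ⟨Φ, hΦ, hΦ'⟩ := exists_coeff_inv_pow r n
  obtain ⟨B, hB⟩ := (isCompact_closedBall (0 : ℝ × (Fin n → ℝ)) R).exists_bound_of_continuousOn
    hΦ.continuousOn
  refine ⟨max B 0, le_max_right _ _, fun f h1 h2 => ?_⟩
  rw [hΦ']
  refine (hB _ ?_).trans (le_max_left _ _)
  have hR : 0 ≤ R := (abs_nonneg _).trans h1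
  rw [mem_closedBall_zero_iff, Prod.norm_def, max_le_iff, pi_norm_le_iff_of_nonneg hR]
  exact ⟨h1, fun j => h2 _ j.2⟩

theorem coeff_pow_of_lt {S : PowerSeries ℝ} (hS : PowerSeries.constantCoeff S = 0) {n j : ℕ}
    (h : n < j) : PowerSeries.coeff n (S ^ j) = 0 := by
  obtain ⟨T, rfl⟩ := PowerSeries.X_dvd_iff.2 hS
  rw [mul_pow, PowerSeries.coeff_X_pow_mul', if_neg (by omega)]

theorem coeff_pow_mul_of_lt {S : PowerSeries ℝ} (hS : PowerSeries.constantCoeff S = 0) {n j : ℕ}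
    (h : n < j) (T : PowerSeries ℝ) : PowerSeries.coeff n (S ^ j * T) = 0 := by
  rw [PowerSeries.coeff_mul]
  refine Finset.sum_eq_zero fun x hx => ?_
  rw [mem_antidiagonal] at hx
  rw [coeff_pow_of_lt hS (by omega), zero_mul]

theorem sub_pow_mul_geom_sum (c : ℝ) (S : PowerSeries ℝ) (hc : c ≠ 0) (n : ℕ) :
    (PowerSeries.C c - S) * ∑ j ∈ Finset.range n, PowerSeries.C (c⁻¹ ^ (j + 1)) * S ^ j =
      1 - PowerSeries.C (c⁻¹ ^ n) * S ^ n := by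
  induction n with
  | zero => simp
  | succ n ih =>
    have h : PowerSeries.C c * PowerSeries.C (c⁻¹ ^ (n + 1)) = (PowerSeries.C (c⁻¹ ^ n) :
        PowerSeries ℝ) := by
      rw [← map_mul, pow_succ]
      congr 1
      field_simp
    rw [Finset.sum_range_succ, mul_add, ih]
    linear_combination S ^ n * h

theorem coeff_inv_eq_sum {c : ℝ} {S : PowerSeries ℝ} (hc : c ≠ 0)
    (hS : PowerSeries.constantCoeff S = 0) (n : ℕ) :
    PowerSeries.coeff n (PowerSeries.C c - S)⁻¹ =
      ∑ j ∈ Finset.range (n + 1), c⁻¹ ^ (j + 1) * PowerSeries.coeff n (S ^ j) := by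
  have h1 := sub_pow_mul_geom_sum c S hc (n + 1)
  have h2 : (PowerSeries.C c - S) * (PowerSeries.C c - S)⁻¹ = 1 :=
    PowerSeries.mul_inv_cancel _ (by simpa [hS] using hc)
  have h3 : (PowerSeries.C c - S)⁻¹ =
      ∑ j ∈ Finset.range (n + 1), PowerSeries.C (c⁻¹ ^ (j + 1)) * S ^ j +
        S ^ (n + 1) * (PowerSeries.C (c⁻¹ ^ (n + 1)) * (PowerSeries.C c - S)⁻¹) := by
    linear_combination (PowerSeries.C c - S)⁻¹ * (-h1) +
      (∑ j ∈ Finset.range (n + 1), PowerSeries.C (c⁻¹ ^ (j + 1)) * S ^ j) * h2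
  rw [h3, map_add, coeff_pow_mul_of_lt hS (Nat.lt_succ_self n), add_zero, map_sum]
  simp only [PowerSeries.coeff_C_mul]

theorem sq_sub_mul_sum (c : ℝ) (S : PowerSeries ℝ) (hc : c ≠ 0) (n : ℕ) :
    (PowerSeries.C c - S) ^ 2 *
      ∑ j ∈ Finset.range n, PowerSeries.C ((j + 1) * c⁻¹ ^ (j + 1)) * S ^ j =
      PowerSeries.C c - S ^ n * (PowerSeries.C ((n + 1) * c * c⁻¹ ^ n) -
        PowerSeries.C (n * c⁻¹ ^ n) * S) := by
  induction n with
  | zero => simp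
  | succ n ih =>
    rw [Finset.sum_range_succ, mul_add, ih]
    have h : PowerSeries.C c * PowerSeries.C (c⁻¹ ^ (n + 1)) = (PowerSeries.C (c⁻¹ ^ n) :
        PowerSeries ℝ) := by
      rw [← map_mul, pow_succ]
      congr 1
      field_simp
    simp only [map_mul, map_add, map_one, Nat.cast_succ] at h ⊢
    linear_combination (S ^ n * (PowerSeries.C (n : ℝ) + 1) * (PowerSeries.C c - S)) * h -
      S ^ n * PowerSeries.C (n : ℝ) * S * h + S * S ^ n * (PowerSeries.C (n : ℝ) + 1) * h

/-- Expansion of `c (c - S)⁻²`, exact at order `n` since `S` starts at order 1. The weights `j + 1`,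
absent from `coeff_inv_eq_sum`, will be removed by the integrals of `θ^j δ`. -/
theorem coeff_mul_inv_sq_eq_sum {c : ℝ} {S : PowerSeries ℝ} (hc : c ≠ 0)
    (hS : PowerSeries.constantCoeff S = 0) (n : ℕ) :
    c * PowerSeries.coeff n ((PowerSeries.C c - S)⁻¹ ^ 2) =
      ∑ j ∈ Finset.range (n + 1), (j + 1) * c⁻¹ ^ (j + 1) * PowerSeries.coeff n (S ^ j) := by
  have h1 := sq_sub_mul_sum c S hc (n + 1)
  have h2 : (PowerSeries.C c - S) * (PowerSeries.C c - S)⁻¹ = 1 :=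
    PowerSeries.mul_inv_cancel _ (by simpa [hS] using hc)
  have h3 : PowerSeries.C c * (PowerSeries.C c - S)⁻¹ ^ 2 =
      ∑ j ∈ Finset.range (n + 1), PowerSeries.C (((j : ℕ) + 1) * c⁻¹ ^ (j + 1)) * S ^ j +
        S ^ (n + 1) * ((PowerSeries.C (((n + 1 : ℕ) + 1) * c * c⁻¹ ^ (n + 1)) -
        PowerSeries.C ((n + 1 : ℕ) * c⁻¹ ^ (n + 1)) * S) * (PowerSeries.C c - S)⁻¹ ^ 2) := by
    linear_combination (PowerSeries.C c - S)⁻¹ ^ 2 * (-h1) +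
      (∑ j ∈ Finset.range (n + 1), PowerSeries.C (((j : ℕ) + 1) * c⁻¹ ^ (j + 1)) * S ^ j) *
      ((PowerSeries.C c - S) * (PowerSeries.C c - S)⁻¹ + 1) * h2
  rw [← PowerSeries.coeff_C_mul, h3, map_add, coeff_pow_mul_of_lt hS (Nat.lt_succ_self n),
    add_zero, map_sum]
  simp only [PowerSeries.coeff_C_mul]

end Coefficients

open MeasureTheory

/-! ### Lattice sums as integrals -/

section Lattice

variable {ι : Type*} [Fintype ι]

theorem measurable_floor_pi {ι : Type*} : Measurable fun (u : ι → ℝ) (j : ι) => ⌊u j⌋ :=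
  measurable_pi_lambda _ fun j => Int.measurable_floor.comp (measurable_pi_apply j)

theorem map_floor_pi : Measure.map (fun (u : ι → ℝ) (j : ι) => ⌊u j⌋) volume = Measure.count := by
  refine Measure.ext_of_singleton fun y => ?_
  have h : (fun (u : ι → ℝ) (j : ι) => ⌊u j⌋) ⁻¹' {y} =
      Set.univ.pi fun j => Set.Ico (y j : ℝ) (y j + 1) := by
    ext u
    simp [funext_iff, Int.floor_eq_iff]
  rw [Measure.map_apply measurable_floor_pi (measurableSet_singleton y), h, volume_pi_pi,
    Measure.count_singleton]
  simp

/-- A sum over `ℤ^ι` is an integral of a function of the integer parts. -/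
theorem summable_and_tsum_eq_integral_floor (F : (ι → ℤ) → ℝ) {Λ : ℝ} (hΛ : 0 < Λ)
    (h : Integrable fun u : ι → ℝ => F fun j => ⌊Λ * u j⌋) :
    Summable F ∧ ∑' y, F y = Λ ^ Fintype.card ι * ∫ u : ι → ℝ, F fun j => ⌊Λ * u j⌋ := by
  have h1 : Integrable fun u : ι → ℝ => F fun j => ⌊u j⌋ := by
    rw [← integrable_comp_smul_iff volume (fun u : ι → ℝ => F fun j => ⌊u j⌋) hΛ.ne']
    exact h
  have hF : AEStronglyMeasurable F (Measure.map (fun (u : ι → ℝ) (j : ι) => ⌊u j⌋) volume) :=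
    (measurable_of_countable F).aestronglyMeasurable
  have h2 : Integrable F (Measure.count : Measure (ι → ℤ)) := by
    rw [← map_floor_pi, integrable_map_measure hF measurable_floor_pi.aemeasurable]
    exact h1
  have h3 : ∫ u : ι → ℝ, F (fun j => ⌊u j⌋) = ∑' y, F y := by
    rw [← integral_map measurable_floor_pi.aemeasurable hF, map_floor_pi, integral_countable h2]
    simp [Measure.real]
  have h4 := Measure.integral_comp_smul volume (fun u : ι → ℝ => F fun j => ⌊u j⌋) Λ
  simp only [Pi.smul_apply, smul_eq_mul, Module.finrank_fintype_fun_eq_card] at h4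
  refine ⟨(integrable_count_iff.1 h2).of_norm, ?_⟩
  rw [h4, h3, abs_of_pos (by positivity), mul_inv_cancel_left₀ (by positivity)]

theorem insertNth_injective {k : ℕ} (i : Fin (k + 1)) (s : ℤ) :
    Function.Injective fun y : Fin k → ℤ => (i.insertNth s y : Fin (k + 1) → ℤ) :=
  fun _ _ h => (Fin.insertNth_injective2 h).2

/-- The same, for the points of the lattice whose `i`-th coordinate is `s`. -/
theorem summable_and_tsum_eq_integral_insertNth {k : ℕ} (i : Fin (k + 1)) (s : ℤ)
    (F : (Fin (k + 1) → ℤ) → ℝ) (hF : ∀ q, q i ≠ s → F q = 0) {Λ : ℝ} (hΛ : 0 < Λ)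
    (h : Integrable fun u : Fin k → ℝ => F (i.insertNth s fun j => ⌊Λ * u j⌋)) :
    Summable F ∧
      ∑' q, F q = Λ ^ k * ∫ u : Fin k → ℝ, F (i.insertNth s fun j => ⌊Λ * u j⌋) := by
  obtain ⟨h1, h2⟩ := summable_and_tsum_eq_integral_floor
    (fun y : Fin k → ℤ => F (i.insertNth s y)) hΛ h
  have h3 : ∀ q ∉ Set.range fun y : Fin k → ℤ => (i.insertNth s y : Fin (k + 1) → ℤ),
      F q = 0 := by
    intro q hq
    refine hF q fun hs => hq ⟨i.removeNth q, ?_⟩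
    subst hs
    exact Fin.insertNth_self_removeNth i q
  refine ⟨((insertNth_injective i s).summable_iff h3).1 h1, ?_⟩
  rw [← (insertNth_injective i s).tsum_eq (Function.support_subset_iff'.2 h3), h2,
    Fintype.card_fin]

end Lattice

/-! ### The gauge `∑ |u j| ^ p` -/

section Gauge

variable {ι : Type*} [Fintype ι] {p : ℝ}

/-- The sum of the `p`-th powers of the coordinates. -/
noncomputable def gauge (p : ℝ) (u : ι → ℝ) : ℝ := ∑ j, |u j| ^ p

theorem gauge_nonneg (u : ι → ℝ) : 0 ≤ gauge p u :=
  Finset.sum_nonneg fun _ _ => Real.rpow_nonneg (abs_nonneg _) _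

theorem continuous_gauge (hp : 0 ≤ p) : Continuous (gauge p : (ι → ℝ) → ℝ) :=
  continuous_finsetSum _ fun j _ => ((continuous_apply j).abs).rpow_const fun _ => Or.inr hp

/-- The open and the closed `ℓ^p` ball have the same finite volume, so their difference is null.
This is why the discontinuity of the sharp cutoff does no harm under the integral. -/
theorem volume_gauge_eq [Nonempty ι] (hp : 1 ≤ p) (c : ℝ) :
    volume {u : ι → ℝ | gauge p u = c} = 0 := by
  have hp0 : 0 < p := by linarith
  have h1 := volume_sum_rpow_le ι hp (c ^ (1 / p))
  rw [← volume_sum_rpow_lt ι hp] at h1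
  have hle : {u : ι → ℝ | (∑ i, |u i| ^ p) ^ (1 / p) < c ^ (1 / p)} ⊆
      {u : ι → ℝ | (∑ i, |u i| ^ p) ^ (1 / p) ≤ c ^ (1 / p)} := fun u hu => by
    simp only [Set.mem_ofPred_eq] at hu ⊢
    exact hu.le
  have hmeas : MeasurableSet {u : ι → ℝ | (∑ i, |u i| ^ p) ^ (1 / p) < c ^ (1 / p)} :=
    measurableSet_lt ((continuous_gauge hp0.le).measurable.pow_const _) measurable_const
  have hfin : volume {u : ι → ℝ | (∑ i, |u i| ^ p) ^ (1 / p) < c ^ (1 / p)} ≠ ⊤ := by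
    rw [volume_sum_rpow_lt ι hp]
    exact ENNReal.mul_ne_top (ENNReal.pow_ne_top ENNReal.ofReal_ne_top) ENNReal.ofReal_ne_top
  have h2 := measure_sdiff hle hmeas.nullMeasurableSet hfin
  rw [h1, tsub_self] at h2
  refine measure_mono_null (fun u hu => ?_) h2
  rw [Set.mem_ofPred_eq] at hu
  have : (∑ i, |u i| ^ p) = c := hu
  exact ⟨by simp only [Set.mem_ofPred_eq, this, le_refl],
    by simp only [Set.mem_ofPred_eq, this, lt_irrefl, not_false_eq_true]⟩

theorem ae_gauge_ne [Nonempty ι] (hp : 1 ≤ p) (c : ℝ) : ∀ᵐ u : ι → ℝ, gauge p u ≠ c := by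
  rw [ae_iff]
  simpa using volume_gauge_eq hp c

theorem integrable_exp_neg_abs : Integrable fun x : ℝ => Real.exp (-|x|) := by
  rw [← integrableOn_univ, ← Set.Iic_union_Ioi (a := (0 : ℝ))]
  refine IntegrableOn.union ?_ ?_
  · refine (integrableOn_exp_Iic 0).congr_fun (fun x hx => ?_) measurableSet_Iic
    rw [abs_of_nonpos hx, neg_neg]
  · refine (integrableOn_exp_neg_Ioi 0).congr_fun (fun x hx => ?_) measurableSet_Ioi
    rw [abs_of_pos hx]

theorem integrable_exp_neg_sum_abs :
    Integrable fun u : ι → ℝ => Real.exp (-∑ j, |u j|) := by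
  have := Integrable.fintype_prod (μ := fun _ : ι => (volume : Measure ℝ))
    (f := fun (_ : ι) (x : ℝ) => Real.exp (-|x|)) fun _ => integrable_exp_neg_abs
  simp only [← Real.exp_sum, Finset.sum_neg_distrib] at this
  exact this

end Gauge

/-! ### Integrals over the loop momenta -/

section Loops

variable {k n : ℕ} {p M R B C : ℝ} {W θ : ℝ → ℝ} {f : ℝ → ℝ} {T : ℝ → PowerSeries ℝ} {x : ℝ}

/-- The kinetic energy at the momentum `(x, u)`, where the momenta are discretized by `f`. -/
noncomputable def energy (p : ℝ) (f : ℝ → ℝ) (x : ℝ) (u : Fin k → ℝ) : ℝ :=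
  |f x| ^ p + gauge p fun j => f (u j)

/-- The two-point function with a one-colour self energy `T`, weighted by `θ`. -/
noncomputable def dressed (p M : ℝ) (θ : ℝ → ℝ) (f : ℝ → ℝ) (T : ℝ → PowerSeries ℝ) (x : ℝ)
    (u : Fin k → ℝ) : PowerSeries ℝ :=
  PowerSeries.C (energy p f x u + M) -
    PowerSeries.C (θ (energy p f x u)) * (T x + ∑ j, T (u j))

/-- The coefficient of order `n` of `W` times the `r`-th power of the full propagator. -/
noncomputable def loopIntegrand (p M : ℝ) (W θ : ℝ → ℝ) (n r : ℕ) (f : ℝ → ℝ)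
    (T : ℝ → PowerSeries ℝ) (x : ℝ) (u : Fin k → ℝ) : ℝ :=
  W (energy p f x u) * PowerSeries.coeff n ((dressed p M θ f T x u)⁻¹ ^ r)

/-- A discretization and a self energy with uniform bounds, up to the order `n`. -/
structure IsProfile (n : ℕ) (R C : ℝ) (f : ℝ → ℝ) (T : ℝ → PowerSeries ℝ) : Prop where
  measurable_f : Measurable f
  sub_le_abs : ∀ v, |v| - R ≤ |f v|
  const : ∀ v, PowerSeries.constantCoeff (T v) = 0
  measurable_T : ∀ m ≤ n, Measurable fun v => PowerSeries.coeff m (T v)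
  bound : ∀ m ≤ n, ∀ v, |PowerSeries.coeff m (T v)| ≤ C

/-- A rapidly decreasing weight, with discontinuities at `1` only. -/
structure IsWeight (B : ℝ) (W θ : ℝ → ℝ) : Prop where
  measurable_W : Measurable W
  measurable_θ : Measurable θ
  abs_θ_le : ∀ y, |θ y| ≤ 1
  abs_W_le : ∀ y, 0 ≤ y → |W y| ≤ B * Real.exp (-y)
  continuousAt_W : ∀ y, y ≠ 1 → ContinuousAt W y
  continuousAt_θ : ∀ y, y ≠ 1 → ContinuousAt θ y

theorem energy_nonneg (u : Fin k → ℝ) : 0 ≤ energy p f x u :=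
  add_nonneg (Real.rpow_nonneg (abs_nonneg _) _) (gauge_nonneg _)

theorem measurable_energy (hf : Measurable f) :
    Measurable fun u : Fin k → ℝ => energy p f x u := by
  refine measurable_const.add (Finset.measurable_sum _ fun j _ => ?_)
  exact ((hf.comp (measurable_pi_apply j)).abs).pow_const _

theorem sub_one_le_rpow (hp : 1 ≤ p) {y : ℝ} (hy : 0 ≤ y) : y - 1 ≤ y ^ p := by
  rcases le_total y 1 with h | h
  · exact (sub_nonpos.2 h).trans (Real.rpow_nonneg hy _)
  · exact (sub_le_self _ zero_le_one).trans (Real.self_le_rpow_of_one_le h hp)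

/-- For `p ≥ 1` the gauge dominates the `ℓ¹` norm up to a constant. The majorant is integrable and
depends on the discretization only through `R`, hence is uniform in the cutoff. -/
theorem exp_neg_energy_le (hp : 1 ≤ p) (hf : ∀ v, |v| - R ≤ |f v|) (u : Fin k → ℝ) :
    Real.exp (-energy p f x u) ≤ Real.exp (k * (R + 1)) * Real.exp (-∑ j, |u j|) := by
  rw [← Real.exp_add, Real.exp_le_exp]
  have h1 : ∑ j, (|u j| - (R + 1)) ≤ gauge p fun j => f (u j) := by
    refine Finset.sum_le_sum fun j _ => ?_
    have := sub_one_le_rpow hp (abs_nonneg (f (u j)))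
    linarith [hf (u j)]
  rw [Finset.sum_sub_distrib, Finset.sum_const, Finset.card_univ, Fintype.card_fin,
    nsmul_eq_mul] at h1
  have h2 : 0 ≤ |f x| ^ p := Real.rpow_nonneg (abs_nonneg _) _
  unfold energy
  linarith

theorem constantCoeff_dressed (hT : ∀ v, PowerSeries.constantCoeff (T v) = 0) (u : Fin k → ℝ) :
    PowerSeries.constantCoeff (dressed p M θ f T x u) = energy p f x u + M := by
  simp [dressed, hT]

theorem coeff_succ_dressed (m : ℕ) (u : Fin k → ℝ) :
    PowerSeries.coeff (m + 1) (dressed p M θ f T x u) = -(θ (energy p f x u) *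
      (PowerSeries.coeff (m + 1) (T x) + ∑ j, PowerSeries.coeff (m + 1) (T (u j)))) := by
  rw [dressed, map_sub, PowerSeries.coeff_C_mul, PowerSeries.coeff_C, if_neg (Nat.succ_ne_zero m),
    zero_sub, map_add, map_sum]

theorem constantCoeff_dressed_ne_zero (hM : 0 < M)
    (hT : ∀ v, PowerSeries.constantCoeff (T v) = 0) (u : Fin k → ℝ) :
    PowerSeries.constantCoeff (dressed p M θ f T x u) ≠ 0 := by
  rw [constantCoeff_dressed hT]
  exact (add_pos_of_nonneg_of_pos (energy_nonneg u) hM).ne'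

/-- The mass keeps the inverse of the constant coefficient below `M⁻¹`, and the higher coefficients
are sums of `k + 1` one-colour terms; a continuous function is bounded on this compact range. -/
theorem exists_bound_dressed (hM : 0 < M) (k n r : ℕ) (R C : ℝ) : ∃ D : ℝ, 0 ≤ D ∧
    ∀ p θ f T, (∀ y, |θ y| ≤ 1) → IsProfile n R C f T → ∀ (x : ℝ) (u : Fin k → ℝ),
      |PowerSeries.coeff n ((dressed p M θ f T x u)⁻¹ ^ r)| ≤ D := by
  obtain ⟨D, hD, h⟩ := exists_bound_coeff_inv_pow r n (max M⁻¹ ((k + 1) * C))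
  refine ⟨D, hD, fun p θ f T hθ hT x u => h _ ?_ fun j hj => ?_⟩
  · rw [constantCoeff_dressed hT.const, abs_inv,
      abs_of_pos (add_pos_of_nonneg_of_pos (energy_nonneg u) hM)]
    exact (inv_anti₀ hM (by linarith [energy_nonneg (p := p) (f := f) (x := x) u])).trans
      (le_max_left _ _)
  · rw [coeff_succ_dressed, abs_neg, abs_mul]
    refine le_trans ?_ (le_max_right _ _)
    have h1 : |PowerSeries.coeff (j + 1) (T x) + ∑ i, PowerSeries.coeff (j + 1) (T (u i))| ≤
        (k + 1) * C := by
      refine (abs_add_le _ _).trans ?_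
      have h2 := (Finset.abs_sum_le_sum_abs (fun i => PowerSeries.coeff (j + 1) (T (u i)))
        Finset.univ).trans (Finset.sum_le_sum fun i _ => hT.bound (j + 1) (by omega) (u i))
      rw [Finset.sum_const, Finset.card_univ, Fintype.card_fin, nsmul_eq_mul] at h2
      linarith [hT.bound (j + 1) (by omega) x]
    calc _ ≤ 1 * ((k + 1) * C) := mul_le_mul (hθ _) h1 (abs_nonneg _) zero_le_one
      _ = _ := one_mul _

theorem measurable_coeff_dressed (hθ : Measurable θ) (hT : IsProfile n R C f T) (r : ℕ) :
    Measurable fun u : Fin k → ℝ => PowerSeries.coeff n ((dressed p M θ f T x u)⁻¹ ^ r) := by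
  refine measurable_coeff_inv_pow (fun j hj => ?_) r
  cases j with
  | zero =>
    simp only [PowerSeries.coeff_zero_eq_constantCoeff_apply, constantCoeff_dressed hT.const]
    exact (measurable_energy hT.measurable_f).add_const _
  | succ j =>
    simp only [coeff_succ_dressed]
    refine ((hθ.comp (measurable_energy hT.measurable_f)).mul (measurable_const.add
      (Finset.measurable_sum _ fun i _ => ?_))).neg
    exact (hT.measurable_T _ hj).comp (measurable_pi_apply i)

theorem measurable_loopIntegrand (hW : IsWeight B W θ) (hT : IsProfile n R C f T) (r : ℕ) :
    Measurable fun u : Fin k → ℝ => loopIntegrand p M W θ n r f T x u :=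
  (hW.measurable_W.comp (measurable_energy hT.measurable_f)).mul
    (measurable_coeff_dressed hW.measurable_θ hT r)

theorem exists_bound_loopIntegrand (hp : 1 ≤ p) (hM : 0 < M) (k n r : ℕ) (R C B : ℝ) :
    ∃ D : ℝ, 0 ≤ D ∧ ∀ W θ f T, IsWeight B W θ → IsProfile n R C f T → ∀ (x : ℝ) (u : Fin k → ℝ),
      |loopIntegrand p M W θ n r f T x u| ≤ D * Real.exp (-∑ j, |u j|) := by
  obtain ⟨D, hD, h⟩ := exists_bound_dressed hM k n r R C
  refine ⟨|B| * Real.exp (k * (R + 1)) * D, by positivity, fun W θ f T hW hT x u => ?_⟩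
  rw [loopIntegrand, abs_mul]
  have h1 := hW.abs_W_le _ (energy_nonneg (p := p) (f := f) (x := x) u)
  have h2 := exp_neg_energy_le (x := x) hp hT.sub_le_abs u
  have h3 := h p θ f T hW.abs_θ_le hT x u
  calc _ ≤ |B| * (Real.exp (k * (R + 1)) * Real.exp (-∑ j, |u j|)) * D :=
        mul_le_mul (h1.trans (mul_le_mul (le_abs_self B) h2 (Real.exp_pos _).le (abs_nonneg _))) h3
          (abs_nonneg _) (by positivity)
    _ = _ := by ring

theorem integrable_loopIntegrand (hp : 1 ≤ p) (hM : 0 < M) (hW : IsWeight B W θ)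
    (hT : IsProfile n R C f T) (r : ℕ) (x : ℝ) :
    Integrable fun u : Fin k → ℝ => loopIntegrand p M W θ n r f T x u := by
  obtain ⟨D, -, h⟩ := exists_bound_loopIntegrand hp hM k n r R C B
  refine (integrable_exp_neg_sum_abs.const_mul D).mono'
    (measurable_loopIntegrand hW hT r).aestronglyMeasurable (Eventually.of_forall fun u => ?_)
  exact h W θ f T hW hT x u

theorem exists_bound_integral_loopIntegrand (hp : 1 ≤ p) (hM : 0 < M) (k n r : ℕ) (R C B : ℝ) :
    ∃ D : ℝ, 0 ≤ D ∧ ∀ W θ f T, IsWeight B W θ → IsProfile n R C f T → ∀ x : ℝ,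
      |∫ u : Fin k → ℝ, loopIntegrand p M W θ n r f T x u| ≤ D := by
  obtain ⟨D, hD, h⟩ := exists_bound_loopIntegrand hp hM k n r R C B
  refine ⟨∫ u : Fin k → ℝ, D * Real.exp (-∑ j, |u j|), integral_nonneg fun u => by positivity,
    fun W θ f T hW hT x => ?_⟩
  rw [← Real.norm_eq_abs]
  refine norm_integral_le_of_norm_le (integrable_exp_neg_sum_abs.const_mul D)
    (Eventually.of_forall fun u => ?_)
  rw [Real.norm_eq_abs]
  exact h W θ f T hW hT x u

section Limits

variable {α : Type*} {l : Filter α} {F : α → ℝ → ℝ} {S : α → ℝ → PowerSeries ℝ} {y : α → ℝ}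

theorem tendsto_energy (hp : 0 ≤ p) (hy : Tendsto (fun a => F a (y a)) l (𝓝 (f x)))
    (hF : ∀ v, Tendsto (fun a => F a v) l (𝓝 (f v))) (u : Fin k → ℝ) :
    Tendsto (fun a => energy p (F a) (y a) u) l (𝓝 (energy p f x u)) := by
  refine Tendsto.add (hy.abs.rpow_const (Or.inr hp)) (tendsto_finsetSum _ fun j _ => ?_)
  exact (hF _).abs.rpow_const (Or.inr hp)

theorem tendsto_loopIntegrand (hp : 0 ≤ p) (hM : 0 < M) (hW : IsWeight B W θ)
    (hT : ∀ v, PowerSeries.constantCoeff (T v) = 0)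
    (hy : Tendsto (fun a => F a (y a)) l (𝓝 (f x)))
    (hF : ∀ v, Tendsto (fun a => F a v) l (𝓝 (f v)))
    (hSy : ∀ m ≤ n, Tendsto (fun a => PowerSeries.coeff m (S a (y a))) l
      (𝓝 (PowerSeries.coeff m (T x))))
    (hS : ∀ m ≤ n, ∀ v, Tendsto (fun a => PowerSeries.coeff m (S a v)) l
      (𝓝 (PowerSeries.coeff m (T v))))
    (r : ℕ) {u : Fin k → ℝ} (hu : energy p f x u ≠ 1) :
    Tendsto (fun a => loopIntegrand p M W θ n r (F a) (S a) (y a) u) l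
      (𝓝 (loopIntegrand p M W θ n r f T x u)) := by
  have he := tendsto_energy hp hy hF u
  refine ((hW.continuousAt_W _ hu).tendsto.comp he).mul (tendsto_coeff_inv_pow
    (constantCoeff_dressed_ne_zero hM hT u) (fun j hj => ?_) r)
  have hθ := (hW.continuousAt_θ _ hu).tendsto.comp he
  have hsum := (hSy j hj).add (tendsto_finsetSum Finset.univ fun i _ => hS j hj (u i))
  have h1 := hθ.mul hsum
  simp only [dressed, map_sub, PowerSeries.coeff_C_mul, map_add, map_sum]
  refine Tendsto.sub ?_ h1
  by_cases h0 : j = 0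
  · subst h0
    simpa [PowerSeries.coeff_C] using he.add_const M
  · simpa [PowerSeries.coeff_C, h0] using tendsto_const_nhds

variable [l.IsCountablyGenerated]

/-- Dominated convergence for the loop integrals, with a bounded spectator factor. -/
theorem tendsto_integral_loopIntegrand_mul [NeZero k] (hp : 1 ≤ p) (hM : 0 < M)
    (hW : IsWeight B W θ) (hT : ∀ v, PowerSeries.constantCoeff (T v) = 0) (hf : f = id)
    (hprof : ∀ᶠ a in l, IsProfile n R C (F a) (S a))
    (hy : Tendsto (fun a => F a (y a)) l (𝓝 (f x)))
    (hF : ∀ v, Tendsto (fun a => F a v) l (𝓝 (f v)))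
    (hSy : ∀ m ≤ n, Tendsto (fun a => PowerSeries.coeff m (S a (y a))) l
      (𝓝 (PowerSeries.coeff m (T x))))
    (hS : ∀ m ≤ n, ∀ v, Tendsto (fun a => PowerSeries.coeff m (S a v)) l
      (𝓝 (PowerSeries.coeff m (T v))))
    (r : ℕ) {ρ : (Fin k → ℝ) → ℝ} (hρ : Measurable ρ) {A : ℝ} (hρA : ∀ u, |ρ u| ≤ A) :
    Tendsto (fun a => ∫ u : Fin k → ℝ, loopIntegrand p M W θ n r (F a) (S a) (y a) u * ρ u) l
      (𝓝 (∫ u : Fin k → ℝ, loopIntegrand p M W θ n r f T x u * ρ u)) := by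
  obtain ⟨D, hD, h⟩ := exists_bound_loopIntegrand hp hM k n r R C B
  refine tendsto_integral_filter_of_dominated_convergence
    (fun u => D * Real.exp (-∑ j, |u j|) * A) ?_ ?_
    ((integrable_exp_neg_sum_abs.const_mul D).mul_const A) ?_
  · filter_upwards [hprof] with a ha
    exact ((measurable_loopIntegrand hW ha r).mul hρ).aestronglyMeasurable
  · filter_upwards [hprof] with a ha
    refine Eventually.of_forall fun u => ?_
    rw [Real.norm_eq_abs, abs_mul]
    exact mul_le_mul (h W θ _ _ hW ha _ u) (hρA u) (abs_nonneg _) (by positivity)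
  · have : Nonempty (Fin k) := ⟨0⟩
    -- The integrand can fail to converge only where the limiting energy equals 1, a level set of
    -- the gauge.
    filter_upwards [ae_gauge_ne (ι := Fin k) hp (1 - |x| ^ p)] with u hu
    refine (tendsto_loopIntegrand (by linarith) hM hW hT hy hF hSy hS r ?_).mul_const _
    subst hf
    intro he
    exact hu (by rw [← he]; simp [energy])

theorem tendsto_integral_loopIntegrand [NeZero k] (hp : 1 ≤ p) (hM : 0 < M)
    (hW : IsWeight B W θ) (hT : ∀ v, PowerSeries.constantCoeff (T v) = 0) (hf : f = id)
    (hprof : ∀ᶠ a in l, IsProfile n R C (F a) (S a))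
    (hy : Tendsto (fun a => F a (y a)) l (𝓝 (f x)))
    (hF : ∀ v, Tendsto (fun a => F a v) l (𝓝 (f v)))
    (hSy : ∀ m ≤ n, Tendsto (fun a => PowerSeries.coeff m (S a (y a))) l
      (𝓝 (PowerSeries.coeff m (T x))))
    (hS : ∀ m ≤ n, ∀ v, Tendsto (fun a => PowerSeries.coeff m (S a v)) l
      (𝓝 (PowerSeries.coeff m (T v))))
    (r : ℕ) :
    Tendsto (fun a => ∫ u : Fin k → ℝ, loopIntegrand p M W θ n r (F a) (S a) (y a) u) l
      (𝓝 (∫ u : Fin k → ℝ, loopIntegrand p M W θ n r f T x u)) := by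
  simpa using tendsto_integral_loopIntegrand_mul hp hM hW hT hf hprof hy hF hSy hS r
    (measurable_const (a := (1 : ℝ))) (A := 1) (by simp)

end Limits

end Loops

/-! ### The regularized Dirac and Heaviside functions -/

section Regulator

variable {a : ℝ}

theorem continuous_deltaReg (a : ℝ) : Continuous (deltaReg a) := by
  unfold deltaReg
  fun_prop

theorem deltaReg_nonneg (ha : 0 < a) (x : ℝ) : 0 ≤ deltaReg a x := by
  unfold deltaReg
  positivity

/-- Completing the square: `(|x|/a - a)² ≥ 0`. -/
theorem deltaReg_le (ha : 0 < a) (x : ℝ) :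
    deltaReg a x ≤ Real.exp (a ^ 2) / (a * √Real.pi) * Real.exp (-2 * |x|) := by
  rw [deltaReg, div_mul_eq_mul_div, ← Real.exp_add]
  refine div_le_div_of_nonneg_right (Real.exp_le_exp.2 ?_) (by positivity)
  have h : 0 ≤ (|x| / a - a) ^ 2 := sq_nonneg _
  have h2 : (|x| / a - a) ^ 2 = x ^ 2 / a ^ 2 - 2 * |x| + a ^ 2 := by
    rw [← sq_abs x]
    field_simp
    ring
  linarith

theorem integrable_deltaReg (ha : 0 < a) : Integrable (deltaReg a) := by
  refine (integrable_exp_neg_abs.const_mul (Real.exp (a ^ 2) / (a * √Real.pi))).mono'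
    (continuous_deltaReg a).aestronglyMeasurable (Eventually.of_forall fun x => ?_)
  rw [Real.norm_eq_abs, abs_of_nonneg (deltaReg_nonneg ha x)]
  refine (deltaReg_le ha x).trans (mul_le_mul_of_nonneg_left ?_ (by positivity))
  exact Real.exp_le_exp.2 (by linarith [abs_nonneg x])

theorem integral_deltaReg (ha : 0 < a) : ∫ x, deltaReg a x = 1 := by
  have h := integral_gaussian (a ^ 2)⁻¹
  have h1 : ∀ x : ℝ, deltaReg a x = (a * √Real.pi)⁻¹ * Real.exp (-(a ^ 2)⁻¹ * x ^ 2) := by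
    intro x
    rw [deltaReg, div_eq_inv_mul]
    congr 2
    ring
  simp only [h1]
  rw [integral_const_mul, h, div_inv_eq_mul, Real.sqrt_mul Real.pi_pos.le, Real.sqrt_sq ha.le]
  have := Real.sqrt_pos.2 Real.pi_pos
  field_simp

theorem deltaReg_mul {c : ℝ} (hc : 0 < c) (x : ℝ) :
    deltaReg (a * c) (c * x) = c⁻¹ * deltaReg a x := by
  unfold deltaReg
  rw [mul_pow, mul_pow, mul_comm (a ^ 2), mul_div_mul_left _ _ (by positivity)]
  by_cases ha : a = 0
  · simp [ha]
  have := Real.sqrt_pos.2 Real.pi_pos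
  field_simp

theorem thetaReg_mul {c : ℝ} (hc : 0 < c) (x : ℝ) : thetaReg (a * c) (c * x) = thetaReg a x := by
  unfold thetaReg
  have h := Measure.integral_comp_mul_left (Set.indicator (Set.Iic (c * x)) (deltaReg (a * c))) c
  have h1 : ∀ z, Set.indicator (Set.Iic (c * x)) (deltaReg (a * c)) (c * z) =
      c⁻¹ * Set.indicator (Set.Iic x) (deltaReg a) z := by
    intro z
    by_cases hz : z ≤ x
    · rw [Set.indicator_of_mem (show c * z ∈ Set.Iic (c * x) from
        mul_le_mul_of_nonneg_left hz hc.le), Set.indicator_of_mem (show z ∈ Set.Iic x from hz),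
        deltaReg_mul hc]
    · rw [Set.indicator_of_notMem (show c * z ∉ Set.Iic (c * x) from fun h =>
        hz (le_of_mul_le_mul_left h hc)), Set.indicator_of_notMem (show z ∉ Set.Iic x from hz),
        mul_zero]
  simp only [h1] at h
  rw [integral_const_mul, integral_indicator measurableSet_Iic, integral_indicator
    measurableSet_Iic, abs_of_pos (inv_pos.2 hc), smul_eq_mul] at h
  exact (mul_left_cancel₀ (inv_pos.2 hc).ne' h).symm

theorem thetaReg_nonneg (ha : 0 < a) (x : ℝ) : 0 ≤ thetaReg a x :=
  integral_nonneg fun y => deltaReg_nonneg ha y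

theorem thetaReg_le_one (ha : 0 < a) (x : ℝ) : thetaReg a x ≤ 1 := by
  rw [← integral_deltaReg ha]
  exact setIntegral_le_integral (integrable_deltaReg ha)
    (Eventually.of_forall fun y => deltaReg_nonneg ha y)

theorem hasDerivAt_thetaReg (ha : 0 < a) (x : ℝ) : HasDerivAt (thetaReg a) (deltaReg a x) x := by
  have h1 : ∀ y, thetaReg a y = thetaReg a 0 + ∫ z in (0 : ℝ)..y, deltaReg a z := by
    intro y
    rw [← intervalIntegral.integral_Iic_sub_Iic (integrable_deltaReg ha).integrableOn
      (integrable_deltaReg ha).integrableOn]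
    simp only [thetaReg]
    ring
  have h2 : HasDerivAt (fun y => thetaReg a 0 + ∫ z in (0 : ℝ)..y, deltaReg a z)
      (deltaReg a x) x :=
    ((continuous_deltaReg a).integral_hasStrictDerivAt 0 x).hasDerivAt.const_add _
  exact h2.congr_of_eventuallyEq (Eventually.of_forall h1)

theorem continuous_thetaReg (ha : 0 < a) : Continuous (thetaReg a) :=
  continuous_iff_continuousAt.2 fun x => (hasDerivAt_thetaReg ha x).continuousAt

theorem tendsto_thetaReg_atTop (ha : 0 < a) : Tendsto (thetaReg a) atTop (𝓝 1) := by
  rw [← integral_deltaReg ha]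
  exact (aecover_Iic tendsto_id).integral_tendsto_of_countably_generated (integrable_deltaReg ha)

theorem tendsto_thetaReg_atBot (a : ℝ) : Tendsto (thetaReg a) atBot (𝓝 0) :=
  tendsto_integral_Iic_zero tendsto_id

/-- `θ^j δ` is the derivative of `θ^(j+1)/(j+1)`, and `θ` rises from 0 to 1. -/
theorem integral_thetaReg_pow_mul_deltaReg (ha : 0 < a) (j : ℕ) :
    ∫ x, thetaReg a x ^ j * deltaReg a x = 1 / (j + 1) := by
  have h1 : ∀ x, HasDerivAt (fun x => thetaReg a x ^ (j + 1) / (j + 1))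
      (thetaReg a x ^ j * deltaReg a x) x := by
    intro x
    refine (((hasDerivAt_thetaReg ha x).pow (j + 1)).div_const ((j : ℝ) + 1)).congr_deriv ?_
    rw [Nat.cast_succ, Nat.add_sub_cancel]
    field_simp
  have h2 : Integrable fun x => thetaReg a x ^ j * deltaReg a x := by
    refine (integrable_deltaReg ha).mono'
      (((continuous_thetaReg ha).pow j).mul (continuous_deltaReg a)).aestronglyMeasurable
      (Eventually.of_forall fun x => ?_)
    rw [Real.norm_eq_abs, abs_mul, abs_of_nonneg (deltaReg_nonneg ha x), abs_pow,
      abs_of_nonneg (thetaReg_nonneg ha x)]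
    exact mul_le_of_le_one_left (deltaReg_nonneg ha x)
      (pow_le_one₀ (thetaReg_nonneg ha x) (thetaReg_le_one ha x))
  rw [integral_of_hasDerivAt_of_tendsto h1 h2
    (((tendsto_thetaReg_atBot a).pow (j + 1)).div_const _)
    (((tendsto_thetaReg_atTop ha).pow (j + 1)).div_const _)]
  simp

/-- The weight of the boundary term. -/
noncomputable def boundaryWeight (M a y : ℝ) : ℝ := (y + M) * deltaReg a (1 - y)

/-- The Gaussian gives `exp (-2|1 - y|) ≤ e² exp (-2y)`. One factor `exp (-y)` compensates the
growth of `y + M`, the other is the required decay. -/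
theorem isWeight_boundary {M : ℝ} (hM : 0 < M) (ha : 0 < a) :
    IsWeight ((1 + M) * (Real.exp (a ^ 2) / (a * √Real.pi)) * Real.exp 2) (boundaryWeight M a)
      fun y => thetaReg a (1 - y) := by
  have hW : Continuous (boundaryWeight M a) := by
    unfold boundaryWeight
    exact (continuous_id.add_const M).mul ((continuous_deltaReg a).comp (by fun_prop))
  have hθ : Continuous fun y => thetaReg a (1 - y) := (continuous_thetaReg ha).comp (by fun_prop)
  refine ⟨hW.measurable, hθ.measurable, fun y => ?_, fun y hy => ?_, fun y _ => hW.continuousAt,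
    fun y _ => hθ.continuousAt⟩
  · rw [abs_of_nonneg (thetaReg_nonneg ha _)]
    exact thetaReg_le_one ha _
  · have h1 := deltaReg_nonneg ha (1 - y)
    rw [boundaryWeight, abs_of_nonneg (by positivity)]
    have h2 : y + M ≤ (1 + M) * Real.exp y := by
      have := Real.add_one_le_exp y
      nlinarith [mul_nonneg hM.le hy]
    have h3 : Real.exp (-2 * |1 - y|) ≤ Real.exp 2 * Real.exp (-y) * Real.exp (-y) := by
      rw [← Real.exp_add, ← Real.exp_add, Real.exp_le_exp]
      linarith [neg_abs_le (1 - y)]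
    calc (y + M) * deltaReg a (1 - y) ≤ ((1 + M) * Real.exp y) *
          (Real.exp (a ^ 2) / (a * √Real.pi) *
            (Real.exp 2 * Real.exp (-y) * Real.exp (-y))) :=
          mul_le_mul h2 ((deltaReg_le ha _).trans (mul_le_mul_of_nonneg_left h3 (by positivity)))
            h1 (by positivity)
      _ = (1 + M) * (Real.exp (a ^ 2) / (a * √Real.pi)) * Real.exp 2 *
          (Real.exp y * Real.exp (-y)) * Real.exp (-y) := by ring
      _ = _ := by rw [← Real.exp_add, add_neg_cancel, Real.exp_zero, mul_one]

/-- The sharp cutoff. -/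
noncomputable def cutWeight (y : ℝ) : ℝ := if y ≤ 1 then 1 else 0

theorem isWeight_cut : IsWeight (Real.exp 1) cutWeight fun _ => 1 := by
  refine ⟨measurable_const.ite measurableSet_Iic measurable_const, measurable_const, by simp,
    fun y _ => ?_, fun y hy => ?_, fun y _ => continuousAt_const⟩
  · rw [← Real.exp_add, cutWeight]
    split_ifs with h
    · rw [abs_one]
      exact Real.one_le_exp (by linarith)
    · rw [abs_zero]
      positivity
  · rcases lt_or_gt_of_ne hy with h | h
    · refine (continuousAt_const (y := (1 : ℝ))).congr ?_
      filter_upwards [Iio_mem_nhds h] with z hz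
      rw [cutWeight, if_pos (le_of_lt hz)]
    · refine (continuousAt_const (y := (0 : ℝ))).congr ?_
      filter_upwards [Ioi_mem_nhds h] with z hz
      rw [cutWeight, if_neg (not_le.2 hz)]

end Regulator

/-! ### The melonic functions as loop integrals -/

section Scaling

variable {k : ℕ} {i : Fin (k + 1)} {Λ mbar : ℝ}

/-- The discretization of the momenta with lattice spacing `1 / Λ`. -/
noncomputable def lattice (Λ v : ℝ) : ℝ := ⌊Λ * v⌋ / Λ

/-- The self energy in units of the cutoff. -/
noncomputable def scaledTau (i : Fin (k + 1)) (mbar Λ v : ℝ) : PowerSeries ℝ :=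
  (Λ ^ (2 * eta (k + 1)))⁻¹ • tau (k + 1) i Λ (mbar * Λ) ⌊Λ * v⌋

/-- `4η = k` is the condition of just renormalizability: a loop over `k` momentum components with
two propagators is dimensionless. -/
theorem scale_sq (hΛ : 0 < Λ) : (Λ ^ (2 * eta (k + 1))) ^ 2 = Λ ^ k := by
  rw [← Real.rpow_natCast, ← Real.rpow_mul hΛ.le, ← Real.rpow_natCast]
  congr 1
  unfold eta
  push_cast
  ring

theorem momentumPow_insertNth (hΛ : 0 < Λ) (x : ℝ) (u : Fin k → ℝ) :
    momentumPow (k + 1) (i.insertNth ⌊Λ * x⌋ fun j => ⌊Λ * u j⌋) =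
      Λ ^ (2 * eta (k + 1)) * energy (2 * eta (k + 1)) (lattice Λ) x u := by
  have h : ∀ v : ℝ, |((⌊Λ * v⌋ : ℤ) : ℝ)| ^ (2 * eta (k + 1)) =
      Λ ^ (2 * eta (k + 1)) * |lattice Λ v| ^ (2 * eta (k + 1)) := by
    intro v
    rw [← Real.mul_rpow hΛ.le (abs_nonneg _), lattice, abs_div, abs_of_pos hΛ,
      mul_div_cancel₀ _ hΛ.ne']
  rw [momentumPow, Fin.sum_univ_succAbove _ i]
  simp only [Fin.insertNth_apply_same, Fin.insertNth_apply_succAbove, h, energy, gauge, mul_add,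
    Finset.mul_sum]

theorem belowCutoff_insertNth (hΛ : 0 < Λ) (x : ℝ) (u : Fin k → ℝ) :
    BelowCutoff (k + 1) Λ (i.insertNth ⌊Λ * x⌋ fun j => ⌊Λ * u j⌋) ↔
      energy (2 * eta (k + 1)) (lattice Λ) x u ≤ 1 := by
  rw [BelowCutoff, momentumPow_insertNth hΛ]
  exact mul_le_iff_le_one_right (Real.rpow_pos_of_pos hΛ _)

theorem kinetic_insertNth (hΛ : 0 < Λ) (hm : 0 < mbar) (x : ℝ) (u : Fin k → ℝ) :
    kinetic (k + 1) (mbar * Λ) (i.insertNth ⌊Λ * x⌋ fun j => ⌊Λ * u j⌋) =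
      Λ ^ (2 * eta (k + 1)) * (energy (2 * eta (k + 1)) (lattice Λ) x u +
        mbar ^ (2 * eta (k + 1))) := by
  rw [kinetic, momentumPow_insertNth hΛ, Real.mul_rpow hm.le hΛ.le]
  ring

variable {K : Finset (Fin (k + 1) → ℤ)}

theorem selfEnergy_insertNth (hK : ∀ q, q ∈ K ↔ BelowCutoff (k + 1) Λ q) (hΛ : 0 < Λ) (x : ℝ)
    (u : Fin k → ℝ) :
    selfEnergy (k + 1) Λ (mbar * Λ) (i.insertNth ⌊Λ * x⌋ fun j => ⌊Λ * u j⌋) =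
      PowerSeries.C (Λ ^ (2 * eta (k + 1))) *
        (scaledTau i mbar Λ x + ∑ j, scaledTau i mbar Λ (u j)) := by
  have h : ∀ v, PowerSeries.C (Λ ^ (2 * eta (k + 1))) * scaledTau i mbar Λ v =
      tau (k + 1) i Λ (mbar * Λ) ⌊Λ * v⌋ := by
    intro v
    rw [scaledTau, PowerSeries.smul_eq_C_mul, ← mul_assoc, ← map_mul,
      mul_inv_cancel₀ (Real.rpow_pos_of_pos hΛ _).ne', map_one, one_mul]
  rw [selfEnergy_eq_sum_tau hK i, Fin.sum_univ_succAbove _ i]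
  simp only [Fin.insertNth_apply_same, Fin.insertNth_apply_succAbove, mul_add, Finset.mul_sum, h]

theorem inv_C_mul {c : ℝ} (f : PowerSeries ℝ) :
    (PowerSeries.C c * f)⁻¹ = PowerSeries.C c⁻¹ * f⁻¹ := by
  rw [PowerSeries.mul_inv_rev, PowerSeries.C_inv, mul_comm]

theorem inv_sub_insertNth (hK : ∀ q, q ∈ K ↔ BelowCutoff (k + 1) Λ q) (hΛ : 0 < Λ) (hm : 0 < mbar)
    (θ : ℝ → ℝ) (x : ℝ) (u : Fin k → ℝ) :
    (PowerSeries.C (kinetic (k + 1) (mbar * Λ) (i.insertNth ⌊Λ * x⌋ fun j => ⌊Λ * u j⌋)) -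
      PowerSeries.C (θ (energy (2 * eta (k + 1)) (lattice Λ) x u)) *
        selfEnergy (k + 1) Λ (mbar * Λ) (i.insertNth ⌊Λ * x⌋ fun j => ⌊Λ * u j⌋))⁻¹ =
      PowerSeries.C (Λ ^ (2 * eta (k + 1)))⁻¹ * (dressed (2 * eta (k + 1))
        (mbar ^ (2 * eta (k + 1))) θ (lattice Λ) (scaledTau i mbar Λ) x u)⁻¹ := by
  rw [kinetic_insertNth hΛ hm, selfEnergy_insertNth hK hΛ, map_mul, mul_left_comm, ← mul_sub,
    inv_C_mul, dressed]

theorem gammaTwo_inv_insertNth (hK : ∀ q, q ∈ K ↔ BelowCutoff (k + 1) Λ q) (hΛ : 0 < Λ)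
    (hm : 0 < mbar) (x : ℝ) (u : Fin k → ℝ) :
    (gammaTwo (k + 1) Λ (mbar * Λ) (i.insertNth ⌊Λ * x⌋ fun j => ⌊Λ * u j⌋))⁻¹ =
      PowerSeries.C (Λ ^ (2 * eta (k + 1)))⁻¹ * (dressed (2 * eta (k + 1))
        (mbar ^ (2 * eta (k + 1))) (fun _ => 1) (lattice Λ) (scaledTau i mbar Λ) x u)⁻¹ := by
  rw [← inv_sub_insertNth hK hΛ hm, map_one, one_mul, gammaTwo]

variable {n r : ℕ} {R C : ℝ}

theorem one_le_two_eta (hk : 2 ≤ k) : 1 ≤ 2 * eta (k + 1) := by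
  have : (2 : ℝ) ≤ k := by exact_mod_cast hk
  unfold eta
  push_cast
  linarith

/-- Rescaling by the cutoff: the momentum volume contributes `Λ^k` and each propagator `Λ^(-2η)`.
The remaining integral depends on `Λ` only through the lattice spacing and the rescaled self energy.
-/
theorem sum_filter_gammaTwo_inv (hk : 2 ≤ k) (hK : ∀ q, q ∈ K ↔ BelowCutoff (k + 1) Λ q)
    (hΛ : 0 < Λ) (hm : 0 < mbar)
    (hprof : IsProfile n R C (lattice Λ) (scaledTau i mbar Λ)) (r : ℕ) (x : ℝ) :
    ∑ q ∈ K with q i = ⌊Λ * x⌋, PowerSeries.coeff n ((gammaTwo (k + 1) Λ (mbar * Λ) q)⁻¹ ^ r) =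
      Λ ^ k * ((Λ ^ (2 * eta (k + 1)))⁻¹ ^ r * ∫ u : Fin k → ℝ,
        loopIntegrand (2 * eta (k + 1)) (mbar ^ (2 * eta (k + 1))) cutWeight (fun _ => 1) n r
          (lattice Λ) (scaledTau i mbar Λ) x u) := by
  classical
  have hM : 0 < mbar ^ (2 * eta (k + 1)) := Real.rpow_pos_of_pos hm _
  set F : (Fin (k + 1) → ℤ) → ℝ := fun q => if q i = ⌊Λ * x⌋ ∧ BelowCutoff (k + 1) Λ q then
    PowerSeries.coeff n ((gammaTwo (k + 1) Λ (mbar * Λ) q)⁻¹ ^ r) else 0 with hF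
  have h1 : ∀ u : Fin k → ℝ, F (i.insertNth ⌊Λ * x⌋ fun j => ⌊Λ * u j⌋) =
      (Λ ^ (2 * eta (k + 1)))⁻¹ ^ r * loopIntegrand (2 * eta (k + 1)) (mbar ^ (2 * eta (k + 1)))
        cutWeight (fun _ => 1) n r (lattice Λ) (scaledTau i mbar Λ) x u := by
    intro u
    simp only [hF, Fin.insertNth_apply_same, true_and, belowCutoff_insertNth hΛ, loopIntegrand,
      cutWeight]
    split_ifs with h
    · rw [gammaTwo_inv_insertNth hK hΛ hm, mul_pow, ← map_pow, PowerSeries.coeff_C_mul, one_mul]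
    · simp
  have h2 := summable_and_tsum_eq_integral_insertNth i ⌊Λ * x⌋ F
    (fun q hq => if_neg fun h => hq h.1) hΛ (by
      simp only [h1]
      exact (integrable_loopIntegrand (one_le_two_eta hk) hM isWeight_cut hprof r x).const_mul _)
  simp only [h1, integral_const_mul] at h2
  rw [← h2.2, tsum_eq_sum (s := K), Finset.sum_filter]
  · refine Finset.sum_congr rfl fun q hq => ?_
    simp [hF, (hK q).1 hq]
  · intro q hq
    exact if_neg fun h => hq ((hK q).2 h.2)

/-- Order `n + 1` of the self energy is an integral over its orders at most `n`. All the inductions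
on the order rest on this. -/
theorem coeff_scaledTau_succ (hk : 2 ≤ k) (hΛ : 0 < Λ) (hm : 0 < mbar)
    (hprof : IsProfile n R C (lattice Λ) (scaledTau i mbar Λ)) (x : ℝ) :
    PowerSeries.coeff (n + 1) (scaledTau i mbar Λ x) = -2 * ∫ u : Fin k → ℝ,
        loopIntegrand (2 * eta (k + 1)) (mbar ^ (2 * eta (k + 1))) cutWeight (fun _ => 1) n 1
          (lattice Λ) (scaledTau i mbar Λ) x u := by
  have hK : ∀ q, q ∈ (finite_belowCutoff (d := k + 1) (by omega) hΛ.le).toFinset ↔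
      BelowCutoff (k + 1) Λ q := fun q => Set.Finite.mem_toFinset _
  have h := sum_filter_gammaTwo_inv hk hK hΛ hm hprof 1 x
  simp only [pow_one] at h
  rw [scaledTau, tau_eq_sum_inv hK (by positivity), map_smul, neg_mul, map_neg, mul_assoc,
    PowerSeries.coeff_C_mul, PowerSeries.coeff_succ_X_mul, map_sum, h, ← scale_sq hΛ]
  have := Real.rpow_pos_of_pos hΛ (2 * eta (k + 1))
  simp only [smul_eq_mul]
  field_simp

theorem constantCoeff_scaledTau (hk : 2 ≤ k) (hΛ : 0 < Λ) (hm : 0 < mbar) (x : ℝ) :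
    PowerSeries.constantCoeff (scaledTau i mbar Λ x) = 0 := by
  have hK : ∀ q, q ∈ (finite_belowCutoff (d := k + 1) (by omega) hΛ.le).toFinset ↔
      BelowCutoff (k + 1) Λ q := fun q => Set.Finite.mem_toFinset _
  rw [scaledTau, tau_eq_sum_inv hK (by positivity), PowerSeries.smul_eq_C_mul]
  simp

theorem coeff_loop (hk : 2 ≤ k) (hΛ : 0 < Λ) (hm : 0 < mbar)
    (hprof : IsProfile n R C (lattice Λ) (scaledTau i mbar Λ)) :
    PowerSeries.coeff n (loop (k + 1) i Λ (mbar * Λ)) = ∫ u : Fin k → ℝ,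
        loopIntegrand (2 * eta (k + 1)) (mbar ^ (2 * eta (k + 1))) cutWeight (fun _ => 1) n 2
          (lattice Λ) (scaledTau i mbar Λ) 0 u := by
  have hK : ∀ q, q ∈ (finite_belowCutoff (d := k + 1) (by omega) hΛ.le).toFinset ↔
      BelowCutoff (k + 1) Λ q := fun q => Set.Finite.mem_toFinset _
  have h := sum_filter_gammaTwo_inv hk hK hΛ hm hprof 2 0
  rw [mul_zero, Int.floor_zero] at h
  rw [loop_eq hK, map_sum, h, ← scale_sq hΛ]
  have := Real.rpow_pos_of_pos hΛ (2 * eta (k + 1))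
  field_simp

/-- The powers of `Λ^(2η)` are 1 from the kinetic factor, -1 from `δ` and -2 from the propagators;
the total is `Λ^(-k)`, which the momentum volume cancels. -/
theorem coeff_boundaryTerm (hk : 2 ≤ k) (hΛ : 0 < Λ) (hm : 0 < mbar) (a : ℝ) (u : Fin k → ℝ) :
    PowerSeries.coeff n (boundaryTerm (k + 1) i Λ (mbar * Λ) a
      (i.insertNth 0 fun j => ⌊Λ * u j⌋)) = (Λ ^ k)⁻¹ *
        loopIntegrand (2 * eta (k + 1)) (mbar ^ (2 * eta (k + 1)))
          (boundaryWeight (mbar ^ (2 * eta (k + 1))) a) (fun y => thetaReg a (1 - y)) n 2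
          (lattice Λ) (scaledTau i mbar Λ) 0 u := by
  have hK : ∀ q, q ∈ (finite_belowCutoff (d := k + 1) (by omega) hΛ.le).toFinset ↔
      BelowCutoff (k + 1) Λ q := fun q => Set.Finite.mem_toFinset _
  have hs := Real.rpow_pos_of_pos hΛ (2 * eta (k + 1))
  have h0 : (⌊Λ * 0⌋ : ℤ) = 0 := by simp
  have h1 := inv_sub_insertNth (i := i) hK hΛ hm (fun y => thetaReg a (1 - y)) 0 u
  have h2 := momentumPow_insertNth (i := i) hΛ 0 u
  have h3 := kinetic_insertNth (i := i) hΛ hm 0 u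
  rw [h0] at h1 h2 h3
  have h4 : Λ ^ (2 * eta (k + 1)) - Λ ^ (2 * eta (k + 1)) *
      energy (2 * eta (k + 1)) (lattice Λ) 0 u =
      Λ ^ (2 * eta (k + 1)) * (1 - energy (2 * eta (k + 1)) (lattice Λ) 0 u) := by ring
  simp only [boundaryTerm, Fin.insertNth_apply_same, if_true]
  rw [h2, h4, thetaReg_mul hs, deltaReg_mul hs, h1, h3, mul_pow, ← map_pow,
    PowerSeries.coeff_C_mul, PowerSeries.coeff_C_mul, loopIntegrand, boundaryWeight, ← scale_sq hΛ]
  field_simp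

theorem tsum_boundaryTerm (hk : 2 ≤ k) (hΛ : 0 < Λ) (hm : 0 < mbar)
    (hprof : IsProfile n R C (lattice Λ) (scaledTau i mbar Λ)) {a : ℝ} (ha : 0 < a) :
    (Summable fun q => PowerSeries.coeff n (boundaryTerm (k + 1) i Λ (mbar * Λ) a q)) ∧
    ∑' q, PowerSeries.coeff n (boundaryTerm (k + 1) i Λ (mbar * Λ) a q) = ∫ u : Fin k → ℝ,
        loopIntegrand (2 * eta (k + 1)) (mbar ^ (2 * eta (k + 1)))
          (boundaryWeight (mbar ^ (2 * eta (k + 1))) a) (fun y => thetaReg a (1 - y)) n 2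
          (lattice Λ) (scaledTau i mbar Λ) 0 u := by
  have hM : 0 < mbar ^ (2 * eta (k + 1)) := Real.rpow_pos_of_pos hm _
  have h := summable_and_tsum_eq_integral_insertNth i 0
    (fun q => PowerSeries.coeff n (boundaryTerm (k + 1) i Λ (mbar * Λ) a q))
    (fun q hq => by simp [boundaryTerm, hq]) hΛ (by
      simp only [coeff_boundaryTerm hk hΛ hm]
      exact (integrable_loopIntegrand (one_le_two_eta hk) hM (isWeight_boundary hM ha) hprof
        2 0).const_mul _)
  refine ⟨h.1, ?_⟩
  rw [h.2]
  simp only [coeff_boundaryTerm hk hΛ hm, integral_const_mul]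
  have : 0 < Λ ^ k := by positivity
  field_simp

end Scaling

/-! ### The continuum limit -/

section Continuum

variable {k n : ℕ} {i : Fin (k + 1)} {Λ mbar : ℝ}

theorem abs_sub_lattice_le (hΛ : 0 < Λ) (v : ℝ) : |v - lattice Λ v| ≤ 1 / Λ := by
  have h : v - lattice Λ v = Int.fract (Λ * v) / Λ := by
    rw [lattice, Int.fract]
    field_simp
  rw [h, abs_div, abs_of_nonneg (Int.fract_nonneg _), abs_of_pos hΛ]
  exact div_le_div_of_nonneg_right (Int.fract_lt_one _).le hΛ.le

theorem tendsto_lattice (v : ℝ) : Tendsto (fun Λ => lattice Λ v) atTop (𝓝 v) := by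
  have h : Tendsto (fun Λ => v - lattice Λ v) atTop (𝓝 0) := by
    refine squeeze_zero_norm' ?_ (tendsto_const_nhds.div_atTop tendsto_id (a := (1 : ℝ)))
    filter_upwards [eventually_gt_atTop 0] with Λ hΛ
    exact abs_sub_lattice_le hΛ v
  simpa using (tendsto_const_nhds (x := v)).sub h

theorem isProfile_scaledTau (hk : 2 ≤ k) (hm : 0 < mbar) {Λ₀ C : ℝ} (hΛ₀ : 0 < Λ₀)
    (hΛ : Λ₀ ≤ Λ) (hC : ∀ m ≤ n, ∀ v, |PowerSeries.coeff m (scaledTau i mbar Λ v)| ≤ C) :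
    IsProfile n (1 / Λ₀) C (lattice Λ) (scaledTau i mbar Λ) := by
  have hΛ' := hΛ₀.trans_le hΛ
  refine ⟨?_, fun v => ?_, constantCoeff_scaledTau hk hΛ' hm, fun m _ => ?_, hC⟩
  · have h : Measurable fun s : ℤ => (s : ℝ) / Λ := measurable_of_countable _
    exact h.comp (Int.measurable_floor.comp (measurable_const_mul Λ))
  · have h1 := abs_sub_lattice_le hΛ' v
    have h2 := abs_sub_abs_le_abs_sub v (lattice Λ v)
    have h3 := one_div_le_one_div_of_le hΛ₀ hΛ
    linarith
  · exact (measurable_of_countable fun s : ℤ => PowerSeries.coeff m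
      ((Λ ^ (2 * eta (k + 1)))⁻¹ • tau (k + 1) i Λ (mbar * Λ) s)).comp
      (Int.measurable_floor.comp (measurable_const_mul Λ))

/-- The self energy is bounded in units of the cutoff, uniformly in the cutoff. -/
theorem exists_isProfile (hk : 2 ≤ k) (hm : 0 < mbar) (i : Fin (k + 1)) {Λ₀ : ℝ} (hΛ₀ : 0 < Λ₀)
    (n : ℕ) : ∃ C, ∀ Λ, Λ₀ ≤ Λ → IsProfile n (1 / Λ₀) C (lattice Λ) (scaledTau i mbar Λ) := by
  have hM : 0 < mbar ^ (2 * eta (k + 1)) := Real.rpow_pos_of_pos hm _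
  induction n with
  | zero =>
    refine ⟨0, fun Λ hΛ => isProfile_scaledTau hk hm hΛ₀ hΛ fun m hm' v => ?_⟩
    rw [Nat.le_zero.1 hm', PowerSeries.coeff_zero_eq_constantCoeff_apply,
      constantCoeff_scaledTau hk (hΛ₀.trans_le hΛ) hm, abs_zero]
  | succ n ih =>
    obtain ⟨C, hC⟩ := ih
    obtain ⟨D, hD, h⟩ := exists_bound_integral_loopIntegrand (one_le_two_eta hk) hM k n 1
      (1 / Λ₀) C (Real.exp 1)
    refine ⟨max C (2 * D), fun Λ hΛ => isProfile_scaledTau hk hm hΛ₀ hΛ fun m hm' v => ?_⟩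
    rcases Nat.le_succ_iff.1 hm' with h1 | rfl
    · exact ((hC Λ hΛ).bound m h1 v).trans (le_max_left _ _)
    · rw [coeff_scaledTau_succ hk (hΛ₀.trans_le hΛ) hm (hC Λ hΛ), abs_mul, abs_neg, abs_two]
      exact (mul_le_mul_of_nonneg_left (h _ _ _ _ isWeight_cut (hC Λ hΛ) v) zero_le_two).trans
        (le_max_right _ _)

/-- The continuum limit of the one-colour self energy. -/
noncomputable def tauLim (i : Fin (k + 1)) (mbar v : ℝ) : PowerSeries ℝ :=
  PowerSeries.mk fun n => limUnder atTop fun Λ => PowerSeries.coeff n (scaledTau i mbar Λ v)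

theorem coeff_tauLim {v l : ℝ}
    (h : Tendsto (fun Λ => PowerSeries.coeff n (scaledTau i mbar Λ v)) atTop (𝓝 l)) :
    PowerSeries.coeff n (tauLim i mbar v) = l := by
  rw [tauLim, PowerSeries.coeff_mk, h.limUnder_eq]

theorem isProfile_tauLim (hm : 0 < mbar) (hk : 2 ≤ k) {R : ℝ} (hR : 0 ≤ R)
    (h : ∀ m ≤ n, (Continuous fun v => PowerSeries.coeff m (tauLim i mbar v)) ∧
      ∀ v, Tendsto (fun Λ => PowerSeries.coeff m (scaledTau i mbar Λ v)) atTop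
        (𝓝 (PowerSeries.coeff m (tauLim i mbar v)))) :
    ∃ C, IsProfile n R C id (tauLim i mbar) := by
  obtain ⟨C, hC⟩ := exists_isProfile hk hm i one_pos n
  refine ⟨C, measurable_id, fun v => by simpa using hR, fun v => ?_,
    fun m hm' => (h m hm').1.measurable, fun m hm' v => ?_⟩
  · rw [← PowerSeries.coeff_zero_eq_constantCoeff_apply]
    refine coeff_tauLim (tendsto_const_nhds.congr' ?_)
    filter_upwards [eventually_gt_atTop 0] with Λ hΛ
    rw [PowerSeries.coeff_zero_eq_constantCoeff_apply, constantCoeff_scaledTau hk hΛ hm]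
  · refine le_of_tendsto ((h m hm').2 v).abs ?_
    filter_upwards [eventually_ge_atTop 1] with Λ hΛ
    exact (hC Λ hΛ).bound m hm' v

/-- The lower orders converge pointwise and are uniformly bounded, so dominated convergence passes
the recursion for order `n + 1` to the limit. Applied to the limiting recursion with a moving
external momentum, the same argument gives continuity. -/
theorem continuous_and_tendsto_tauLim (hk : 2 ≤ k) (hm : 0 < mbar) (i : Fin (k + 1)) (n : ℕ) :
    (Continuous fun v => PowerSeries.coeff n (tauLim i mbar v)) ∧
      (∀ v, Tendsto (fun Λ => PowerSeries.coeff n (scaledTau i mbar Λ v)) atTop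
        (𝓝 (PowerSeries.coeff n (tauLim i mbar v)))) ∧
      ∀ m, n = m + 1 → ∀ v, PowerSeries.coeff n (tauLim i mbar v) = -2 * ∫ u : Fin k → ℝ,
        loopIntegrand (2 * eta (k + 1)) (mbar ^ (2 * eta (k + 1))) cutWeight (fun _ => 1) m 1
          id (tauLim i mbar) v u := by
  have hM : 0 < mbar ^ (2 * eta (k + 1)) := Real.rpow_pos_of_pos hm _
  have : NeZero k := ⟨by omega⟩
  induction n using Nat.strong_induction_on with
  | _ n ih =>
    cases n with
    | zero =>
      have h : ∀ v, Tendsto (fun Λ => PowerSeries.coeff 0 (scaledTau i mbar Λ v)) atTop (𝓝 0) := by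
        intro v
        refine tendsto_const_nhds.congr' ?_
        filter_upwards [eventually_gt_atTop 0] with Λ hΛ
        rw [PowerSeries.coeff_zero_eq_constantCoeff_apply, constantCoeff_scaledTau hk hΛ hm]
      simp only [fun v => coeff_tauLim (h v)]
      exact ⟨continuous_const, h, by simp⟩
    | succ n =>
      have hih : ∀ m ≤ n, (Continuous fun v => PowerSeries.coeff m (tauLim i mbar v)) ∧
          ∀ v, Tendsto (fun Λ => PowerSeries.coeff m (scaledTau i mbar Λ v)) atTop
            (𝓝 (PowerSeries.coeff m (tauLim i mbar v))) := fun m hm' =>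
        ⟨(ih m (by omega)).1, (ih m (by omega)).2.1⟩
      obtain ⟨C, hC⟩ := exists_isProfile hk hm i one_pos n
      obtain ⟨C', hC'⟩ := isProfile_tauLim hm hk zero_le_one hih
      have h : ∀ v, Tendsto (fun Λ => PowerSeries.coeff (n + 1) (scaledTau i mbar Λ v)) atTop
          (𝓝 (-2 * ∫ u : Fin k → ℝ, loopIntegrand (2 * eta (k + 1)) (mbar ^ (2 * eta (k + 1)))
            cutWeight (fun _ => 1) n 1 id (tauLim i mbar) v u)) := by
        intro v
        refine Tendsto.congr' (f₁ := fun Λ => -2 * ∫ u : Fin k → ℝ,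
          loopIntegrand (2 * eta (k + 1)) (mbar ^ (2 * eta (k + 1))) cutWeight (fun _ => 1) n 1
            (lattice Λ) (scaledTau i mbar Λ) v u) ?_ (Tendsto.const_mul _ ?_)
        · filter_upwards [eventually_ge_atTop 1] with Λ hΛ
          exact (coeff_scaledTau_succ hk (by linarith) hm (hC Λ hΛ) v).symm
        · exact tendsto_integral_loopIntegrand (one_le_two_eta hk) hM isWeight_cut hC'.const rfl
            (eventually_atTop.2 ⟨1, hC⟩) (tendsto_lattice v) tendsto_lattice
            (fun m hm' => (hih m hm').2 v) (fun m hm' v => (hih m hm').2 v) 1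
      simp only [fun v => coeff_tauLim (h v)]
      refine ⟨continuous_const.mul (continuous_iff_continuousAt.2 fun v => ?_), h, ?_⟩
      · exact tendsto_integral_loopIntegrand (F := fun _ => id) (S := fun _ => tauLim i mbar)
          (one_le_two_eta hk) hM isWeight_cut hC'.const rfl (Eventually.of_forall fun _ => hC')
          tendsto_id (fun v => tendsto_const_nhds) (fun m hm' => (hih m hm').1.tendsto v)
          (fun m hm' v => tendsto_const_nhds) 1
      · rintro m hm' v
        obtain rfl : n = m := by omega
        rfl

theorem exists_isProfile_tauLim (hk : 2 ≤ k) (hm : 0 < mbar) (i : Fin (k + 1)) (n : ℕ) {R : ℝ}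
    (hR : 0 ≤ R) : ∃ C, IsProfile n R C id (tauLim i mbar) :=
  isProfile_tauLim hm hk hR fun m _ => ⟨(continuous_and_tendsto_tauLim hk hm i m).1,
    (continuous_and_tendsto_tauLim hk hm i m).2.1⟩

/-- The continuum limit of the loop integrals, at vanishing external momentum. -/
theorem tendsto_integral_scaledTau (hk : 2 ≤ k) (hm : 0 < mbar) (i : Fin (k + 1)) {B : ℝ}
    {W θ : ℝ → ℝ} (hW : IsWeight B W θ) (n r : ℕ) :
    Tendsto (fun Λ => ∫ u : Fin k → ℝ, loopIntegrand (2 * eta (k + 1))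
      (mbar ^ (2 * eta (k + 1))) W θ n r (lattice Λ) (scaledTau i mbar Λ) 0 u) atTop
      (𝓝 (∫ u : Fin k → ℝ, loopIntegrand (2 * eta (k + 1)) (mbar ^ (2 * eta (k + 1))) W θ n r id
        (tauLim i mbar) 0 u)) := by
  have hM : 0 < mbar ^ (2 * eta (k + 1)) := Real.rpow_pos_of_pos hm _
  have : NeZero k := ⟨by omega⟩
  obtain ⟨C, hC⟩ := exists_isProfile hk hm i one_pos n
  obtain ⟨C', hC'⟩ := exists_isProfile_tauLim hk hm i n zero_le_one
  exact tendsto_integral_loopIntegrand (one_le_two_eta hk) hM hW hC'.const rfl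
    (eventually_atTop.2 ⟨1, hC⟩) (tendsto_lattice 0) tendsto_lattice
    (fun m _ => (continuous_and_tendsto_tauLim hk hm i m).2.1 0)
    (fun m _ => (continuous_and_tendsto_tauLim hk hm i m).2.1) r

/-- The continuum limit of the loop. -/
noncomputable def loopLim (i : Fin (k + 1)) (mbar : ℝ) : PowerSeries ℝ :=
  PowerSeries.mk fun n => ∫ u : Fin k → ℝ, loopIntegrand (2 * eta (k + 1))
    (mbar ^ (2 * eta (k + 1))) cutWeight (fun _ => 1) n 2 id (tauLim i mbar) 0 u

theorem tendsto_loop (hk : 2 ≤ k) (hm : 0 < mbar) (i : Fin (k + 1)) :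
    TendstoCoeff (fun Λ => loop (k + 1) i Λ (mbar * Λ)) atTop (loopLim i mbar) := by
  intro n
  rw [loopLim, PowerSeries.coeff_mk]
  refine (tendsto_integral_scaledTau hk hm i isWeight_cut n 2).congr' ?_
  obtain ⟨C, hC⟩ := exists_isProfile hk hm i one_pos n
  filter_upwards [eventually_ge_atTop 1] with Λ hΛ
  exact (coeff_loop hk (by linarith) hm (hC Λ hΛ)).symm

/-- The continuum limit of the boundary sum. -/
noncomputable def boundaryLim (i : Fin (k + 1)) (mbar a : ℝ) : PowerSeries ℝ :=
  PowerSeries.mk fun n => ∫ u : Fin k → ℝ, loopIntegrand (2 * eta (k + 1))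
    (mbar ^ (2 * eta (k + 1))) (boundaryWeight (mbar ^ (2 * eta (k + 1))) a)
    (fun y => thetaReg a (1 - y)) n 2 id (tauLim i mbar) 0 u

theorem summable_boundaryTerm (hk : 2 ≤ k) (hm : 0 < mbar) (i : Fin (k + 1)) {a : ℝ} (ha : 0 < a)
    (hΛ : 0 < Λ) (n : ℕ) :
    Summable fun q => PowerSeries.coeff n (boundaryTerm (k + 1) i Λ (mbar * Λ) a q) := by
  obtain ⟨C, hC⟩ := exists_isProfile hk hm i hΛ n
  exact (tsum_boundaryTerm hk hΛ hm (hC Λ le_rfl) ha).1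

theorem tendsto_boundary (hk : 2 ≤ k) (hm : 0 < mbar) (i : Fin (k + 1)) {a : ℝ} (ha : 0 < a) :
    TendstoCoeff (fun Λ => PowerSeries.mk fun n => ∑' q,
      PowerSeries.coeff n (boundaryTerm (k + 1) i Λ (mbar * Λ) a q)) atTop
      (boundaryLim i mbar a) := by
  intro n
  have hM : 0 < mbar ^ (2 * eta (k + 1)) := Real.rpow_pos_of_pos hm _
  simp only [boundaryLim, PowerSeries.coeff_mk]
  refine (tendsto_integral_scaledTau hk hm i (isWeight_boundary hM ha) n 2).congr' ?_
  obtain ⟨C, hC⟩ := exists_isProfile hk hm i one_pos n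
  filter_upwards [eventually_ge_atTop 1] with Λ hΛ
  exact (tsum_boundaryTerm hk (by linarith) hm (hC Λ hΛ) ha).2.symm

/-- At each cutoff the four-point function is the same rational function of the loop, so its limit
follows from that of the loop. -/
theorem tendsto_gammaFour (hk : 2 ≤ k) (hm : 0 < mbar) (i : Fin (k + 1)) :
    TendstoCoeff (fun Λ => gammaFour (k + 1) i Λ (mbar * Λ)) atTop
      (PowerSeries.C 4 * PowerSeries.X *
        (1 + PowerSeries.C 2 * PowerSeries.X * loopLim i mbar)⁻¹) := by
  have hc : ∀ L : PowerSeries ℝ, PowerSeries.constantCoeff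
      (1 + PowerSeries.C 2 * PowerSeries.X * L) ≠ 0 := by simp
  have h1 : ∀ Λ, 0 < Λ → gammaFour (k + 1) i Λ (mbar * Λ) = PowerSeries.C 4 * PowerSeries.X *
      (1 + PowerSeries.C 2 * PowerSeries.X * loop (k + 1) i Λ (mbar * Λ))⁻¹ := by
    intro Λ hΛ
    rw [PowerSeries.eq_mul_inv_iff_mul_eq (hc _)]
    exact gammaFour_mul (K := (finite_belowCutoff (d := k + 1) (by omega) hΛ.le).toFinset)
      (fun q => Set.Finite.mem_toFinset _)
      ((Set.Finite.mem_toFinset _).2 (belowCutoff_zero (by omega) hΛ.le)) (by positivity) i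
  intro n
  cases n with
  | zero =>
    refine tendsto_const_nhds.congr' ?_
    filter_upwards [eventually_gt_atTop 0] with Λ hΛ
    rw [h1 Λ hΛ]
    simp
  | succ n =>
    have h2 : Tendsto (fun Λ => PowerSeries.coeff n ((1 + PowerSeries.C 2 * PowerSeries.X *
        loop (k + 1) i Λ (mbar * Λ))⁻¹ ^ 1)) atTop (𝓝 (PowerSeries.coeff n
        ((1 + PowerSeries.C 2 * PowerSeries.X * loopLim i mbar)⁻¹ ^ 1))) := by
      refine tendsto_coeff_inv_pow (hc _) (fun j _ => ?_) 1
      simp only [map_add, mul_assoc, PowerSeries.coeff_C_mul]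
      refine tendsto_const_nhds.add (tendsto_const_nhds.mul ?_)
      cases j with
      | zero => simp
      | succ j =>
        simp only [PowerSeries.coeff_succ_X_mul]
        exact tendsto_loop hk hm i j
    rw [pow_one] at h2
    rw [mul_assoc, PowerSeries.coeff_C_mul, PowerSeries.coeff_succ_X_mul]
    refine (h2.const_mul 4).congr' ?_
    filter_upwards [eventually_gt_atTop 0] with Λ hΛ
    rw [h1 Λ hΛ, mul_assoc (PowerSeries.C (4 : ℝ)), PowerSeries.coeff_C_mul,
      PowerSeries.coeff_succ_X_mul, pow_one]

end Continuum

/-! ### Polar coordinates -/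

section Polar

/-- Integration in polar coordinates. -/
theorem integral_polar {E : Type*} [NormedAddCommGroup E] [NormedSpace ℝ E] [MeasurableSpace E]
    [BorelSpace E] [FiniteDimensional ℝ E] [Nontrivial E] (μ : Measure E) [μ.IsAddHaarMeasure]
    {h : E → ℝ} (hh : Integrable h μ) :
    ∫ z, h z ∂μ = ∫ r in Set.Ioi (0 : ℝ), r ^ (Module.finrank ℝ E - 1) *
      ∫ ω : Metric.sphere (0 : E) 1, h (r • (ω : E)) ∂μ.toSphere := by
  have hemb := (homeomorphUnitSphereProd E).measurableEmbedding
  have hmp := μ.measurePreserving_homeomorphUnitSphereProd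
  set g : Metric.sphere (0 : E) 1 × Set.Ioi (0 : ℝ) → ℝ := fun x => h ((x.2 : ℝ) • (x.1 : E))
    with hg
  have hgh : ∀ z : ({0}ᶜ : Set E), g (homeomorphUnitSphereProd E z) = h z := by
    intro z
    simp only [hg]
    rw [← homeomorphUnitSphereProd_symm_apply_coe, Homeomorph.symm_apply_apply]
  have h1 : ∫ z, h z ∂μ = ∫ x, g x ∂μ.toSphere.prod (.volumeIoiPow (Module.finrank ℝ E - 1)) := by
    rw [← hmp.integral_comp hemb]
    simp only [hgh]
    rw [integral_subtype_comap (measurableSet_singleton _).compl, restrict_compl_singleton]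
  have h2 : Integrable g (μ.toSphere.prod (.volumeIoiPow (Module.finrank ℝ E - 1))) := by
    rw [← hmp.integrable_comp_emb hemb]
    have : g ∘ homeomorphUnitSphereProd E = h ∘ ((↑) : ({0}ᶜ : Set E) → E) := funext hgh
    rw [this, ← integrableOn_iff_comap_subtypeVal (measurableSet_singleton _).compl]
    exact hh.integrableOn
  rw [h1, integral_prod_symm g h2]
  simp only [Measure.volumeIoiPow, ENNReal.ofReal]
  rw [integral_withDensity_eq_integral_smul
      (measurable_subtype_coe.pow_const _).real_toNNReal,
    integral_subtype_comap measurableSet_Ioi fun a : ℝ =>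
      Real.toNNReal (a ^ (Module.finrank ℝ E - 1)) •
        ∫ ω : Metric.sphere (0 : E) 1, h (a • (ω : E)) ∂μ.toSphere]
  refine setIntegral_congr_fun measurableSet_Ioi fun r hr => ?_
  simp only [NNReal.smul_def, Real.coe_toNNReal _ (pow_nonneg (le_of_lt hr) _), smul_eq_mul]

variable {k : ℕ} {p : ℝ}

/-- The density of a bounded continuous function with respect to the gauge, for `k = 2p`. -/
theorem exists_radial_density (hp : 1 ≤ p) (hkp : (k : ℝ) = 2 * p) {φ : (Fin k → ℝ) → ℝ}
    (hφ : Continuous φ) {C : ℝ} (hC : ∀ u, |φ u| ≤ C) :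
    ∃ A : ℝ → ℝ, Continuous A ∧ (∃ C', ∀ y, |A y| ≤ C') ∧
      ∀ ψ : ℝ → ℝ, (Integrable fun u => φ u * ψ (gauge p u)) →
        ∫ u, φ u * ψ (gauge p u) = ∫ y in Set.Ioi (0 : ℝ), ψ y * (y * A y) := by
  have hp0 : 0 < p := by linarith
  have hk : 0 < k := by
    have : (0 : ℝ) < k := by linarith
    exact_mod_cast this
  have : Nonempty (Fin k) := ⟨⟨0, hk⟩⟩
  have : Fact (1 ≤ ENNReal.ofReal p) := ⟨by simpa using hp⟩
  have hpr : (ENNReal.ofReal p).toReal = p := ENNReal.toReal_ofReal hp0.le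
  -- In the `ℓ^p` norm the gauge is the `p`-th power of the radius, and Lebesgue measure is
  -- transported to this space.
  let E := PiLp (ENNReal.ofReal p) fun _ : Fin k => ℝ
  let e : (Fin k → ℝ) ≃L[ℝ] E := (PiLp.continuousLinearEquiv (ENNReal.ofReal p) ℝ fun _ => ℝ).symm
  let μ : Measure E := Measure.map e volume
  have hμ : μ.IsAddHaarMeasure := e.isAddHaarMeasure_map volume
  have hemb : MeasurableEmbedding e := e.toHomeomorph.measurableEmbedding
  have hmp : MeasurePreserving e volume μ := ⟨hemb.measurable, rfl⟩
  have hnorm : ∀ z : E, gauge p (e.symm z) = ‖z‖ ^ p := by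
    intro z
    have h1 := PiLp.norm_eq_sum (p := ENNReal.ofReal p) (by rw [hpr]; exact hp0) z
    rw [hpr] at h1
    rw [h1, ← Real.rpow_mul (Finset.sum_nonneg fun _ _ => Real.rpow_nonneg (norm_nonneg _) _),
      one_div_mul_cancel hp0.ne', Real.rpow_one]
    rfl
  have hfin : Module.finrank ℝ E = k := by
    rw [← e.toLinearEquiv.finrank_eq]
    simp
  have hnt : Nontrivial E := Module.nontrivial_of_finrank_pos (R := ℝ) (by rw [hfin]; exact hk)
  set A₀ : ℝ → ℝ := fun r => ∫ ω : Metric.sphere (0 : E) 1, φ (e.symm (r • (ω : E))) ∂μ.toSphere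
    with hA₀
  have hA₀c : Continuous A₀ := by
    refine continuous_of_dominated (bound := fun _ => C) (fun r => ?_)
      (fun r => Eventually.of_forall fun ω => hC _) (integrable_const C)
      (Eventually.of_forall fun ω => ?_)
    · exact (hφ.comp (e.symm.continuous.comp
        (continuous_subtype_val.const_smul r))).aestronglyMeasurable
    · exact hφ.comp (e.symm.continuous.comp (continuous_id.smul continuous_const))
  have hA₀b : ∀ r, |A₀ r| ≤ ∫ _ : Metric.sphere (0 : E) 1, C ∂μ.toSphere := by
    intro r
    rw [← Real.norm_eq_abs]
    exact norm_integral_le_of_norm_le (integrable_const C) (Eventually.of_forall fun ω => hC _)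
  refine ⟨fun y => A₀ (y ^ (1 / p)) / p, ?_, ⟨(∫ _ : Metric.sphere (0 : E) 1, C ∂μ.toSphere) / p,
    fun y => ?_⟩, fun ψ hψ => ?_⟩
  · exact (hA₀c.comp (continuous_id.rpow_const fun _ => Or.inr (by positivity))).div_const _
  · rw [abs_div, abs_of_pos hp0]
    exact div_le_div_of_nonneg_right (hA₀b _) hp0.le
  · set h : E → ℝ := fun z => φ (e.symm z) * ψ (gauge p (e.symm z)) with hh
    have h1 : (fun u => φ u * ψ (gauge p u)) = h ∘ e := by
      funext u
      simp [hh]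
    rw [h1, hmp.integrable_comp_emb hemb] at hψ
    have h2 : ∫ u, φ u * ψ (gauge p u) = ∫ z, h z ∂μ := by
      rw [← hmp.integral_comp hemb, h1]
      rfl
    rw [h2, integral_polar μ hψ, hfin, ← integral_comp_rpow_Ioi_of_pos
      (g := fun y => ψ y * (y * (A₀ (y ^ (1 / p)) / p))) hp0]
    refine setIntegral_congr_fun measurableSet_Ioi fun r hr => ?_
    rw [Set.mem_Ioi] at hr
    have h3 : ∀ ω : Metric.sphere (0 : E) 1, h (r • (ω : E)) =
        φ (e.symm (r • (ω : E))) * ψ (r ^ p) := by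
      intro ω
      simp only [hh, hnorm]
      rw [norm_smul, norm_eq_of_mem_sphere, mul_one, Real.norm_eq_abs, abs_of_pos hr]
    -- Because `k = 2p`, the radial measure `r^(k-1) dr` becomes `y dy / p` in the variable `y =
    -- r^p`.
    have h4 : r ^ (k - 1) = r ^ (p - 1) * r ^ p := by
      rw [← Real.rpow_add hr, ← Real.rpow_natCast, Nat.cast_sub hk, hkp]
      congr 1
      push_cast
      ring
    have h5 : (r ^ p) ^ (1 / p) = r := by
      rw [← Real.rpow_mul hr.le, mul_one_div_cancel hp0.ne', Real.rpow_one]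
    simp only [h3, integral_mul_const, h4, h5, smul_eq_mul]
    rw [hA₀]
    field_simp

end Polar

/-! ### The boundary of the cutoff -/

section Boundary

variable {k : ℕ} {p : ℝ}

theorem exp_neg_gauge_le (hp : 1 ≤ p) (u : Fin k → ℝ) :
    Real.exp (-gauge p u) ≤ Real.exp k * Real.exp (-∑ j, |u j|) := by
  rw [← Real.exp_add, Real.exp_le_exp]
  have h1 : ∑ j, (|u j| - 1) ≤ gauge p u :=
    Finset.sum_le_sum fun j _ => sub_one_le_rpow hp (abs_nonneg (u j))
  rw [Finset.sum_sub_distrib, Finset.sum_const, Finset.card_univ, Fintype.card_fin, nsmul_one] at h1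
  linarith

theorem integrable_mul_gauge (hp : 1 ≤ p) {φ : (Fin k → ℝ) → ℝ} (hφ : Continuous φ) {C : ℝ}
    (hC : ∀ u, |φ u| ≤ C) {ψ : ℝ → ℝ} (hψ : Measurable ψ) {B : ℝ}
    (hB : ∀ y, 0 ≤ y → |ψ y| ≤ B * Real.exp (-y)) :
    Integrable fun u => φ u * ψ (gauge p u) := by
  have hB0 : 0 ≤ B := by simpa using (abs_nonneg _).trans (hB 0 le_rfl)
  have hC0 : 0 ≤ C := (abs_nonneg _).trans (hC 0)
  refine (integrable_exp_neg_sum_abs.const_mul (C * B * Real.exp k)).mono' (hφ.measurable.mul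
    (hψ.comp (continuous_gauge (by linarith)).measurable)).aestronglyMeasurable
    (Eventually.of_forall fun u => ?_)
  rw [Real.norm_eq_abs, abs_mul]
  calc _ ≤ C * (B * (Real.exp k * Real.exp (-∑ j, |u j|))) :=
        mul_le_mul (hC u) ((hB _ (gauge_nonneg u)).trans
          (mul_le_mul_of_nonneg_left (exp_neg_gauge_le hp u) hB0)) (abs_nonneg _) hC0
    _ = _ := by ring

theorem measurable_cutWeight : Measurable cutWeight := isWeight_cut.measurable_W

theorem abs_cutWeight_sub_le {s y : ℝ} (hs : 0 ≤ s) (hy : 0 ≤ y) :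
    |cutWeight y - cutWeight (s + y)| ≤ Real.exp 1 * Real.exp (-y) := by
  refine le_trans ?_ (isWeight_cut.abs_W_le y hy)
  unfold cutWeight
  split_ifs with h1 h2 <;> first | linarith | simp

/-- The difference of cutoffs is the indicator of `(1 - s, 1]`, so the quotient is the left
difference quotient at 1 of the primitive of `y A(y)`. -/
theorem tendsto_layer {A : ℝ → ℝ} (hA : Continuous A) :
    Tendsto (fun s => s⁻¹ * ∫ y in Set.Ioi (0 : ℝ), (cutWeight y - cutWeight (s + y)) * (y * A y))
      (𝓝[>] 0) (𝓝 (A 1)) := by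
  have hc : Continuous fun y => y * A y := continuous_id.mul hA
  have h1 : HasDerivAt (fun t => ∫ y in (0 : ℝ)..t, y * A y) (1 * A 1) 1 :=
    (hc.integral_hasStrictDerivAt 0 1).hasDerivAt
  have h2 : Tendsto (fun s : ℝ => -s) (𝓝[>] 0) (𝓝[≠] 0) := by
    refine tendsto_nhdsWithin_iff.2 ⟨?_, ?_⟩
    · have : Tendsto (fun s : ℝ => -s) (𝓝 0) (𝓝 0) := by
        simpa using (continuous_neg (G := ℝ)).tendsto 0
      exact this.mono_left nhdsWithin_le_nhds
    · filter_upwards [self_mem_nhdsWithin] with s hs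
      exact neg_ne_zero.2 (ne_of_gt hs)
  have h3 := h1.tendsto_slope_zero.comp h2
  rw [one_mul] at h3
  refine h3.congr' ?_
  filter_upwards [Ioo_mem_nhdsGT (one_pos (α := ℝ))] with s hs
  have h4 : ∫ y in Set.Ioi (0 : ℝ), (cutWeight y - cutWeight (s + y)) * (y * A y) =
      ∫ y in Set.Ioc (1 - s) 1, y * A y := by
    rw [← integral_indicator measurableSet_Ioi, ← integral_indicator measurableSet_Ioc]
    congr 1
    funext y
    unfold cutWeight
    by_cases h1 : y ≤ 1
    · by_cases h2 : 1 - s < y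
      · have h0 : 0 < y := by linarith [hs.2]
        rw [Set.indicator_of_mem (show y ∈ Set.Ioi (0 : ℝ) from h0),
          Set.indicator_of_mem (show y ∈ Set.Ioc (1 - s) 1 from ⟨h2, h1⟩), if_pos h1,
          if_neg (by linarith)]
        ring
      · rw [Set.indicator_of_notMem (show y ∉ Set.Ioc (1 - s) 1 from fun h => h2 h.1)]
        refine Set.indicator_apply_eq_zero.2 fun _ => ?_
        rw [if_pos h1, if_pos (by linarith), sub_self, zero_mul]
    · rw [Set.indicator_of_notMem (show y ∉ Set.Ioc (1 - s) 1 from fun h => h1 h.2)]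
      refine Set.indicator_apply_eq_zero.2 fun _ => ?_
      rw [if_neg h1, if_neg (by linarith [hs.1]), sub_self, zero_mul]
  have h5 := intervalIntegral.integral_add_adjacent_intervals (hc.intervalIntegrable 0 (1 - s))
    (hc.intervalIntegrable (μ := volume) (1 - s) 1)
  rw [h4, ← intervalIntegral.integral_of_le (by linarith [hs.1])]
  simp only [Function.comp_apply, smul_eq_mul, ← sub_eq_add_neg]
  rw [← h5, inv_neg]
  ring

/-- The substitution `1 - y = a v` turns `θ^j δ` into a fixed density of mass `1/(j + 1)`, while the
other factor concentrates at `y = 1`. -/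
theorem tendsto_smoothLayer {A : ℝ → ℝ} (hA : Continuous A) {C : ℝ} (hC : ∀ y, |A y| ≤ C) (j : ℕ) :
    Tendsto (fun a => ∫ y in Set.Ioi (0 : ℝ),
      (thetaReg a (1 - y) ^ j * deltaReg a (1 - y)) * (y * A y)) (𝓝[>] 0) (𝓝 (A 1 / (j + 1))) := by
  have hC0 : 0 ≤ C := (abs_nonneg _).trans (hC 0)
  have h1 : ∀ a, 0 < a → ∫ y in Set.Ioi (0 : ℝ),
      (thetaReg a (1 - y) ^ j * deltaReg a (1 - y)) * (y * A y) =
      ∫ v, (thetaReg 1 v ^ j * deltaReg 1 v) * (max (1 - a * v) 0 * A (1 - a * v)) := by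
    intro a ha
    -- Replacing `y` by `max y 0` extends the integral to the whole line and keeps the integrand
    -- continuous.
    set G : ℝ → ℝ := fun y => (thetaReg a (1 - y) ^ j * deltaReg a (1 - y)) * (max y 0 * A y)
    have h2 : ∫ y in Set.Ioi (0 : ℝ), (thetaReg a (1 - y) ^ j * deltaReg a (1 - y)) * (y * A y) =
        ∫ y, G y := by
      rw [← setIntegral_eq_integral_of_forall_compl_eq_zero (s := Set.Ioi (0 : ℝ)) (f := G)]
      · refine setIntegral_congr_fun measurableSet_Ioi fun y hy => ?_
        simp only [G]
        rw [max_eq_left (le_of_lt hy)]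
      · intro y hy
        simp only [G]
        rw [max_eq_right (not_lt.1 hy)]
        ring
    have h3 := Measure.integral_comp_mul_left (fun z => G (1 - z)) a
    rw [integral_sub_left_eq_self G volume 1, abs_of_pos (inv_pos.2 ha), smul_eq_mul] at h3
    have h4 : ∀ v, G (1 - a * v) =
        a⁻¹ * ((thetaReg 1 v ^ j * deltaReg 1 v) * (max (1 - a * v) 0 * A (1 - a * v))) := by
      intro v
      have h5 := thetaReg_mul (a := 1) ha v
      have h6 := deltaReg_mul (a := 1) ha v
      rw [one_mul] at h5 h6
      simp only [G]
      rw [sub_sub_cancel, h5, h6]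
      ring
    simp only [h4] at h3
    rw [integral_const_mul] at h3
    rw [h2, mul_left_cancel₀ (inv_pos.2 ha).ne' h3]
  have h2 : ∫ v, (thetaReg 1 v ^ j * deltaReg 1 v) * (max 1 0 * A 1) = A 1 / (j + 1) := by
    rw [integral_mul_const, integral_thetaReg_pow_mul_deltaReg one_pos, max_eq_left zero_le_one]
    ring
  rw [← h2]
  refine Tendsto.congr' (f₁ := fun a => ∫ v, (thetaReg 1 v ^ j * deltaReg 1 v) *
    (max (1 - a * v) 0 * A (1 - a * v))) ?_ ?_
  · filter_upwards [self_mem_nhdsWithin] with a ha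
    exact (h1 a ha).symm
  · have hmax : Continuous fun y => max y 0 * A y := (continuous_id.max continuous_const).mul hA
    refine tendsto_integral_filter_of_dominated_convergence
      (fun v => Real.exp (1 ^ 2) / (1 * √Real.pi) * C * Real.exp (-|v|)) ?_ ?_
      (integrable_exp_neg_abs.const_mul _) ?_
    · refine Eventually.of_forall fun a => Continuous.aestronglyMeasurable ?_
      exact (((continuous_thetaReg one_pos).pow j).mul (continuous_deltaReg 1)).mul
        (hmax.comp (by fun_prop))
    · filter_upwards [Ioo_mem_nhdsGT (one_pos (α := ℝ))] with a ha
      refine Eventually.of_forall fun v => ?_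
      have h3 : |thetaReg 1 v ^ j * deltaReg 1 v| ≤
          Real.exp (1 ^ 2) / (1 * √Real.pi) * Real.exp (-2 * |v|) := by
        rw [abs_mul, abs_pow, abs_of_nonneg (thetaReg_nonneg one_pos v),
          abs_of_nonneg (deltaReg_nonneg one_pos v)]
        exact (mul_le_of_le_one_left (deltaReg_nonneg one_pos v)
          (pow_le_one₀ (thetaReg_nonneg one_pos v) (thetaReg_le_one one_pos v))).trans
          (deltaReg_le one_pos v)
      -- For `a < 1` the linear growth costs one of the two factors `exp (-|v|)` available from the
      -- Gaussian.
      have h4 : |max (1 - a * v) 0| ≤ Real.exp |v| := by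
        rw [abs_of_nonneg (le_max_right _ _)]
        refine max_le ?_ (Real.exp_pos _).le
        have h5 : -(a * v) ≤ |v| := by
          refine (neg_le_abs _).trans ?_
          rw [abs_mul, abs_of_pos ha.1]
          exact mul_le_of_le_one_left (abs_nonneg _) ha.2.le
        linarith [Real.add_one_le_exp |v|]
      rw [Real.norm_eq_abs, abs_mul, abs_mul (max _ _)]
      calc _ ≤ (Real.exp (1 ^ 2) / (1 * √Real.pi) * Real.exp (-2 * |v|)) * (Real.exp |v| * C) :=
            mul_le_mul h3 (mul_le_mul h4 (hC _) (abs_nonneg _) (Real.exp_pos _).le)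
              (by positivity) (by positivity)
        _ = Real.exp (1 ^ 2) / (1 * √Real.pi) * C * (Real.exp (-2 * |v|) * Real.exp |v|) := by ring
        _ = _ := by
          rw [← Real.exp_add]
          congr 2
          ring
    · refine Eventually.of_forall fun v => Tendsto.const_mul _ ?_
      have h3 : Tendsto (fun a : ℝ => 1 - a * v) (𝓝[>] 0) (𝓝 1) := by
        have : Tendsto (fun a : ℝ => 1 - a * v) (𝓝 0) (𝓝 (1 - 0 * v)) :=
          Continuous.tendsto (by fun_prop) 0
        rw [zero_mul, sub_zero] at this
        exact this.mono_left nhdsWithin_le_nhds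
      exact (hmax.tendsto 1).comp h3

theorem integrable_mul_layer (hp : 1 ≤ p) {φ : (Fin k → ℝ) → ℝ} (hφ : Continuous φ) {C : ℝ}
    (hC : ∀ u, |φ u| ≤ C) {s : ℝ} (hs : 0 ≤ s) :
    Integrable fun u => φ u * (cutWeight (gauge p u) - cutWeight (s + gauge p u)) :=
  integrable_mul_gauge hp hφ hC (ψ := fun y => cutWeight y - cutWeight (s + y))
    (measurable_cutWeight.sub (measurable_cutWeight.comp (measurable_const_add s)))
    fun _ hy => abs_cutWeight_sub_le hs hy

theorem integrable_mul_smoothLayer (hp : 1 ≤ p) {φ : (Fin k → ℝ) → ℝ} (hφ : Continuous φ) {C : ℝ}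
    (hC : ∀ u, |φ u| ≤ C) {a : ℝ} (ha : 0 < a) (j : ℕ) :
    Integrable fun u => φ u *
      (thetaReg a (1 - gauge p u) ^ j * deltaReg a (1 - gauge p u)) := by
  refine integrable_mul_gauge hp hφ hC
    (ψ := fun y => thetaReg a (1 - y) ^ j * deltaReg a (1 - y)) (Continuous.measurable ?_)
    (B := Real.exp (a ^ 2) / (a * √Real.pi) * Real.exp 2) fun y hy => ?_
  · exact (((continuous_thetaReg ha).comp (by fun_prop)).pow j).mul
      ((continuous_deltaReg a).comp (by fun_prop))
  · rw [abs_mul, abs_pow, abs_of_nonneg (thetaReg_nonneg ha _),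
      abs_of_nonneg (deltaReg_nonneg ha _), mul_assoc, ← Real.exp_add]
    refine (mul_le_of_le_one_left (deltaReg_nonneg ha _) (pow_le_one₀ (thetaReg_nonneg ha _)
      (thetaReg_le_one ha _))).trans ((deltaReg_le ha _).trans (mul_le_mul_of_nonneg_left
      (Real.exp_le_exp.2 ?_) (by positivity)))
    linarith [neg_abs_le (1 - y)]

/-- The two ways to integrate a function over the boundary of the cutoff. -/
theorem exists_boundary (hp : 1 ≤ p) (hkp : (k : ℝ) = 2 * p) {φ : (Fin k → ℝ) → ℝ}
    (hφ : Continuous φ) {C : ℝ} (hC : ∀ u, |φ u| ≤ C) : ∃ b : ℝ,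
    Tendsto (fun s => s⁻¹ * ∫ u, φ u * (cutWeight (gauge p u) - cutWeight (s + gauge p u)))
      (𝓝[>] 0) (𝓝 b) ∧
    ∀ j : ℕ, Tendsto (fun a => ∫ u, φ u *
      (thetaReg a (1 - gauge p u) ^ j * deltaReg a (1 - gauge p u))) (𝓝[>] 0)
      (𝓝 (b / (j + 1))) := by
  obtain ⟨A, hA, ⟨C', hC'⟩, h⟩ := exists_radial_density hp hkp hφ hC
  refine ⟨A 1, (tendsto_layer hA).congr' ?_, fun j => (tendsto_smoothLayer hA hC' j).congr' ?_⟩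
  · filter_upwards [self_mem_nhdsWithin] with s hs
    rw [h (fun y => cutWeight y - cutWeight (s + y))
      (integrable_mul_layer hp hφ hC (le_of_lt hs))]
  · filter_upwards [self_mem_nhdsWithin] with a ha
    rw [h (fun y => thetaReg a (1 - y) ^ j * deltaReg a (1 - y))
      (integrable_mul_smoothLayer hp hφ hC ha j)]

end Boundary

/-! ### Bounded continuous functions -/

section BoundedContinuous

variable {α : Type*} [TopologicalSpace α]

/-- Continuous and bounded. -/
def IsBoundedContinuous (f : α → ℝ) : Prop := Continuous f ∧ ∃ C, ∀ x, |f x| ≤ C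

theorem IsBoundedContinuous.const (c : ℝ) : IsBoundedContinuous fun _ : α => c :=
  ⟨continuous_const, |c|, fun _ => le_rfl⟩

theorem IsBoundedContinuous.mul {f g : α → ℝ} (hf : IsBoundedContinuous f)
    (hg : IsBoundedContinuous g) : IsBoundedContinuous fun x => f x * g x := by
  obtain ⟨hf, C, hC⟩ := hf
  obtain ⟨hg, D, hD⟩ := hg
  refine ⟨hf.mul hg, C * D, fun x => ?_⟩
  rw [abs_mul]
  exact mul_le_mul (hC x) (hD x) (abs_nonneg _) ((abs_nonneg _).trans (hC x))

theorem IsBoundedContinuous.add {f g : α → ℝ} (hf : IsBoundedContinuous f)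
    (hg : IsBoundedContinuous g) : IsBoundedContinuous fun x => f x + g x := by
  obtain ⟨hf, C, hC⟩ := hf
  obtain ⟨hg, D, hD⟩ := hg
  exact ⟨hf.add hg, C + D, fun x => (abs_add_le _ _).trans (add_le_add (hC x) (hD x))⟩

theorem IsBoundedContinuous.sum {ι : Type*} {s : Finset ι} {f : ι → α → ℝ}
    (hf : ∀ i ∈ s, IsBoundedContinuous (f i)) : IsBoundedContinuous fun x => ∑ i ∈ s, f i x := by
  classical
  induction s using Finset.induction_on with
  | empty => simpa using IsBoundedContinuous.const 0
  | insert a s ha ih =>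
    simp only [Finset.sum_insert ha]
    exact (hf a (Finset.mem_insert_self _ _)).add
      (ih fun i hi => hf i (Finset.mem_insert_of_mem hi))

theorem IsBoundedContinuous.pow {f : α → ℝ} (hf : IsBoundedContinuous f) (j : ℕ) :
    IsBoundedContinuous fun x => f x ^ j := by
  induction j with
  | zero => simpa using IsBoundedContinuous.const 1
  | succ j ih =>
    simp only [pow_succ]
    exact ih.mul hf

theorem IsBoundedContinuous.comp {β : Type*} [TopologicalSpace β] {f : α → ℝ}
    (hf : IsBoundedContinuous f) {g : β → α} (hg : Continuous g) :
    IsBoundedContinuous fun x => f (g x) :=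
  ⟨hf.1.comp hg, hf.2.imp fun _ hC x => hC (g x)⟩

theorem IsBoundedContinuous.coeff_pow {S : α → PowerSeries ℝ}
    (hS : ∀ m, IsBoundedContinuous fun x => PowerSeries.coeff m (S x)) (j n : ℕ) :
    IsBoundedContinuous fun x => PowerSeries.coeff n (S x ^ j) := by
  induction j generalizing n with
  | zero => simpa using IsBoundedContinuous.const (PowerSeries.coeff n 1)
  | succ j ih =>
    simp only [pow_succ, PowerSeries.coeff_mul]
    exact IsBoundedContinuous.sum fun x _ => (ih x.1).mul (hS x.2)

end BoundedContinuous

/-! ### The derivative of the self energy -/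

section Derivative

variable {k : ℕ} {p M : ℝ} {T : ℝ → PowerSeries ℝ}

theorem energy_zero (hp : 1 ≤ p) (u : Fin k → ℝ) : energy p id 0 u = gauge p u := by
  rw [energy, id, abs_zero, Real.zero_rpow (by linarith), zero_add]
  rfl

theorem isBoundedContinuous_inv_gauge (hp : 1 ≤ p) (hM : 0 < M) :
    IsBoundedContinuous fun u : Fin k → ℝ => (gauge p u + M)⁻¹ := by
  have hpos : ∀ u : Fin k → ℝ, 0 < gauge p u + M := fun u =>
    add_pos_of_nonneg_of_pos (gauge_nonneg u) hM
  refine ⟨((continuous_gauge (by linarith)).add continuous_const).inv₀ fun u => (hpos u).ne',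
    M⁻¹, fun u => ?_⟩
  rw [abs_inv, abs_of_pos (hpos u)]
  exact inv_anti₀ hM (by linarith [gauge_nonneg (p := p) u])

theorem isBoundedContinuous_coeff_sum
    (hT : ∀ n, IsBoundedContinuous fun v => PowerSeries.coeff n (T v)) (j n : ℕ) :
    IsBoundedContinuous fun u : Fin k → ℝ =>
      PowerSeries.coeff n ((T 0 + ∑ i, T (u i)) ^ j) := by
  refine IsBoundedContinuous.coeff_pow (fun m => ?_) j n
  simp only [map_add, map_sum]
  exact (IsBoundedContinuous.const _).add
    (IsBoundedContinuous.sum fun i _ => (hT m).comp (continuous_apply i))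

theorem isProfile_id (hT0 : ∀ v, PowerSeries.constantCoeff (T v) = 0)
    (hT : ∀ n, IsBoundedContinuous fun v => PowerSeries.coeff n (T v)) (n : ℕ) :
    ∃ C, IsProfile n 0 C id T := by
  choose hc C hC using hT
  refine ⟨∑ m ∈ Finset.range (n + 1), |C m|, measurable_id, fun v => by simp, hT0,
    fun m _ => (hc m).measurable, fun m hm v => ?_⟩
  exact (hC m v).trans ((le_abs_self _).trans (Finset.single_le_sum (f := fun m => |C m|)
    (fun _ _ => abs_nonneg _) (Finset.mem_range.2 (Nat.lt_succ_of_le hm))))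

/-- Order by order the full propagator without cutoff is a finite geometric sum of bounded
continuous terms. -/
theorem isBoundedContinuous_coeff_dressed (hp : 1 ≤ p) (hM : 0 < M)
    (hT0 : ∀ v, PowerSeries.constantCoeff (T v) = 0)
    (hT : ∀ n, IsBoundedContinuous fun v => PowerSeries.coeff n (T v)) (n : ℕ) :
    IsBoundedContinuous fun u : Fin k → ℝ =>
      PowerSeries.coeff n (dressed p M (fun _ => 1) id T 0 u)⁻¹ := by
  have h : ∀ u : Fin k → ℝ, PowerSeries.coeff n (dressed p M (fun _ => 1) id T 0 u)⁻¹ =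
      ∑ j ∈ Finset.range (n + 1), (gauge p u + M)⁻¹ ^ (j + 1) *
        PowerSeries.coeff n ((T 0 + ∑ i, T (u i)) ^ j) := by
    intro u
    rw [dressed, map_one, one_mul, energy_zero hp]
    exact coeff_inv_eq_sum (add_pos_of_nonneg_of_pos (gauge_nonneg u) hM).ne' (by simp [hT0]) n
  simp only [h]
  exact IsBoundedContinuous.sum fun j _ => ((isBoundedContinuous_inv_gauge hp hM).pow _).mul
    (isBoundedContinuous_coeff_sum hT j n)

/-- The regularized boundary term converges to the integral over the boundary. -/
theorem exists_boundary_dressed (hp : 1 ≤ p) (hkp : (k : ℝ) = 2 * p) (hM : 0 < M)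
    (hT0 : ∀ v, PowerSeries.constantCoeff (T v) = 0)
    (hT : ∀ n, IsBoundedContinuous fun v => PowerSeries.coeff n (T v)) (n : ℕ) : ∃ b : ℝ,
    Tendsto (fun s => s⁻¹ * ∫ u : Fin k → ℝ,
      PowerSeries.coeff n (dressed p M (fun _ => 1) id T 0 u)⁻¹ *
        (cutWeight (gauge p u) - cutWeight (s + gauge p u))) (𝓝[>] 0) (𝓝 b) ∧
    Tendsto (fun a => ∫ u : Fin k → ℝ, loopIntegrand p M (boundaryWeight M a)
      (fun y => thetaReg a (1 - y)) n 2 id T 0 u) (𝓝[>] 0) (𝓝 b) := by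
  -- The term with `j` self energy insertions. The shell sees `∑ φ j`, the smeared boundary sees `∑
  -- (j + 1) θ^j φ j`.
  set φ : ℕ → (Fin k → ℝ) → ℝ := fun j u => (gauge p u + M)⁻¹ ^ (j + 1) *
    PowerSeries.coeff n ((T 0 + ∑ i, T (u i)) ^ j) with hφdef
  have hφ : ∀ j, IsBoundedContinuous (φ j) := fun j =>
    ((isBoundedContinuous_inv_gauge hp hM).pow _).mul (isBoundedContinuous_coeff_sum hT j n)
  choose hφc C hC using hφ
  choose b hb hb' using fun j => exists_boundary hp hkp (hφc j) (hC j)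
  have hne : ∀ u : Fin k → ℝ, gauge p u + M ≠ 0 := fun u =>
    (add_pos_of_nonneg_of_pos (gauge_nonneg u) hM).ne'
  refine ⟨∑ j ∈ Finset.range (n + 1), b j, ?_, ?_⟩
  · refine (tendsto_finsetSum (Finset.range (n + 1)) fun j _ => hb j).congr' ?_
    filter_upwards [self_mem_nhdsWithin] with s hs
    rw [← Finset.mul_sum, ← integral_finsetSum _ fun j _ =>
      integrable_mul_layer hp (hφc j) (hC j) (le_of_lt hs)]
    congr 2
    funext u
    rw [← Finset.sum_mul, dressed, map_one, one_mul, energy_zero hp,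
      coeff_inv_eq_sum (hne u) (by simp [hT0]) n]
  · have h1 := tendsto_finsetSum (Finset.range (n + 1)) fun j _ =>
      (hb' j j).const_mul ((j : ℝ) + 1)
    -- Here `j + 1` meets `∫ θ^j δ = 1/(j + 1)`, and the two ways to reach the boundary agree.
    have h2 : ∑ j ∈ Finset.range (n + 1), ((j : ℝ) + 1) * (b j / (j + 1)) =
        ∑ j ∈ Finset.range (n + 1), b j := by
      refine Finset.sum_congr rfl fun j _ => ?_
      field_simp
    rw [h2] at h1
    refine h1.congr' ?_
    filter_upwards [self_mem_nhdsWithin] with a ha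
    rw [Set.mem_Ioi] at ha
    simp only [← integral_const_mul]
    rw [← integral_finsetSum _ fun j _ =>
      (integrable_mul_smoothLayer hp (hφc j) (hC j) ha j).const_mul _]
    congr 1
    funext u
    rw [loopIntegrand, boundaryWeight, dressed, energy_zero hp, mul_right_comm,
      coeff_mul_inv_sq_eq_sum (hne u) (by simp [hT0]) n, Finset.sum_mul]
    refine Finset.sum_congr rfl fun j _ => ?_
    rw [mul_pow, ← map_pow, PowerSeries.coeff_C_mul]
    simp only [hφdef]
    ring

theorem integrable_loopIntegrand_mul (hp : 1 ≤ p) (hM : 0 < M) {n : ℕ} {B R C : ℝ} {W θ : ℝ → ℝ}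
    {f : ℝ → ℝ} (hW : IsWeight B W θ) (hT : IsProfile n R C f T) (r : ℕ) (x : ℝ)
    {ρ : (Fin k → ℝ) → ℝ} (hρ : IsBoundedContinuous ρ) :
    Integrable fun u : Fin k → ℝ => loopIntegrand p M W θ n r f T x u * ρ u := by
  obtain ⟨hρ, A, hA⟩ := hρ
  refine ((integrable_loopIntegrand hp hM hW hT r x).norm.mul_const A).mono'
    ((measurable_loopIntegrand hW hT r).mul hρ.measurable).aestronglyMeasurable
    (Eventually.of_forall fun u => ?_)
  rw [norm_mul]
  exact mul_le_mul_of_nonneg_left (hA u) (norm_nonneg _)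

/-- The resolvent identity. Between momentum 0 and `x` the inverse propagator changes by `|x|^p`
times one minus the difference quotient of `T`. -/
theorem inv_dressed_sub (hM : 0 < M) (hp : 1 ≤ p) (hT0 : ∀ v, PowerSeries.constantCoeff (T v) = 0)
    {x : ℝ} (hx : x ≠ 0) (u : Fin k → ℝ) :
    (dressed p M (fun _ => 1) id T x u)⁻¹ = (dressed p M (fun _ => 1) id T 0 u)⁻¹ +
      PowerSeries.C (|x| ^ p) * ((dressed p M (fun _ => 1) id T x u)⁻¹ *
        (dressed p M (fun _ => 1) id T 0 u)⁻¹ * ((|x| ^ p)⁻¹ • (T x - T 0) - 1)) := by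
  have h1 := PowerSeries.mul_inv_cancel _
    (constantCoeff_dressed_ne_zero (p := p) (θ := fun _ => 1) (f := id) (x := x) hM hT0 u)
  have h2 := PowerSeries.mul_inv_cancel _
    (constantCoeff_dressed_ne_zero (p := p) (θ := fun _ => 1) (f := id) (x := 0) hM hT0 u)
  have hs : |x| ^ p ≠ 0 := (Real.rpow_pos_of_pos (abs_pos.2 hx) p).ne'
  have h3 : dressed p M (fun _ => 1) id T x u = dressed p M (fun _ => 1) id T 0 u -
      PowerSeries.C (|x| ^ p) * ((|x| ^ p)⁻¹ • (T x - T 0) - 1) := by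
    have h4 : energy p id x u = |x| ^ p + energy p id 0 u := by
      rw [energy_zero hp]
      rfl
    rw [mul_sub, PowerSeries.smul_eq_C_mul, ← mul_assoc, ← map_mul, mul_inv_cancel₀ hs, map_one,
      one_mul, mul_one, dressed, dressed, h4, add_assoc, map_add]
    simp only [map_one]
    ring
  generalize (|x| ^ p)⁻¹ • (T x - T 0) - 1 = t at *
  linear_combination (dressed p M (fun _ => 1) id T 0 u)⁻¹ * h1 -
    (dressed p M (fun _ => 1) id T x u)⁻¹ * h2 -
    (dressed p M (fun _ => 1) id T x u)⁻¹ * (dressed p M (fun _ => 1) id T 0 u)⁻¹ * h3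

/-- Two effects of the external momentum are separated: the displacement of the sharp cutoff, with
the propagator kept at zero momentum, and the change of the propagator inside the displaced domain.
The double sum distributes the order over the two propagators and the difference quotient. -/
theorem loopIntegrand_sub (hM : 0 < M) (hp : 1 ≤ p)
    (hT0 : ∀ v, PowerSeries.constantCoeff (T v) = 0) {x : ℝ} (hx : x ≠ 0) (n : ℕ)
    (u : Fin k → ℝ) :
    loopIntegrand p M cutWeight (fun _ => 1) n 1 id T x u =
      loopIntegrand p M cutWeight (fun _ => 1) n 1 id T 0 u -
        PowerSeries.coeff n (dressed p M (fun _ => 1) id T 0 u)⁻¹ *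
          (cutWeight (gauge p u) - cutWeight (|x| ^ p + gauge p u)) +
        ∑ y ∈ antidiagonal n, ∑ z ∈ antidiagonal y.1,
          (|x| ^ p * PowerSeries.coeff y.2 ((|x| ^ p)⁻¹ • (T x - T 0) - 1)) *
          (loopIntegrand p M cutWeight (fun _ => 1) z.1 1 id T x u *
            PowerSeries.coeff z.2 (dressed p M (fun _ => 1) id T 0 u)⁻¹) := by
  have h1 : energy p id x u = |x| ^ p + gauge p u := rfl
  simp only [loopIntegrand, pow_one, energy_zero hp, h1]
  nth_rw 1 [inv_dressed_sub hM hp hT0 hx u]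
  rw [map_add, PowerSeries.coeff_C_mul, PowerSeries.coeff_mul]
  simp only [PowerSeries.coeff_mul, Finset.sum_mul, Finset.mul_sum]
  rw [mul_add, Finset.mul_sum]
  simp only [Finset.mul_sum]
  have h2 : ∀ a b c d e : ℝ, a = b → c * d + a = e * d - d * (e - c) + b := by
    rintro a b c d e rfl
    ring
  refine h2 _ _ _ _ _ (Finset.sum_congr rfl fun y _ => Finset.sum_congr rfl fun z _ => ?_)
  ring

theorem integral_loopIntegrand_sub (hM : 0 < M) (hp : 1 ≤ p)
    (hT0 : ∀ v, PowerSeries.constantCoeff (T v) = 0)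
    (hT : ∀ n, IsBoundedContinuous fun v => PowerSeries.coeff n (T v)) {x : ℝ} (hx : x ≠ 0)
    (n : ℕ) :
    (∫ u : Fin k → ℝ, loopIntegrand p M cutWeight (fun _ => 1) n 1 id T x u) =
      (∫ u : Fin k → ℝ, loopIntegrand p M cutWeight (fun _ => 1) n 1 id T 0 u) -
        (∫ u : Fin k → ℝ, PowerSeries.coeff n (dressed p M (fun _ => 1) id T 0 u)⁻¹ *
          (cutWeight (gauge p u) - cutWeight (|x| ^ p + gauge p u))) +
        ∑ y ∈ antidiagonal n, ∑ z ∈ antidiagonal y.1,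
          (|x| ^ p * PowerSeries.coeff y.2 ((|x| ^ p)⁻¹ • (T x - T 0) - 1)) *
          ∫ u : Fin k → ℝ, loopIntegrand p M cutWeight (fun _ => 1) z.1 1 id T x u *
            PowerSeries.coeff z.2 (dressed p M (fun _ => 1) id T 0 u)⁻¹ := by
  have hH := isBoundedContinuous_coeff_dressed (k := k) hp hM hT0 hT
  have hint : ∀ m, Integrable fun u : Fin k → ℝ =>
      loopIntegrand p M cutWeight (fun _ => 1) m 1 id T 0 u := by
    intro m
    obtain ⟨C, hC⟩ := isProfile_id hT0 hT m
    exact integrable_loopIntegrand hp hM isWeight_cut hC 1 0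
  have hmul : ∀ m e, Integrable fun u : Fin k → ℝ =>
      loopIntegrand p M cutWeight (fun _ => 1) m 1 id T x u *
        PowerSeries.coeff e (dressed p M (fun _ => 1) id T 0 u)⁻¹ := by
    intro m e
    obtain ⟨C, hC⟩ := isProfile_id hT0 hT m
    exact integrable_loopIntegrand_mul hp hM isWeight_cut hC 1 x (hH e)
  obtain ⟨hHc, C, hC⟩ := hH n
  have hlayer := integrable_mul_layer hp hHc hC (Real.rpow_nonneg (abs_nonneg x) p)
  have hsub : Integrable fun u : Fin k → ℝ =>
      loopIntegrand p M cutWeight (fun _ => 1) n 1 id T 0 u -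
        PowerSeries.coeff n (dressed p M (fun _ => 1) id T 0 u)⁻¹ *
          (cutWeight (gauge p u) - cutWeight (|x| ^ p + gauge p u)) := (hint n).sub hlayer
  simp only [loopIntegrand_sub hM hp hT0 hx n]
  rw [integral_add hsub (integrable_finsetSum _ fun y _ =>
      integrable_finsetSum _ fun z _ => (hmul z.1 z.2).const_mul _),
    integral_sub (hint n) hlayer, integral_finsetSum _ fun y _ =>
      integrable_finsetSum _ fun z _ => (hmul z.1 z.2).const_mul _]
  congr 1
  refine Finset.sum_congr rfl fun y _ => ?_
  rw [integral_finsetSum _ fun z _ => (hmul z.1 z.2).const_mul _]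
  simp only [integral_const_mul]

theorem tendsto_abs_rpow (hp : 0 < p) : Tendsto (fun x : ℝ => |x| ^ p) (𝓝[≠] 0) (𝓝[>] 0) := by
  refine tendsto_nhdsWithin_iff.2 ⟨?_, ?_⟩
  · have h : Continuous fun x : ℝ => |x| ^ p := continuous_abs.rpow_const fun _ => Or.inr hp.le
    have h1 := h.tendsto 0
    rw [abs_zero, Real.zero_rpow hp.ne'] at h1
    exact h1.mono_left nhdsWithin_le_nhds
  · filter_upwards [self_mem_nhdsWithin] with x hx
    exact Real.rpow_pos_of_pos (abs_pos.2 hx) p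

/-- After division by `|x|^p`, order `n + 1` of the difference quotient is expressed by its orders
at most `n`, the shell integral and the loop of two propagators at momenta `x` and 0. Induction on
the order gives the limit, and the limiting recursion is the linear equation `hT'`. -/
theorem tendsto_derivative [NeZero k] (hp : 1 ≤ p) (hM : 0 < M)
    (hT0 : ∀ v, PowerSeries.constantCoeff (T v) = 0)
    (hT : ∀ n, IsBoundedContinuous fun v => PowerSeries.coeff n (T v))
    (hself : ∀ n v, PowerSeries.coeff (n + 1) (T v) = -2 * ∫ u : Fin k → ℝ,
      loopIntegrand p M cutWeight (fun _ => 1) n 1 id T v u)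
    {L Bd T' : PowerSeries ℝ}
    (hL : ∀ n, PowerSeries.coeff n L = ∫ u : Fin k → ℝ,
      loopIntegrand p M cutWeight (fun _ => 1) n 2 id T 0 u)
    (hBd : ∀ n, Tendsto (fun s => s⁻¹ * ∫ u : Fin k → ℝ,
      PowerSeries.coeff n (dressed p M (fun _ => 1) id T 0 u)⁻¹ *
        (cutWeight (gauge p u) - cutWeight (s + gauge p u))) (𝓝[>] 0)
        (𝓝 (PowerSeries.coeff n Bd)))
    (hT' : T' * (1 + PowerSeries.C 2 * PowerSeries.X * L) =
      PowerSeries.C 2 * PowerSeries.X * (L + Bd)) :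
    TendstoCoeff (fun x : ℝ => (|x| ^ p)⁻¹ • (T x - T 0)) (𝓝[≠] 0) T' := by
  have hH := isBoundedContinuous_coeff_dressed (k := k) hp hM hT0 hT
  -- The linear equation solved for the term of highest order: the factor `X` makes it a recursion.
  have hT'eq : T' = -(PowerSeries.C 2 * (PowerSeries.X * (L * (T' - 1) - Bd))) := by
    linear_combination hT'
  -- The product of the propagators at `x` and 0 tends to the square at 0, whose integral is the
  -- loop.
  have hP : ∀ a, Tendsto (fun x => ∑ z ∈ antidiagonal a, ∫ u : Fin k → ℝ,
      loopIntegrand p M cutWeight (fun _ => 1) z.1 1 id T x u *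
        PowerSeries.coeff z.2 (dressed p M (fun _ => 1) id T 0 u)⁻¹) (𝓝[≠] 0)
      (𝓝 (PowerSeries.coeff a L)) := by
    intro a
    have h1 : PowerSeries.coeff a L = ∑ z ∈ antidiagonal a, ∫ u : Fin k → ℝ,
        loopIntegrand p M cutWeight (fun _ => 1) z.1 1 id T 0 u *
          PowerSeries.coeff z.2 (dressed p M (fun _ => 1) id T 0 u)⁻¹ := by
      rw [hL, ← integral_finsetSum]
      · congr 1
        funext u
        simp only [loopIntegrand, pow_two, PowerSeries.coeff_mul, Finset.mul_sum, mul_assoc,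
          pow_one]
      · intro z _
        obtain ⟨C, hC⟩ := isProfile_id hT0 hT z.1
        exact integrable_loopIntegrand_mul hp hM isWeight_cut hC 1 0 (hH z.2)
    rw [h1]
    refine tendsto_finsetSum _ fun z _ => ?_
    obtain ⟨C, hC⟩ := isProfile_id hT0 hT z.1
    obtain ⟨hc, A, hA⟩ := hH z.2
    have hid : Tendsto (fun x : ℝ => x) (𝓝[≠] 0) (𝓝 0) := tendsto_id.mono_left nhdsWithin_le_nhds
    exact tendsto_integral_loopIntegrand_mul (F := fun _ => id) (S := fun _ => T) hp hM
      isWeight_cut hT0 rfl (Eventually.of_forall fun _ => hC) hid (fun v => tendsto_const_nhds)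
      (fun m _ => ((hT m).1.tendsto 0).comp hid) (fun m _ v => tendsto_const_nhds) 1 hc.measurable hA
  intro n
  induction n using Nat.strong_induction_on with
  | _ n ih =>
    cases n with
    | zero =>
      rw [hT'eq]
      simp [hT0]
    | succ n =>
      have h1 : PowerSeries.coeff (n + 1) T' = -2 * (∑ y ∈ antidiagonal n,
          PowerSeries.coeff y.1 L * PowerSeries.coeff y.2 (T' - 1) - PowerSeries.coeff n Bd) := by
        conv_lhs => rw [hT'eq]
        rw [map_neg, PowerSeries.coeff_C_mul, PowerSeries.coeff_succ_X_mul, map_sub,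
          PowerSeries.coeff_mul]
        ring
      rw [h1]
      have h2 : Tendsto (fun x : ℝ => ∑ y ∈ antidiagonal n, (∑ z ∈ antidiagonal y.1,
          ∫ u : Fin k → ℝ, loopIntegrand p M cutWeight (fun _ => 1) z.1 1 id T x u *
            PowerSeries.coeff z.2 (dressed p M (fun _ => 1) id T 0 u)⁻¹) *
          PowerSeries.coeff y.2 ((|x| ^ p)⁻¹ • (T x - T 0) - 1)) (𝓝[≠] 0)
          (𝓝 (∑ y ∈ antidiagonal n, PowerSeries.coeff y.1 L *
            PowerSeries.coeff y.2 (T' - 1))) := by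
        refine tendsto_finsetSum _ fun y hy => (hP y.1).mul ?_
        rw [mem_antidiagonal] at hy
        simp only [map_sub (PowerSeries.coeff y.2) _ 1]
        exact (ih y.2 (by omega)).sub_const _
      have h3 := (hBd n).comp (tendsto_abs_rpow (p := p) (by linarith))
      refine ((h2.sub h3).const_mul (-2)).congr' ?_
      filter_upwards [self_mem_nhdsWithin] with x hx
      have hs : |x| ^ p ≠ 0 := (Real.rpow_pos_of_pos (abs_pos.2 hx) p).ne'
      rw [map_smul, map_sub, hself, hself, integral_loopIntegrand_sub hM hp hT0 hT hx n]
      simp only [← Finset.mul_sum, mul_assoc, Function.comp_apply, smul_eq_mul]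
      have h4 : ∀ y : ℕ × ℕ, (∑ z ∈ antidiagonal y.1,
          ∫ u : Fin k → ℝ, loopIntegrand p M cutWeight (fun _ => 1) z.1 1 id T x u *
            PowerSeries.coeff z.2 (dressed p M (fun _ => 1) id T 0 u)⁻¹) *
          PowerSeries.coeff y.2 ((|x| ^ p)⁻¹ • (T x - T 0) - 1) =
          PowerSeries.coeff y.2 ((|x| ^ p)⁻¹ • (T x - T 0) - 1) * ∑ z ∈ antidiagonal y.1,
          ∫ u : Fin k → ℝ, loopIntegrand p M cutWeight (fun _ => 1) z.1 1 id T x u *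
            PowerSeries.coeff z.2 (dressed p M (fun _ => 1) id T 0 u)⁻¹ := fun y => mul_comm _ _
      simp only [h4]
      field_simp
      ring

end Derivative

/-! ### Nonvanishing of the loop -/

section Positivity

variable {k : ℕ} {p M : ℝ} {T : ℝ → PowerSeries ℝ}

theorem integral_loopIntegrand_zero_pos (hp : 1 ≤ p) (hM : 0 < M)
    (hT0 : ∀ v, PowerSeries.constantCoeff (T v) = 0)
    (hT : ∀ n, IsBoundedContinuous fun v => PowerSeries.coeff n (T v)) :
    0 < ∫ u : Fin k → ℝ, loopIntegrand p M cutWeight (fun _ => 1) 0 2 id T 0 u := by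
  obtain ⟨C, hC⟩ := isProfile_id hT0 hT 0
  have h1 : ∀ u : Fin k → ℝ, loopIntegrand p M cutWeight (fun _ => 1) 0 2 id T 0 u =
      cutWeight (gauge p u) * (gauge p u + M)⁻¹ ^ 2 := by
    intro u
    rw [loopIntegrand, energy_zero hp, PowerSeries.coeff_zero_eq_constantCoeff_apply, map_pow,
      PowerSeries.constantCoeff_inv, constantCoeff_dressed hT0, energy_zero hp]
  have hcut : ∀ y, 0 ≤ cutWeight y := by
    intro y
    unfold cutWeight
    split_ifs <;> norm_num
  rw [integral_pos_iff_support_of_nonneg]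
  · have hopen : IsOpen {u : Fin k → ℝ | gauge p u < 1} :=
      isOpen_lt (continuous_gauge (by linarith)) continuous_const
    refine (hopen.measure_pos volume ⟨0, ?_⟩).trans_le (measure_mono fun u hu => ?_)
    · have : gauge p (0 : Fin k → ℝ) = 0 := by
        simp [gauge, Real.zero_rpow (show p ≠ 0 by linarith)]
      rw [Set.mem_ofPred_eq, this]
      exact one_pos
    · rw [Set.mem_ofPred_eq] at hu
      rw [Function.mem_support, h1, cutWeight, if_pos hu.le, one_mul]
      have := add_pos_of_nonneg_of_pos (gauge_nonneg (p := p) u) hM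
      positivity
  · intro u
    simp only [h1]
    exact mul_nonneg (hcut _) (sq_nonneg _)
  · exact integrable_loopIntegrand hp hM isWeight_cut hC 2 0

end Positivity

end TGFT

/-! ### The Ward identity -/

theorem mainTheorem6 (d : ℕ) (hd : 4 ≤ d) (i : Fin d) (mbar : ℝ) (hm : 0 < mbar) :
    -- the self energy is a sum of one-variable functions
    (∀ Λ : ℝ, 0 < Λ → ∀ p : Fin d → ℤ,
      TGFT.selfEnergy d Λ (mbar * Λ) p = ∑ j, TGFT.tau d i Λ (mbar * Λ) (p j)) ∧
    ∃ (τ : ℝ → PowerSeries ℝ) (τ' γ L dτ : PowerSeries ℝ) (B : ℝ → PowerSeries ℝ),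
      -- continuum limit of `τ`, in the variable `x = p / Λ` and in units of `Λ^{2η}`
      (∀ x : ℝ, TGFT.TendstoCoeff
        (fun Λ : ℝ => (Λ ^ (2 * TGFT.eta d))⁻¹ • TGFT.tau d i Λ (mbar * Λ) ⌊Λ * x⌋)
        Filter.atTop (τ x)) ∧
      -- `τ'(0)`, the derivative with respect to `x^{2η}` at `x = 0`
      TGFT.TendstoCoeff (fun x : ℝ => (|x| ^ (2 * TGFT.eta d))⁻¹ • (τ x - τ 0))
        (nhdsWithin 0 {0}ᶜ) τ' ∧
      -- continuum limits of `γ⁽⁴⁾` and of the loop `𝓛`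
      TGFT.TendstoCoeff (fun Λ : ℝ => TGFT.gammaFour d i Λ (mbar * Λ)) Filter.atTop γ ∧
      TGFT.TendstoCoeff (fun Λ : ℝ => TGFT.loop d i Λ (mbar * Λ)) Filter.atTop L ∧
      PowerSeries.constantCoeff L ≠ 0 ∧
      -- `𝓛 ∂τ`: continuum limit of the regularized boundary sum, then removal of the regulator
      (∀ a : ℝ, 0 < a →
        (∀ Λ : ℝ, 0 < Λ → ∀ n, Summable fun q : Fin d → ℤ =>
          PowerSeries.coeff n (TGFT.boundaryTerm d i Λ (mbar * Λ) a q)) ∧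
        TGFT.TendstoCoeff
          (fun Λ : ℝ => PowerSeries.mk fun n => ∑' q : Fin d → ℤ,
            PowerSeries.coeff n (TGFT.boundaryTerm d i Λ (mbar * Λ) a q))
          Filter.atTop (B a)) ∧
      TGFT.TendstoCoeff B (nhdsWithin 0 (Set.Ioi 0)) (L * dτ) ∧
      -- the Ward identity
      PowerSeries.C (1 / 2 : ℝ) * γ * L * (1 + dτ) = τ' := by
  obtain ⟨k, rfl⟩ : ∃ k, d = k + 1 := ⟨d - 1, by omega⟩
  have hk : 2 ≤ k := by omega
  have : NeZero k := ⟨by omega⟩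
  refine ⟨fun Λ hΛ p => TGFT.selfEnergy_eq_sum_tau
    (K := (TGFT.finite_belowCutoff (d := k + 1) (by omega) hΛ.le).toFinset)
    (fun q => Set.Finite.mem_toFinset _) i p, ?_⟩
  have hp := TGFT.one_le_two_eta hk
  have hM : 0 < mbar ^ (2 * TGFT.eta (k + 1)) := Real.rpow_pos_of_pos hm _
  -- The relation `k = 2p` for the exponent `p = 2η`, needed for the polar coordinates.
  have hkp : (k : ℝ) = 2 * (2 * TGFT.eta (k + 1)) := by
    unfold TGFT.eta
    push_cast
    ring
  have hlim := TGFT.continuous_and_tendsto_tauLim hk hm i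
  obtain ⟨_, hT0⟩ := TGFT.exists_isProfile_tauLim hk hm i 0 zero_le_one
  replace hT0 := hT0.const
  have hT : ∀ n, TGFT.IsBoundedContinuous fun v =>
      PowerSeries.coeff n (TGFT.tauLim i mbar v) := by
    intro n
    obtain ⟨C, hC⟩ := TGFT.exists_isProfile_tauLim hk hm i n zero_le_one
    exact ⟨(hlim n).1, C, hC.bound n le_rfl⟩
  choose b hb hb' using TGFT.exists_boundary_dressed hp hkp hM hT0 hT
  set L := TGFT.loopLim i mbar
  have hL0 : PowerSeries.constantCoeff L ≠ 0 := by
    rw [← PowerSeries.coeff_zero_eq_constantCoeff_apply, show L = TGFT.loopLim i mbar from rfl,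
      TGFT.loopLim, PowerSeries.coeff_mk]
    exact (TGFT.integral_loopIntegrand_zero_pos hp hM hT0 hT).ne'
  have hc : PowerSeries.constantCoeff (1 + PowerSeries.C 2 * PowerSeries.X * L) ≠ 0 := by simp
  have hLL : L * L⁻¹ = 1 := PowerSeries.mul_inv_cancel _ hL0
  have hcc := PowerSeries.mul_inv_cancel _ hc
  -- `τ'` is the solution `2λ(𝓛 + b)/(1 + 2λ𝓛)` of the equation for the derivative, `γ⁽⁴⁾` is `4λ/(1
  -- + 2λ𝓛)`, and `∂τ = 𝓛⁻¹ b` is available because the order 0 of the loop is positive.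
  refine ⟨TGFT.tauLim i mbar, PowerSeries.C 2 * PowerSeries.X * (L + PowerSeries.mk b) *
      (1 + PowerSeries.C 2 * PowerSeries.X * L)⁻¹,
    PowerSeries.C 4 * PowerSeries.X * (1 + PowerSeries.C 2 * PowerSeries.X * L)⁻¹, L,
    L⁻¹ * PowerSeries.mk b, TGFT.boundaryLim i mbar, fun x n => (hlim n).2.1 x, ?_,
    TGFT.tendsto_gammaFour hk hm i, TGFT.tendsto_loop hk hm i, hL0,
    fun a ha => ⟨fun Λ hΛ n => TGFT.summable_boundaryTerm hk hm i ha hΛ n,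
      TGFT.tendsto_boundary hk hm i ha⟩, ?_, ?_⟩
  · refine TGFT.tendsto_derivative (L := L) (Bd := PowerSeries.mk b) hp hM hT0 hT
      (fun n v => (hlim (n + 1)).2.2 n rfl v) (fun n => PowerSeries.coeff_mk _ _) (fun n => ?_) ?_
    · rw [PowerSeries.coeff_mk]
      exact hb n
    · linear_combination (PowerSeries.C 2 * PowerSeries.X * (L + PowerSeries.mk b)) * hcc
  · intro n
    rw [← mul_assoc, hLL, one_mul, PowerSeries.coeff_mk]
    simp only [TGFT.boundaryLim, PowerSeries.coeff_mk]
    exact hb' n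
  · have h2 : (PowerSeries.C (1 / 2 : ℝ)) * PowerSeries.C (4 : ℝ) = PowerSeries.C 2 := by
      rw [← map_mul]
      norm_num
    linear_combination (PowerSeries.X * (1 + PowerSeries.C 2 * PowerSeries.X * L)⁻¹ * L *
      (1 + L⁻¹ * PowerSeries.mk b)) * h2 + PowerSeries.C 2 * PowerSeries.X *
      (1 + PowerSeries.C 2 * PowerSeries.X * L)⁻¹ * PowerSeries.mk b * hLL
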